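/- **Setting.** Let $n\ge 2$ and let $(\overline M,\overline J,\overline g)$ be a $2n$-dimensional Kähler–Norden manifold: $\overline g$ is a semi-Riemannian metric and $\overline J$ an almost complex structure with $\overline J^2=-1$, $\overline g(\overline JX,\overline JY)=-\overline g(X,Y)$, and $\overline J$ is parallel for the Levi-Civita connection $\overline\nabla$ of $\overline g$. Let $\overline{\widetilde g}(X,Y)=\overline g(\overline JX,Y)$ be the associated Norden metric and $\overline{\widetilde\nabla}$ its Levi-Civita connection. Curvature tensors are $R(X,Y,Z)=\nabla_X\nabla_YZ-\nabla_Y\nabla_XZ-\nabla_{[X,Y]}Z$, and $\overline R(X,Y,Z,W)=\overline g(\overline R(X,Y,Z),W)$ with $\overline R$ the curvature tensor of $\overline\nabla$. Assume $\overline M$ has constant totally real sectional curvatures with respect to $\overline g$: there are functions $\overline\nu,\overline{\widetilde\nu}:\overline M\to\mathbb R$ such that for every $p$ and every section $\alpha=\mathrm{span}\{x,y\}\subset T_p\overline M$ that is nondegenerate and satisfies $\overline J\alpha\perp\alpha$ (both with respect to $\overline g$), $$\frac{\overline R(x,y,y,x)}{\overline g(x,x)\overline g(y,y)-\overline g(x,y)^2}=\overline\nu(p),\qquad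 \frac{\overline R(x,y,y,\overline Jx)}{\overline g(x,x)\overline g(y,y)-\overline g(x,y)^2}=\overline{\widetilde\nu}(p).$$ Let $M$ be an (immersed) hypersurface of $\overline M$, and let $g,\widetilde g$ be the forms induced on $M$ by $\overline g,\overline{\widetilde g}$. Assume that $(M,\widetilde g)$ is lightlike, i.e. $\mathrm{Rad}\,T_pM=\{v\in T_pM:\widetilde g(v,w)=0\ \forall w\in T_pM\}\neq 0$ for all $p$, and let $S(TM)$ be a screen distribution, i.e. a smooth distribution with $TM=S(TM)\oplus\mathrm{Rad}\,TM$; let $P:TM\to S(TM)$ be the corresponding projection. The transversal bundle $\mathrm{tr}(TM)$ is the line bundle spanned by the vectors $N$ with $$\overline{\widetilde g}(N,\xi)=1,\quad \overline{\widetilde g}(N,N)=0,\quad \overline{\widetilde g}(N,W)=0\ \ \forall W\in S(TM)\qquad(\ast)$$ for some $\xi\in\mathrm{Rad}\,TM$. Assume that $M$ is radical transversal: $\overline J(\mathrm{Rad}\,TM)=\mathrm{tr}(TM)$. Let $\widetilde\nabla$ be the induced connection on $M$ (the $TM$-component of $\overline{\widetilde\nabla}$ in $T\overline M|_M=TM\oplus\mathrm{tr}(TM)$),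 with curvature tensor $\widetilde R$ and Ricci tensor $\widetilde{\mathrm{Ric}}(X,Y)=\mathrm{trace}\{Z\mapsto\widetilde R(Z,X,Y)\}$. On an open set $U\subset M$, a local pair $\{\xi,N\}$ consists of a smooth section $\xi$ of $\mathrm{Rad}\,TM$ and a smooth field $N$ along $M$ satisfying $(\ast)$. It determines $\widetilde B$, the shape operator $\widetilde A_N$, the 1-form $\widetilde\tau$ and the function $\widetilde b$ by $$\overline{\widetilde\nabla}_XY=\widetilde\nabla_XY+\widetilde B(X,Y)N,\qquad \overline{\widetilde\nabla}_XN=-\widetilde A_NX+\widetilde\tau(X)N,\qquad \overline J\xi=\widetilde bN .$$ Assume that $(M,\widetilde g)$ is totally umbilical: around each point there are a local pair and a smooth function $\widetilde\rho$ with $\widetilde B=\widetilde\rho\,\widetilde g$. **Theorem.** Under these assumptions $\overline{\widetilde\nu}=0$ at every point of $M$. Moreover, for every open $U\subset M$, every local pair $\{\xi,N\}$ on $U$ and every smooth $\widetilde\rho$ with $\widetilde B=\widetilde\rho\,\widetilde g$ on $U$, the following holds on $U$: $\widetilde b$ has no zeros, $\widetilde\tau(X)=-\frac1{2\widetilde b}X(\widetilde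 b)$, and $$\widetilde b\,\overline\nu-\widetilde\rho^{\,2}+\xi(\widetilde\rho)+\widetilde\rho\,\widetilde\tau(\xi)=0,$$ $$PX(\widetilde\rho)+\widetilde\rho\,\widetilde\tau(PX)=0,$$ $$\widetilde R(X,Y,Z)=\Bigl(\overline\nu-\frac{\widetilde\rho^{\,2}}{\widetilde b}\Bigr)\bigl[\widetilde g(X,Z)\overline J(PY)-\widetilde g(Y,Z)\overline J(PX)\bigr]+\overline\nu\bigl[\overline{\widetilde g}(X,\overline JZ)Y-\overline{\widetilde g}(Y,\overline JZ)X\bigr],$$ $$\widetilde{\mathrm{Ric}}(X,Y)=2(n-1)\overline\nu\,g(X,Y)-\Bigl(\overline\nu-\frac{\widetilde\rho^{\,2}}{\widetilde b}\Bigr)g(PX,PY)$$ for all vector fields $X,Y,Z$ tangent to $M$. -/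

import Mathlib

open scoped Manifold ContDiff Topology
open Bundle

noncomputable section

namespace NordenLightlike

/-! ### Semi-Riemannian metrics, Levi-Civita connections and curvature -/

section Ambient

variable {E : Type*} [NormedAddCommGroup E] [NormedSpace ℝ E]
  {H : Type*} [TopologicalSpace H] (I : ModelWithCorners ℝ E H)
  {M : Type*} [TopologicalSpace M] [ChartedSpace H M] [IsManifold I ∞ M]

/-- A (not necessarily definite, symmetric or nondegenerate) field of bilinear forms on the tangent
spaces of a manifold. -/
abbrev BilinField (M : Type*) [TopologicalSpace M] [ChartedSpace H M] :=
  ∀ x : M, TangentSpace I x →L[ℝ] TangentSpace I x →L[ℝ] ℝ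

/-- A field of endomorphisms of the tangent spaces of a manifold. -/
abbrev EndField (M : Type*) [TopologicalSpace M] [ChartedSpace H M] :=
  ∀ x : M, TangentSpace I x →L[ℝ] TangentSpace I x

/-- An affine connection, i.e. a covariant derivative on the tangent bundle.
`D Y x v` is `(∇_v Y)(x)`. -/
abbrev AffineConnection (M : Type*) [TopologicalSpace M] [ChartedSpace H M] [IsManifold I ∞ M] :=
  CovariantDerivative I E (fun x : M => TangentSpace I x)

variable {I}

/-- The vector field `X` is smooth at `p`. -/
def IsSmoothFieldAt (X : ∀ x : M, TangentSpace I x) (p : M) : Prop :=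
  CMDiffAt ∞ (T% X) p

/-- `g` is a smooth semi-Riemannian metric. -/
structure IsSemiRiemannianMetric (g : BilinField I M) : Prop where
  symm : ∀ (x : M) (v w : TangentSpace I x), g x v w = g x w v
  nondegenerate : ∀ (x : M) (v : TangentSpace I x), (∀ w, g x v w = 0) → v = 0
  smooth : ContMDiff I (I.prod 𝓘(ℝ, E →L[ℝ] E →L[ℝ] ℝ)) ∞
    (fun x : M => TotalSpace.mk' (E →L[ℝ] E →L[ℝ] ℝ)
      (E := fun x : M => TangentSpace I x →L[ℝ] TangentSpace I x →L[ℝ] ℝ) x (g x))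

/-- `J` is a smooth almost complex structure and `g` is a Norden metric for `J`. -/
structure IsAlmostComplexNorden (J : EndField I M) (g : BilinField I M) : Prop where
  metric : IsSemiRiemannianMetric g
  smooth : ContMDiff I (I.prod 𝓘(ℝ, E →L[ℝ] E)) ∞
    (fun x : M => TotalSpace.mk' (E →L[ℝ] E)
      (E := fun x : M => TangentSpace I x →L[ℝ] TangentSpace I x) x (J x))
  sq : ∀ (x : M) (v : TangentSpace I x), J x (J x v) = -v
  anti : ∀ (x : M) (v w : TangentSpace I x), g x (J x v) (J x w) = -g x v w

/-- The associated metric `g̃(v, w) = g(J v, w)`. -/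
def associated (J : EndField I M) (g : BilinField I M) : BilinField I M :=
  fun x => (g x).comp (J x)

/-- `D` is the Levi-Civita connection of `h`: it is torsion-free and metric. -/
structure IsLeviCivita [FiniteDimensional ℝ E] [CompleteSpace E]
    (h : BilinField I M) (D : AffineConnection I M) : Prop where
  torsion_eq_zero : D.torsion = 0
  metric : ∀ (x : M) (Y Z : ∀ y : M, TangentSpace I y),
    MDiffAt (T% Y) x → MDiffAt (T% Z) x → ∀ v : TangentSpace I x,
      mvfderiv I (fun y => h y (Y y) (Z y)) x v = h x (D Y x v) (Z x) + h x (Y x) (D Z x v)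

/-- `J` is parallel with respect to `D`, i.e. `∇_v (J Y) = J ∇_v Y`. -/
def IsParallel (D : AffineConnection I M) (J : EndField I M) : Prop :=
  ∀ (x : M) (Y : ∀ y : M, TangentSpace I y), MDiffAt (T% Y) x → ∀ v : TangentSpace I x,
    D (fun y => J y (Y y)) x v = J x (D Y x v)

/-- The curvature `R(X, Y, Z) = ∇_X ∇_Y Z - ∇_Y ∇_X Z - ∇_[X, Y] Z` on vector fields. -/
def curvature (D : AffineConnection I M) (X Y Z : ∀ x : M, TangentSpace I x) (x : M) :
    TangentSpace I x :=
  D (fun y => D Z y (Y y)) x (X x) - D (fun y => D Z y (X y)) x (Y x)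
    - D Z x (VectorField.mlieBracket I X Y x)

/-- The curvature tensor at a point, evaluated on tangent vectors by extending them to vector fields
that are smooth near the point. -/
def curvatureAt (D : AffineConnection I M) (x : M) (u v w : TangentSpace I x) :
    TangentSpace I x :=
  curvature D (FiberBundle.extend E u) (FiberBundle.extend E v) (FiberBundle.extend E w) x

instance tangentSpace_finiteDimensional [FiniteDimensional ℝ E] (x : M) :
    FiniteDimensional ℝ (TangentSpace I x) :=
  inferInstanceAs (FiniteDimensional ℝ E)

/-- The Ricci tensor `Ric(u, v) = trace (z ↦ R(z, u, v))`, the trace being written out in a basis. -/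
def ricci [FiniteDimensional ℝ E] (D : AffineConnection I M) (x : M) (u v : TangentSpace I x) : ℝ :=
  ∑ i, (Module.finBasis ℝ (TangentSpace I x)).repr
    (curvatureAt D x (Module.finBasis ℝ (TangentSpace I x) i) u v) i

/-- `π₁(x, y, y, x) = g(y, y) g(x, x) - g(x, y)²`; it is nonzero iff `x`, `y` span a nondegenerate
section. -/
def gram (g : BilinField I M) (p : M) (x y : TangentSpace I p) : ℝ :=
  g p y y * g p x x - g p x y * g p y x

/-- The sectional curvature `ν` of the section spanned by `x` and `y`. -/
def sectionalCurvature (g : BilinField I M) (D : AffineConnection I M) (p : M)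
    (x y : TangentSpace I p) : ℝ :=
  g p (curvatureAt D p x y y) x / gram g p x y

/-- The associated sectional curvature `ν̃` of the section spanned by `x` and `y`. -/
def associatedSectionalCurvature (J : EndField I M) (g : BilinField I M) (D : AffineConnection I M)
    (p : M) (x y : TangentSpace I p) : ℝ :=
  g p (curvatureAt D p x y y) (J p x) / gram g p x y

/-- The section spanned by `x` and `y` is totally real: `J α` is orthogonal to `α`. -/
def IsTotallyReal (J : EndField I M) (g : BilinField I M) (p : M) (x y : TangentSpace I p) : Prop :=
  ∀ u ∈ Submodule.span ℝ {x, y}, ∀ v ∈ Submodule.span ℝ {x, y}, g p (J p u) v = 0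

/-- The two totally real sectional curvatures with respect to `g` depend only on the point, and are
given by the functions `ν` and `ν'`. -/
def HasConstantTotallyRealCurvatures (J : EndField I M) (g : BilinField I M)
    (D : AffineConnection I M) (ν ν' : M → ℝ) : Prop :=
  ∀ (p : M) (x y : TangentSpace I p), gram g p x y ≠ 0 → IsTotallyReal J g p x y →
    sectionalCurvature g D p x y = ν p ∧ associatedSectionalCurvature J g D p x y = ν' p

end Ambient

/-! ### Hypersurfaces

`f : M → N` is the immersion of the hypersurface `M` in the ambient manifold `N`, and `h` is a
metric of `N` with Levi-Civita connection `D`. -/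

section Hypersurface

variable {E : Type*} [NormedAddCommGroup E] [NormedSpace ℝ E]
  {H : Type*} [TopologicalSpace H] {I : ModelWithCorners ℝ E H}
  {M : Type*} [TopologicalSpace M] [ChartedSpace H M] [IsManifold I ∞ M]
  {E' : Type*} [NormedAddCommGroup E'] [NormedSpace ℝ E']
  {H' : Type*} [TopologicalSpace H'] {I' : ModelWithCorners ℝ E' H'}
  {N : Type*} [TopologicalSpace N] [ChartedSpace H' N] [IsManifold I' ∞ N]

/-- The covariant derivative `∇_v σ` at `p` of a vector field `σ` along `f` (the pull-back of the
connection `D`). In the trivialization `e` of `TN` around `f p`, this is the derivative of the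
coordinates of `σ`, plus the derivative in the direction `df v` of the field which has constant
coordinates and agrees with `σ` at `p`. In particular `∇_v (Y ∘ f) = ∇_{df v} Y`. -/
def covAlong (f : M → N) (D : AffineConnection I' N) (σ : ∀ q : M, TangentSpace I' (f q)) (p : M)
    (v : TangentSpace I p) : TangentSpace I' (f p) :=
  let e := trivializationAt E' (fun y : N => TangentSpace I' y) (f p)
  let c : M → E' := fun q => (e (TotalSpace.mk' E' (f q) (σ q))).2
  e.symm (f p) (mvfderiv I c p v) + D (fun y => e.symm y (c p)) (f p) (mfderiv I I' f p v)

variable (I)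

/-- The induced symmetric form on the hypersurface: the pull-back of `h`. -/
def induced (f : M → N) (h : BilinField I' N)
    (p : M) (v w : TangentSpace I p) : ℝ :=
  h (f p) (mfderiv I I' f p v) (mfderiv I I' f p w)

/-- The radical `Rad T_pM`: tangent vectors of `M` that are normal to `M`. -/
def radical (f : M → N) (h : BilinField I' N)
    (p : M) : Submodule ℝ (TangentSpace I p) where
  carrier := {v | ∀ w, induced I f h p v w = 0}
  zero_mem' := by intro w; simp [induced]
  add_mem' := by
    intro a b ha hb w
    have h1 := ha w
    have h2 := hb w
    simp only [induced] at h1 h2 ⊢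
    simp [h1, h2]
  smul_mem' := by
    intro c a ha w
    have h1 := ha w
    simp only [induced] at h1 ⊢
    simp [h1]

/-- A screen distribution: a smooth distribution complementary to the radical. -/
structure ScreenDistribution (f : M → N) (h : BilinField I' N) where
  space : ∀ p : M, Submodule ℝ (TangentSpace I p)
  isCompl : ∀ p, IsCompl (space p) (radical I f h p)
  smooth : ∀ (p : M), ∀ v ∈ space p, ∃ X : ∀ q : M, TangentSpace I q,
    IsSmoothFieldAt X p ∧ X p = v ∧ ∀ᶠ q in 𝓝 p, X q ∈ space q

variable {I}

/-- The projection `P` of `TM` onto the screen distribution along the radical. -/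
def ScreenDistribution.proj {f : M → N} {h : BilinField I' N} (S : ScreenDistribution I f h)
    (p : M) : TangentSpace I p →ₗ[ℝ] TangentSpace I p :=
  (S.space p).projection (radical I f h p) (S.isCompl p)

/-- `n` is the transversal vector at `p` paired with `ξ`:
`h(n, ξ) = 1` and `h(n, n) = h(n, W) = 0` for all `W` in the screen. -/
def IsTransversalPair {f : M → N} {h : BilinField I' N} (S : ScreenDistribution I f h) (p : M)
    (ξ : TangentSpace I p) (n : TangentSpace I' (f p)) : Prop :=
  h (f p) n (mfderiv I I' f p ξ) = 1 ∧ h (f p) n n = 0 ∧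
    ∀ w ∈ S.space p, h (f p) n (mfderiv I I' f p w) = 0

/-- The fibre at `p` of the transversal bundle `tr(TM)`. -/
def transversal {f : M → N} {h : BilinField I' N} (S : ScreenDistribution I f h) (p : M) :
    Submodule ℝ (TangentSpace I' (f p)) :=
  Submodule.span ℝ {n | ∃ ξ ∈ radical I f h p, IsTransversalPair S p ξ n}

/-- The hypersurface with screen distribution `S` is a radical transversal lightlike hypersurface:
the radical is nonzero everywhere, and `J` maps it onto the transversal bundle. -/
structure IsRadicalTransversalLightlike {f : M → N} {h : BilinField I' N} (J : EndField I' N)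
    (S : ScreenDistribution I f h) : Prop where
  lightlike : ∀ p : M, radical I f h p ≠ ⊥
  radical_transversal : ∀ p : M,
    ((radical I f h p).map (mfderiv I I' f p).toLinearMap).map (J (f p)).toLinearMap
      = transversal S p

/-- `∇` is the connection induced on the hypersurface by `D` and the transversal bundle: `∇_v Y` is
the tangential part of `D_v Y` in the decomposition `TN = TM ⊕ tr(TM)`. -/
def IsInducedConnection {f : M → N} {h : BilinField I' N} (D : AffineConnection I' N)
    (S : ScreenDistribution I f h) (C : AffineConnection I M) : Prop :=
  ∀ (p : M) (Y : ∀ q : M, TangentSpace I q), IsSmoothFieldAt Y p → ∀ v : TangentSpace I p,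
    covAlong f D (fun q => mfderiv I I' f q (Y q)) p v - mfderiv I I' f p (C Y p v)
      ∈ transversal S p

/-- `{ξ, n}` is a smooth local pair on `U`, with `ξ` a section of the radical and `n` the section
of the transversal bundle paired with it. -/
structure IsLocalPair {f : M → N} {h : BilinField I' N} (S : ScreenDistribution I f h) (U : Set M)
    (ξ : ∀ q : M, TangentSpace I q) (n : ∀ q : M, TangentSpace I' (f q)) : Prop where
  smooth_left : CMDiff[U] ∞ (T% ξ)
  smooth_right : ContMDiffOn I I'.tangent ∞
    (fun q => (TotalSpace.mk' E' (f q) (n q) : TangentBundle I' N)) U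
  mem_radical : ∀ p ∈ U, ξ p ∈ radical I f h p
  isTransversalPair : ∀ p ∈ U, IsTransversalPair S p (ξ p) (n p)

/-- The Gauss formula `D_X Y = ∇_X Y + B(X, Y) n` on `U`, which defines the local second fundamental
form `B` relative to `n`. -/
def GaussFormula (f : M → N) (D : AffineConnection I' N) (C : AffineConnection I M) (U : Set M)
    (n : ∀ q : M, TangentSpace I' (f q)) (B : BilinField I M) : Prop :=
  ∀ p ∈ U, ∀ Y : (∀ q : M, TangentSpace I q), IsSmoothFieldAt Y p → ∀ v : TangentSpace I p,
    covAlong f D (fun q => mfderiv I I' f q (Y q)) p v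
      = mfderiv I I' f p (C Y p v) + B p v (Y p) • n p

/-- The Weingarten formula `D_X n = -A X + τ(X) n` on `U`, which defines the shape operator `A` and
the `1`-form `τ`. -/
def WeingartenFormula (f : M → N) (D : AffineConnection I' N) (U : Set M)
    (n : ∀ q : M, TangentSpace I' (f q)) (A : EndField I M)
    (τ : ∀ q : M, TangentSpace I q →L[ℝ] ℝ) : Prop :=
  ∀ p ∈ U, ∀ v : TangentSpace I p,
    covAlong f D n p v = -mfderiv I I' f p (A p v) + τ p v • n p

/-- The second fundamental form `B` is proportional to the induced metric on `U`, with a smooth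
factor `ρ`. -/
structure IsUmbilicalOn (f : M → N) (h : BilinField I' N) (U : Set M) (B : BilinField I M)
    (ρ : M → ℝ) : Prop where
  smooth : CMDiff[U] ∞ ρ
  eq : ∀ p ∈ U, ∀ v w : TangentSpace I p, B p v w = ρ p * induced I f h p v w

/-- The hypersurface is totally umbilical: around each point there are a local pair `{ξ, n}` and a
smooth function `ρ` such that the second fundamental form is `ρ` times the induced metric. -/
def IsTotallyUmbilical {f : M → N} {h : BilinField I' N} (D : AffineConnection I' N)
    (S : ScreenDistribution I f h) (C : AffineConnection I M) : Prop :=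
  ∀ p : M, ∃ U : Set M, IsOpen U ∧ p ∈ U ∧
    ∃ (ξ : ∀ q : M, TangentSpace I q) (n : ∀ q : M, TangentSpace I' (f q)) (B : BilinField I M)
      (ρ : M → ℝ), IsLocalPair S U ξ n ∧ GaussFormula f D C U n B ∧ IsUmbilicalOn f h U B ρ

end Hypersurface

end NordenLightlike

end

noncomputable section

namespace NordenLightlike

set_option synthInstance.maxHeartbeats 200000

/-! ### Algebraic curvature tensors -/

/-! Since $J$ is parallel, the Levi-Civita connection $\nabla$ of $g$ also preserves $\tilde
g=g(J\cdot,\cdot)$. It is torsion-free, so by uniqueness it is the Levi-Civita connection of $\tilde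
g$ as well (`christoffel_associated`). The ambient geometry is therefore a single curvature tensor
$R$ together with two forms.

$R$ is complex linear for the structure $J$ (`IsKaehlerNordenCurvature.apply_left`). Lowered with
the complex bilinear form $h=g-i\tilde g$ it becomes a complex curvature tensor, and an
$h$-orthonormal pair is the same as a $g$-orthonormal pair spanning a totally real section. Complex
square roots normalise every non-null vector, and perturbation by a parameter reaches the null ones.
Hence $\nu,\nu'$ determine $R$ completely (`eq_spaceFormCurvature`).

On the hypersurface $J\xi=bN$. Differentiating $\tilde g(\xi,w)=0$ and $\tilde g(N,\xi)=1$ with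
$B=\rho\tilde g$ gives $\nabla_u\xi=-\rho Pu-\tau(u)\xi$ (`covariant_radical`). Applying $J$ and
comparing with the derivative of $bN$ gives $\tau=-db/2b$ and $\nabla_uN=-(\rho/b)JPu+\tau(u)N$
(`covariant_transversal`). This is inserted in the Gauss-Codazzi equation (`gauss_codazzi`), and
pairing with $\xi$ isolates the transversal part (`codazzi_spaceForm`). At $(\xi,Pu,w)$ for all $w$,
that part says that a combination of $JPu$ and $Pu$ is orthogonal to everything. A nonzero vector
and its $J$-image are independent, so both coefficients vanish: one is $\nu'b$, the other is the
equation for $\rho$ along $\xi$. At $(Pu,JPu,w)$ the same argument gives the equation along the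
screen. The tangential part is the curvature formula (`fundamental_equations`). Its trace is the
Ricci formula, because $K=JP$ satisfies $K^3=-K$ and so has trace zero (`ricci_equation`).

The computations are made in charts, with germs of maps between vector spaces. The connections are
not assumed smooth, so differentiability of their Christoffel symbols is derived: from the Koszul
formula in the ambient space (`differentiableAt_christoffel`), from the Gauss formula on the
hypersurface (`differentiableAt_of_pushforward`). `hypersurface_equations` carries the result back
to the manifold. -/

/-- `K` is a complex algebraic curvature tensor. -/
structure IsComplexCurvatureLike {V : Type*} [AddCommGroup V] [Module ℂ V]
    (K : V → V → V → V → ℂ) : Prop where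
  add : ∀ x x' y z w, K (x + x') y z w = K x y z w + K x' y z w
  smul : ∀ (c : ℂ) x y z w, K (c • x) y z w = c * K x y z w
  antisymm : ∀ x y z w, K x y z w = -K y x z w
  skew : ∀ x y z w, K x y z w = -K x y w z
  bianchi : ∀ x y z w, K x y z w + K y z x w + K z x y w = 0

namespace IsComplexCurvatureLike

variable {V : Type*} [AddCommGroup V] [Module ℂ V] {K : V → V → V → V → ℂ}

/-- The octahedron argument: combine the four Bianchi sums, one for each choice of last argument,
and cancel by the two skew symmetries. -/
lemma pair_symm (hK : IsComplexCurvatureLike K) (x y z w : V) : K x y z w = K z w x y := by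
  have h1 := hK.bianchi x y z w
  have h2 := hK.bianchi y z w x
  have h3 := hK.bianchi z w x y
  have h4 := hK.bianchi w x y z
  have a1 := hK.skew y z x w
  have a2 := hK.skew z x y w
  have a3 := hK.skew x y z w
  have a4 := hK.skew z w y x
  have a5 := hK.skew w y z x
  have a6 := hK.skew w x z y
  have a7 := hK.skew x z w y
  have b1 := hK.antisymm z x w y
  have b2 := hK.antisymm w y x z
  have b3 := hK.skew y w x z
  have b4 := hK.antisymm w y z x
  grind

lemma add₂ (hK : IsComplexCurvatureLike K) (x y y' z w : V) :
    K x (y + y') z w = K x y z w + K x y' z w := by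
  rw [hK.antisymm, hK.add, hK.antisymm y, hK.antisymm y']; ring

lemma smul₂ (hK : IsComplexCurvatureLike K) (c : ℂ) (x y z w : V) :
    K x (c • y) z w = c * K x y z w := by
  rw [hK.antisymm, hK.smul, hK.antisymm y]; ring

lemma add₃ (hK : IsComplexCurvatureLike K) (x y z z' w : V) :
    K x y (z + z') w = K x y z w + K x y z' w := by
  rw [hK.pair_symm, hK.add, hK.pair_symm z, hK.pair_symm z']

lemma smul₃ (hK : IsComplexCurvatureLike K) (c : ℂ) (x y z w : V) :
    K x y (c • z) w = c * K x y z w := by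
  rw [hK.pair_symm, hK.smul, hK.pair_symm z]

lemma add₄ (hK : IsComplexCurvatureLike K) (x y z w w' : V) :
    K x y z (w + w') = K x y z w + K x y z w' := by
  rw [hK.pair_symm, hK.add₂, hK.pair_symm z, hK.pair_symm z]

lemma smul₄ (hK : IsComplexCurvatureLike K) (c : ℂ) (x y z w : V) :
    K x y z (c • w) = c * K x y z w := by
  rw [hK.pair_symm, hK.smul₂, hK.pair_symm z]

lemma self_left (hK : IsComplexCurvatureLike K) (x z w : V) : K x x z w = 0 := by
  linear_combination (1 / 2 : ℂ) * hK.antisymm x x z w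

lemma self_right (hK : IsComplexCurvatureLike K) (x y z : V) : K x y z z = 0 := by
  linear_combination (1 / 2 : ℂ) * hK.skew x y z z

/-- A curvature tensor is determined by its biquadratic form. -/
theorem eq_zero_of_biquadratic (hK : IsComplexCurvatureLike K)
    (h0 : ∀ x y, K x y y x = 0) (x y z w : V) : K x y z w = 0 := by
  -- Polarisation in the outer pair; pair symmetry makes the two cross terms equal.
  have h1 : ∀ x y w, K x y y w = 0 := by
    intro x y w
    have h := h0 (x + w) y
    rw [hK.add, hK.add₄, hK.add₄, h0, h0] at h
    have h2 : K w y y x = K x y y w := by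
      rw [hK.pair_symm, hK.antisymm, hK.skew, neg_neg]
    linear_combination (1 / 2 : ℂ) * h - (1 / 2 : ℂ) * h2
  have h2 : ∀ x y z w, K x y z w = -K x z y w := by
    intro x y z w
    have h := h1 x (y + z) w
    rw [hK.add₂, hK.add₃, hK.add₃, h1, h1] at h
    linear_combination h
  have h3 := hK.bianchi x y z w
  have h4 := h2 y z x w
  have h5 := hK.antisymm y x z w
  have h6 := hK.antisymm z x y w
  have h7 := h2 x z y w
  -- Now `K` is alternating in its first three arguments, so the three Bianchi terms coincide.
  linear_combination (1 / 3 : ℂ) * h3 - (1 / 3 : ℂ) * h4 + (1 / 3 : ℂ) * h5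
    - (1 / 3 : ℂ) * h6 + (1 / 3 : ℂ) * h7

/-- For a null vector $y$ and a non-null $z$, this makes both $y\pm tz$ non-null. Adding the
biquadratic form at $t$ and at $-t$ removes the odd term, so its vanishing passes from non-null to
null vectors. The choice $t=4a/c$ turns the two values into $24a^2/c$ and $8a^2/c$. -/
lemma exists_good_parameter (a c : ℂ) (hc : c ≠ 0) :
    ∃ t : ℂ, t ≠ 0 ∧ 2 * t * a + t ^ 2 * c ≠ 0 ∧ 2 * (-t) * a + (-t) ^ 2 * c ≠ 0 := by
  by_cases ha : a = 0
  · exact ⟨1, one_ne_zero, by simpa [ha] using hc, by simpa [ha] using hc⟩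
  · refine ⟨4 * a / c, by simp [ha, hc], ?_, ?_⟩
    · have : 2 * (4 * a / c) * a + (4 * a / c) ^ 2 * c = 24 * a ^ 2 / c := by field_simp; ring
      rw [this]; simp [ha, hc]
    · have : 2 * -(4 * a / c) * a + (-(4 * a / c)) ^ 2 * c = 8 * a ^ 2 / c := by
        field_simp; ring
      rw [this]; simp [ha, hc]

/-- A complex curvature tensor vanishes if its sectional curvatures vanish on all orthonormal pairs
of a nondegenerate complex symmetric form. -/
theorem eq_zero_of_orthonormal (hK : IsComplexCurvatureLike K)
    (h : V →ₗ[ℂ] V →ₗ[ℂ] ℂ) (hsymm : ∀ x y, h x y = h y x)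
    (hnd : ∀ x, (∀ y, h x y = 0) → x = 0) (hdim : ∀ x, ∃ w, w ≠ 0 ∧ h x w = 0)
    (h0 : ∀ x y, h x x = 1 → h y y = 1 → h x y = 0 → K x y y x = 0) (x y z w : V) :
    K x y z w = 0 := by
  -- Every non-null vector can be normalised over $\mathbb C$; over $\mathbb R$ the sign of $h(x,x)$
  -- would obstruct this.
  have scale : ∀ x, h x x ≠ 0 → ∃ c : ℂ, c ≠ 0 ∧ h (c • x) (c • x) = 1 := by
    intro x hx
    obtain ⟨s, hs⟩ := IsAlgClosed.exists_pow_nat_eq (h x x) (n := 2) (by norm_num)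
    have hs0 : s ≠ 0 := by rintro rfl; simp at hs; exact hx hs.symm
    refine ⟨s⁻¹, inv_ne_zero hs0, ?_⟩
    simp only [map_smul, LinearMap.smul_apply, smul_eq_mul, ← hs]
    field_simp
  have orth : ∀ x y, h x x ≠ 0 → h y y ≠ 0 → h x y = 0 → K x y y x = 0 := by
    intro x y hx hy hxy
    obtain ⟨c, hc, hcx⟩ := scale x hx
    obtain ⟨d, hd, hdy⟩ := scale y hy
    have := h0 (c • x) (d • y) hcx hdy (by simp [hxy])
    rw [hK.smul, hK.smul₂, hK.smul₃, hK.smul₄] at this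
    simpa [hc, hd] using this
  have polar : ∀ x y, h (x + y) (x + y) = h x x + 2 * h x y + h y y := by
    intro x y
    simp only [map_add, LinearMap.add_apply, hsymm y x]; ring
  -- If $x^\perp$ were totally null, the vector $w\in x^\perp$ given by `hdim` would be orthogonal
  -- to $x^\perp$ and to $x$, hence to everything.
  have exists_orth : ∀ x, h x x ≠ 0 → ∃ z, h x z = 0 ∧ h z z ≠ 0 := by
    intro x hx
    by_contra! hcon
    obtain ⟨w, hw, hxw⟩ := hdim x
    refine hw (hnd w fun y ↦ ?_)
    have hy' : h x (y - (h x y / h x x) • x) = 0 := by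
      simp only [map_sub, map_smul, smul_eq_mul]; field_simp; ring
    have h1 := hcon _ (show h x (w + (y - (h x y / h x x) • x)) = 0 by rw [map_add, hxw, hy', add_zero])
    rw [polar, hcon _ hxw, hcon _ hy', map_sub, map_smul, hsymm w x, hxw] at h1
    simpa using h1
  have perp : ∀ x y, h x x ≠ 0 → h x y = 0 → K x y y x = 0 := by
    intro x y hx hxy
    obtain ⟨z, hxz, hz⟩ := exists_orth x hx
    obtain ⟨t, ht, ht1, ht2⟩ := exists_good_parameter (h y z) (h z z) hz
    by_cases hy : h y y = 0
    · have e : ∀ t, h (y + t • z) (y + t • z) = 2 * t * h y z + t ^ 2 * h z z := by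
        intro t
        rw [polar, hy]; simp only [map_smul, LinearMap.smul_apply, smul_eq_mul]; ring
      have k : ∀ t, K x (y + t • z) (y + t • z) x = K x y y x
          + t * (K x y z x + K x z y x) + t ^ 2 * K x z z x := by
        intro t
        rw [hK.add₂, hK.add₃, hK.add₃, hK.smul₂, hK.smul₂, hK.smul₃, hK.smul₃]; ring
      have k0 := orth x z hx hz hxz
      have k1 := orth x (y + t • z) hx (by rw [e]; exact ht1) (by simp [hxy, hxz])
      have k2 := orth x (y + (-t) • z) hx (by rw [e]; exact ht2) (by simp [hxy, hxz])
      rw [k, k0] at k1 k2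
      linear_combination (1 / 2 : ℂ) * k1 + (1 / 2 : ℂ) * k2
    · exact orth x y hx hy hxy
  -- Removing from $y$ its component along $x$ does not change $K(x,y,y,x)$.
  have nonnull : ∀ x y, h x x ≠ 0 → K x y y x = 0 := by
    intro x y hx
    have h1 := perp x (y + (-(h x y / h x x)) • x) hx (by
      simp only [map_add, map_smul, smul_eq_mul]; field_simp; ring)
    rw [hK.add₂, hK.add₃, hK.add₃, hK.smul₂, hK.smul₂, hK.smul₃, hK.smul₃, hK.self_left,
      hK.self_right, hK.self_left] at h1
    linear_combination h1
  refine hK.eq_zero_of_biquadratic (fun x y ↦ ?_) x y z w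
  by_cases hx : h x x = 0
  · obtain ⟨z, hz⟩ : ∃ z, h z z ≠ 0 := by
      by_contra! hcon
      obtain ⟨w, hw, -⟩ := hdim x
      refine hw (hnd w fun y ↦ ?_)
      have := polar w y
      rw [hcon, hcon, hcon] at this
      simpa using this
    obtain ⟨t, ht, ht1, ht2⟩ := exists_good_parameter (h x z) (h z z) hz
    have e : ∀ t, h (x + t • z) (x + t • z) = 2 * t * h x z + t ^ 2 * h z z := by
      intro t
      rw [polar, hx]; simp only [map_smul, LinearMap.smul_apply, smul_eq_mul]; ring
    have k : ∀ t, K (x + t • z) y y (x + t • z) = K x y y x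
        + t * (K x y y z + K z y y x) + t ^ 2 * K z y y z := by
      intro t
      rw [hK.add, hK.add₄, hK.add₄, hK.smul, hK.smul, hK.smul₄, hK.smul₄]; ring
    have k0 := nonnull z y hz
    have k1 := nonnull (x + t • z) y (by rw [e]; exact ht1)
    have k2 := nonnull (x + (-t) • z) y (by rw [e]; exact ht2)
    rw [k, k0] at k1 k2
    linear_combination (1 / 2 : ℂ) * k1 + (1 / 2 : ℂ) * k2
  · exact nonnull x y hx

end IsComplexCurvatureLike

/-- Real curvature tensors of Kähler-Norden type on a vector space with complex structure `J` and
Norden form `g`. -/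
structure IsKaehlerNordenCurvature {V : Type*} [AddCommGroup V] [Module ℝ V]
    (J : V →ₗ[ℝ] V) (g : V →ₗ[ℝ] V →ₗ[ℝ] ℝ) (R : V → V → V → V) : Prop where
  add : ∀ x x' y z, R (x + x') y z = R x y z + R x' y z
  smul : ∀ (c : ℝ) x y z, R (c • x) y z = c • R x y z
  antisymm : ∀ x y z, R x y z = -R y x z
  skew : ∀ x y z w, g (R x y z) w = -g (R x y w) z
  bianchi : ∀ x y z, R x y z + R y z x + R z x y = 0
  parallel : ∀ x y z, R x y (J z) = J (R x y z)

/-- The standard tensors of Kähler-Norden type. -/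
def spaceFormCurvature {V : Type*} [AddCommGroup V] [Module ℝ V]
    (J : V →ₗ[ℝ] V) (g : V →ₗ[ℝ] V →ₗ[ℝ] ℝ) (ν ν' : ℝ) (x y z : V) : V :=
  ν • (g y z • x - g x z • y - g (J y) z • J x + g (J x) z • J y)
    - ν' • (g y z • J x - g x z • J y + g (J y) z • x - g (J x) z • y)

/-! ### Kähler–Norden curvature tensors on a real vector space -/

section RealAlgebra

variable {V : Type*} [AddCommGroup V] [Module ℝ V]
  {J : V →ₗ[ℝ] V} {g : V →ₗ[ℝ] V →ₗ[ℝ] ℝ}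

lemma norden_self_adjoint (hJ : ∀ v, J (J v) = -v)
    (hanti : ∀ v w, g (J v) (J w) = -g v w) (v w : V) : g (J v) w = g v (J w) := by
  have := hanti v (J w)
  rw [hJ, map_neg] at this
  linarith

/-- The Kähler-Norden curvature is complex linear. -/
lemma IsKaehlerNordenCurvature.apply_left {R : V → V → V → V}
    (hR : IsKaehlerNordenCurvature J g R) (hJ : ∀ v, J (J v) = -v)
    (hanti : ∀ v w, g (J v) (J w) = -g v w)
    (hnd : ∀ v, (∀ w, g v w = 0) → v = 0) (x y z : V) : R (J x) y z = J (R x y z) := by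
  have hself := norden_self_adjoint hJ hanti
  have radd : ∀ x y z w, g (R x y z) w = g (R z w x) y := by
    intro x y z w
    have e : ∀ x y z w, g (R x y z + R y z x + R z x y) w = 0 := by
      intro x y z w; rw [hR.bianchi]; simp
    have as : ∀ x y z w, g (R x y z) w = -g (R y x z) w := by
      intro x y z w; rw [hR.antisymm]; simp
    have h1 := e x y z w
    have h2 := e y z w x
    have h3 := e z w x y
    have h4 := e w x y z
    simp only [map_add, LinearMap.add_apply] at h1 h2 h3 h4
    have a1 := hR.skew y z x w
    have a2 := hR.skew z x y w
    have a3 := hR.skew x y z w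
    have a4 := hR.skew z w y x
    have a5 := hR.skew w y z x
    have a6 := hR.skew w x z y
    have a7 := hR.skew x z w y
    have b1 := as z x w y
    have b2 := as w y x z
    have b3 := hR.skew y w x z
    have b4 := as w y z x
    linarith
  -- Pair symmetry moves `J` from the first pair to the last, where `parallel` and self-adjointness
  -- carry it across.
  have swap : ∀ x y z, R (J x) y z = R x (J y) z := by
    intro x y z
    refine sub_eq_zero.mp (hnd _ fun w ↦ ?_)
    rw [map_sub, LinearMap.sub_apply, radd, radd x, hR.parallel, hself, sub_self]
  -- The defect of complex linearity changes sign under a cyclic rotation of its arguments. Three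
  -- rotations are the identity, so the defect equals its own negative.
  have key : ∀ x y z, (R (J x) y z - J (R x y z)) = -(R (J z) x y - J (R z x y)) := by
    intro x y z
    have h1 := hR.bianchi (J x) y z
    rw [hR.parallel, ← swap z x y] at h1
    have h2 : J (R x y z + R y z x + R z x y) = 0 := by rw [hR.bianchi, map_zero]
    rw [map_add, map_add] at h2
    have h3 : R (J x) y z = -(J (R y z x) + R (J z) x y) := by
      rw [← sub_eq_zero, ← h1]; abel
    have h4 : J (R x y z) = -(J (R y z x) + J (R z x y)) := by
      rw [← sub_eq_zero, ← h2]; abel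
    rw [h3, h4]; abel
  have h1 := key x y z
  rw [key z x y, key y z x, neg_neg] at h1
  have h2 : (2 : ℝ) • (R (J x) y z - J (R x y z)) = 0 := by
    rw [two_smul]; nth_rewrite 1 [h1]; abel
  exact sub_eq_zero.mp ((smul_eq_zero.mp h2).resolve_left two_ne_zero)

/-- The model must have all the symmetries of $R$, so that the difference of the two is again a
complex curvature tensor. -/
lemma spaceForm_isKaehlerNordenCurvature (hJ : ∀ v, J (J v) = -v)
    (hanti : ∀ v w, g (J v) (J w) = -g v w) (hsymm : ∀ v w, g v w = g w v) (ν ν' : ℝ) :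
    IsKaehlerNordenCurvature J g (spaceFormCurvature J g ν ν') := by
  have hself := norden_self_adjoint hJ hanti
  refine ⟨?_, ?_, ?_, ?_, ?_, ?_⟩
  · intro x x' y z
    simp only [spaceFormCurvature, map_add, LinearMap.add_apply]; module
  · intro c x y z
    simp only [spaceFormCurvature, map_smul, LinearMap.smul_apply, smul_eq_mul]; module
  · intro x y z
    simp only [spaceFormCurvature]; module
  · intro x y z w
    simp only [spaceFormCurvature, map_add, map_sub, map_smul, LinearMap.add_apply,
      LinearMap.sub_apply, LinearMap.smul_apply, smul_eq_mul]
    ring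
  · intro x y z
    have hJs : ∀ v w, g (J v) w = g (J w) v := fun v w ↦ by rw [hself, hsymm]
    simp only [spaceFormCurvature, hsymm z x, hsymm z y, hsymm y x, hJs z x, hJs z y, hJs y x]
    module
  · intro x y z
    simp only [spaceFormCurvature, map_add, map_sub, map_smul, hJ, hanti, ← hself, smul_neg]
    module

/-- A Kähler-Norden curvature tensor with constant totally real sectional curvatures is the
standard one. -/
theorem eq_spaceFormCurvature [FiniteDimensional ℝ V] (hdim : 3 ≤ Module.finrank ℝ V)
    {R : V → V → V → V} (hR : IsKaehlerNordenCurvature J g R) (hJ : ∀ v, J (J v) = -v)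
    (hanti : ∀ v w, g (J v) (J w) = -g v w) (hsymm : ∀ v w, g v w = g w v)
    (hnd : ∀ v, (∀ w, g v w = 0) → v = 0) (ν ν' : ℝ)
    (hν : ∀ x y, g x x = 1 → g y y = 1 → g x y = 0 → g (J x) x = 0 → g (J y) y = 0 →
      g (J x) y = 0 → g (R x y y) x = ν ∧ g (R x y y) (J x) = ν') (x y z : V) :
    R x y z = spaceFormCurvature J g ν ν' x y z := by
  have hself := norden_self_adjoint hJ hanti
  have hS := spaceForm_isKaehlerNordenCurvature hJ hanti hsymm ν ν'
  have hRJ := hR.apply_left hJ hanti hnd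
  have hSJ := hS.apply_left hJ hanti hnd
  have hJJ : J * J = (-1 : Module.End ℝ V) := LinearMap.ext fun v ↦ by simp [hJ]
  let _ : Module ℂ V := Module.compHom V (Complex.liftAux J hJJ).toRingHom
  have hsm : ∀ (c : ℂ) (v : V), c • v = c.re • v + c.im • J v := by
    intro c v
    change (Complex.liftAux J hJJ c) v = _
    rw [Complex.liftAux_apply]; simp [Module.algebraMap_end_apply]
  -- The minus sign in the imaginary part is forced by $h(Jv,w)=i\,h(v,w)$.
  let h : V →ₗ[ℂ] V →ₗ[ℂ] ℂ := LinearMap.mk₂ ℂ (fun v w ↦ ⟨g v w, -g (J v) w⟩)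
    (by intro v v' w; apply Complex.ext <;> simp; ring)
    (by
      intro c v w
      apply Complex.ext <;> simp [hsm, hJ] <;> ring)
    (by intro v w w'; apply Complex.ext <;> simp; ring)
    (by
      intro c v w
      apply Complex.ext <;> simp [hsm, hanti, ← hself] <;> ring)
  have hre : ∀ v w, (h v w).re = g v w := fun v w ↦ rfl
  have him : ∀ v w, (h v w).im = -g (J v) w := fun v w ↦ rfl
  set T : V → V → V → V := fun x y z ↦ R x y z - spaceFormCurvature J g ν ν' x y z with hT
  let K : V → V → V → V → ℂ := fun x y z w ↦ h (T x y z) w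
  have hK : IsComplexCurvatureLike K := by
    refine ⟨?_, ?_, ?_, ?_, ?_⟩
    · intro x x' y z w
      simp only [K, hT, hR.add, hS.add, ← LinearMap.add_apply, ← map_add]
      congr 2; abel
    · intro c x y z w
      have : T (c • x) y z = c • T x y z := by
        simp only [hT, hsm, hR.add, hS.add, hR.smul, hS.smul, hRJ, hSJ, map_sub]; module
      simp only [K, this, map_smul, LinearMap.smul_apply, smul_eq_mul]
    · intro x y z w
      have : T x y z = -T y x z := by
        simp only [hT]; rw [hR.antisymm, hS.antisymm]; abel
      simp only [K]; rw [this]; simp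
    · intro x y z w
      apply Complex.ext
      · simp only [K, hre, Complex.neg_re]
        simp only [hT, map_sub, LinearMap.sub_apply]
        rw [hR.skew, hS.skew]; ring
      · simp only [K, him, Complex.neg_im]
        simp only [hT, map_sub, LinearMap.sub_apply]
        rw [← hR.parallel, ← hS.parallel, hR.skew, hS.skew, ← hself, ← hself]; ring
    · intro x y z w
      have : T x y z + T y z x + T z x y = 0 := by
        have h1 : T x y z + T y z x + T z x y = (R x y z + R y z x + R z x y)
            - (spaceFormCurvature J g ν ν' x y z + spaceFormCurvature J g ν ν' y z x
              + spaceFormCurvature J g ν ν' z x y) := by simp only [hT]; abel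
        rw [h1, hR.bianchi, hS.bianchi, sub_zero]
      simp only [K, ← LinearMap.add_apply, ← map_add, this]; simp
  have hzero := hK.eq_zero_of_orthonormal h
    (by
      intro v w
      apply Complex.ext
      · simp only [hre]; exact hsymm v w
      · simp only [him]; rw [hself, hsymm])
    (fun v hv ↦ hnd v fun w ↦ by rw [← hre, hv]; rfl)
    (by
      intro v
      -- Being $h$-orthogonal to $v$ amounts to two real equations, which have a nonzero solution in
      -- dimension at least 3.
      let φ : V →ₗ[ℝ] (ℝ × ℝ) := (g v).prod (g (J v))
      obtain ⟨w, hw, hw0⟩ : ∃ w ∈ LinearMap.ker φ, w ≠ 0 := by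
        refine (Submodule.ne_bot_iff _).mp fun hbot ↦ ?_
        have := LinearMap.finrank_le_finrank_of_injective (LinearMap.ker_eq_bot.mp hbot)
        simp at this; omega
      refine ⟨w, hw0, ?_⟩
      have hw' : g v w = 0 ∧ g (J v) w = 0 := by simpa [φ] using hw
      apply Complex.ext
      · rw [hre]; exact hw'.1
      · rw [him, hw'.2]; simp)
    (by
      -- Real parts say that the pair is $g$-orthonormal, imaginary parts that its span is totally
      -- real.
      intro v w hv hw hvw
      have e1 : g v v = 1 := by rw [← hre, hv]; rfl
      have e2 : g (J v) v = 0 := by have := him v v; rw [hv] at this; simpa using this.symm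
      have e3 : g w w = 1 := by rw [← hre, hw]; rfl
      have e4 : g (J w) w = 0 := by have := him w w; rw [hw] at this; simpa using this.symm
      have e5 : g v w = 0 := by rw [← hre, hvw]; rfl
      have e6 : g (J v) w = 0 := by have := him v w; rw [hvw] at this; simpa using this.symm
      obtain ⟨n1, n2⟩ := hν v w e1 e3 e5 e2 e4 e6
      have e7 : g (J w) v = 0 := by rw [hself, hsymm]; exact e6
      have e8 : g w v = 0 := by rw [hsymm]; exact e5
      apply Complex.ext
      · simp only [K, hre, Complex.zero_re]
        simp only [hT, map_sub, LinearMap.sub_apply, n1, spaceFormCurvature, map_add,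
          map_smul, LinearMap.add_apply, LinearMap.smul_apply, smul_eq_mul, e1, e2, e3, e4, e5, e6,
          e7, e8]
        ring
      · simp only [K, him, Complex.zero_im]
        simp only [hself, hT, map_sub, LinearMap.sub_apply, n2, spaceFormCurvature, map_add,
          map_smul, LinearMap.add_apply, LinearMap.smul_apply, smul_eq_mul]
        simp only [hanti, ← hself, e1, e2, e3, e4, e5, e6, e7, e8]
        ring)
  refine sub_eq_zero.mp (hnd _ fun w ↦ ?_)
  have := hzero x y z w
  rw [← hre]
  change (K x y z w).re = 0
  rw [this]; rfl

/-- An endomorphism with `K³ = -K` of a real vector space has trace zero. -/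
theorem trace_eq_zero_of_cube [FiniteDimensional ℝ V] (K : V →ₗ[ℝ] V)
    (hK : ∀ v, K (K (K v)) = -K v) : LinearMap.trace ℝ V K = 0 := by
  classical
  let b := Module.finBasis ℝ V
  set A := LinearMap.toMatrix b b K with hA
  have hA3 : A * A * A = -A := by
    rw [hA, ← LinearMap.toMatrix_mul, ← LinearMap.toMatrix_mul, ← map_neg]
    congr 1; ext v; simp [hK]
  set B := A.map (algebraMap ℝ ℂ) with hB
  have hB3 : B * B * B = -B := by
    rw [hB, ← Matrix.map_mul, ← Matrix.map_mul, hA3]; ext; simp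
  have htr : LinearMap.trace ℝ V K = A.trace := LinearMap.trace_eq_matrix_trace ℝ b K
  have hBA : B.trace = ((A.trace : ℝ) : ℂ) := by
    simp [hB, Matrix.trace, Matrix.diag]
  have hsum := Matrix.trace_eq_sum_roots_charpoly B
  -- Complex eigenvalues satisfy $\mu^3+\mu=0$, so they lie in $\{0,\pm i\}$. Their sum is purely
  -- imaginary, while it equals a real trace.
  have hroot : ∀ μ ∈ B.charpoly.roots, μ.re = 0 := by
    intro μ hμ
    have h1 := Polynomial.isRoot_of_mem_roots hμ
    rw [← Matrix.charpoly_toLin', ← Module.End.hasEigenvalue_iff_isRoot_charpoly] at h1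
    obtain ⟨v, hv⟩ := h1.exists_hasEigenvector
    have h2 : B.mulVec v = μ • v := by simpa using hv.apply_eq_smul
    have h3 : (B * B * B).mulVec v = (-B).mulVec v := by rw [hB3]
    rw [← Matrix.mulVec_mulVec, ← Matrix.mulVec_mulVec, Matrix.neg_mulVec] at h3
    simp only [h2, Matrix.mulVec_smul] at h3
    have h4 : (μ * μ * μ + μ) • v = 0 := by
      have : μ • μ • μ • v + μ • v = 0 := by rw [h3]; simp
      rw [← this]; simp only [add_smul, mul_smul]
    have h5 := (smul_eq_zero.mp h4).resolve_right hv.2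
    have h6 : μ * (μ ^ 2 + 1) = 0 := by linear_combination h5
    rcases mul_eq_zero.mp h6 with h | h
    · simp [h]
    · have h7 : (μ - Complex.I) * (μ + Complex.I) = 0 := by
        linear_combination h - Complex.I_sq
      rcases mul_eq_zero.mp h7 with h | h
      · rw [sub_eq_zero.mp h]; simp
      · rw [eq_neg_of_add_eq_zero_left h]; simp
  have : (B.charpoly.roots.sum).re = 0 := by
    have : ∀ s : Multiset ℂ, (∀ μ ∈ s, μ.re = 0) → s.sum.re = 0 := by
      intro s
      induction s using Multiset.induction_on with
      | empty => simp
      | cons a s ih =>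
        intro h
        simp [h a (by simp), ih fun μ hμ ↦ h μ (by simp [hμ])]
    exact this _ hroot
  rw [← hsum, hBA] at this
  rw [htr]; simpa using this

end RealAlgebra

/-! ### Connections in coordinates -/

section Coordinates

variable {E : Type*} [NormedAddCommGroup E] [NormedSpace ℝ E]
  {E' : Type*} [NormedAddCommGroup E'] [NormedSpace ℝ E']

/-- The covariant derivative along `F` of the field `σ`, for the connection with Christoffel
symbols `Γ`. -/
def coordCovAlong (F : E → E') (Γ : E' → E' →L[ℝ] E' →L[ℝ] E') (σ : E → E') (x u : E) : E' :=
  fderiv ℝ σ x u + Γ (F x) (fderiv ℝ F x u) (σ x)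

/-- The curvature tensor of the connection with Christoffel symbols `Γ`. -/
def coordCurvature (Γ : E → E →L[ℝ] E →L[ℝ] E) (x u v w : E) : E :=
  fderiv ℝ Γ x u v w - fderiv ℝ Γ x v u w + Γ x u (Γ x v w) - Γ x v (Γ x u w)

/-- The associated form in coordinates. -/
def coordAssociated (J : E' → E' →L[ℝ] E') (g : E' → E' →L[ℝ] E' →L[ℝ] ℝ) (y : E') :
    E' →L[ℝ] E' →L[ℝ] ℝ :=
  (g y).comp (J y)

lemma coordAssociated_apply (J : E' → E' →L[ℝ] E') (g : E' → E' →L[ℝ] E' →L[ℝ] ℝ) (y a b : E') :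
    coordAssociated J g y a b = g y (J y a) b := rfl

lemma hasFDerivAt_fderiv {F : E → E'} {x : E} (hF : ContDiffAt ℝ 2 F x) :
    HasFDerivAt (fderiv ℝ F) (fderiv ℝ (fderiv ℝ F) x) x :=
  ((hF.fderiv_right (m := 1) (by norm_num)).differentiableAt (by norm_num)).hasFDerivAt

lemma fderiv_fderiv_comm {F : E → E'} {x : E} (hF : ContDiffAt ℝ 2 F x) (u v : E) :
    fderiv ℝ (fderiv ℝ F) x u v = fderiv ℝ (fderiv ℝ F) x v u :=
  (hF.isSymmSndFDerivAt (by simp)).eq u v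

section Along

variable {F : E → E'} {Γ : E' → E' →L[ℝ] E' →L[ℝ] E'} {x : E}

lemma coordCovAlong_congr {σ τ : E → E'} (h : σ =ᶠ[𝓝 x] τ) (u : E) :
    coordCovAlong F Γ σ x u = coordCovAlong F Γ τ x u := by
  simp only [coordCovAlong, h.fderiv_eq, h.eq_of_nhds]

lemma coordCovAlong_add {σ τ : E → E'} (hσ : DifferentiableAt ℝ σ x)
    (hτ : DifferentiableAt ℝ τ x) (u : E) :
    coordCovAlong F Γ (fun z ↦ σ z + τ z) x u
      = coordCovAlong F Γ σ x u + coordCovAlong F Γ τ x u := by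
  simp only [coordCovAlong, fderiv_fun_add hσ hτ, add_apply, map_add]; abel

lemma coordCovAlong_smul {σ : E → E'} {r : E → ℝ} (hr : DifferentiableAt ℝ r x)
    (hσ : DifferentiableAt ℝ σ x) (u : E) :
    coordCovAlong F Γ (fun z ↦ r z • σ z) x u
      = fderiv ℝ r x u • σ x + r x • coordCovAlong F Γ σ x u := by
  simp only [coordCovAlong, fderiv_fun_smul hr hσ, add_apply,
    smul_apply, ContinuousLinearMap.smulRight_apply, map_smul]
  module

lemma coordCovAlong_pushforward (hF : ContDiffAt ℝ 2 F x) {W : E → E}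
    (hW : DifferentiableAt ℝ W x) (u : E) :
    coordCovAlong F Γ (fun z ↦ fderiv ℝ F z (W z)) x u
      = fderiv ℝ F x (fderiv ℝ W x u) + coordCovAlong F Γ (fun z ↦ fderiv ℝ F z (W x)) x u := by
  have h1 := ((hasFDerivAt_fderiv hF).clm_apply hW.hasFDerivAt).fderiv
  have h2 := ((hasFDerivAt_fderiv hF).clm_apply (hasFDerivAt_const (W x) x)).fderiv
  simp only [coordCovAlong, h1, h2]
  simp
  abel

lemma differentiableAt_coordCovAlong (hF : ContDiffAt ℝ 2 F x) {σ : E → E'}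
    (hσ : ContDiffAt ℝ 2 σ x) (hΓ : DifferentiableAt ℝ Γ (F x)) (v : E) :
    HasFDerivAt (fun z ↦ coordCovAlong F Γ σ z v)
      ((fderiv ℝ (fderiv ℝ σ) x).flip v
        + ((((fderiv ℝ Γ (F x)).comp (fderiv ℝ F x)).flip (fderiv ℝ F x v)).flip (σ x)
          + ((Γ (F x)).comp ((fderiv ℝ (fderiv ℝ F) x).flip v)).flip (σ x)
          + (Γ (F x) (fderiv ℝ F x v)).comp (fderiv ℝ σ x))) x := by
  have hF1 : HasFDerivAt F (fderiv ℝ F x) x := (hF.differentiableAt (by norm_num)).hasFDerivAt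
  have hσ1 : HasFDerivAt σ (fderiv ℝ σ x) x := (hσ.differentiableAt (by norm_num)).hasFDerivAt
  have h1 := (hasFDerivAt_fderiv hσ).clm_apply (hasFDerivAt_const v x)
  have h2 := (hasFDerivAt_fderiv hF).clm_apply (hasFDerivAt_const v x)
  have h0 : HasFDerivAt (fun z ↦ Γ (F z)) ((fderiv ℝ Γ (F x)).comp (fderiv ℝ F x)) x :=
    HasFDerivAt.comp (g := Γ) x hΓ.hasFDerivAt hF1
  have h3 := (h0.clm_apply h2).clm_apply hσ1
  refine (h1.add h3).congr_fderiv ?_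
  ext u
  simp
  abel

/-- The Ricci identity along a map. -/
lemma coordCovAlong_coordCovAlong (hF : ContDiffAt ℝ 2 F x) {σ : E → E'}
    (hσ : ContDiffAt ℝ 2 σ x) (hΓ : DifferentiableAt ℝ Γ (F x)) (u v : E) :
    coordCovAlong F Γ (fun z ↦ coordCovAlong F Γ σ z v) x u
        - coordCovAlong F Γ (fun z ↦ coordCovAlong F Γ σ z u) x v
      = coordCurvature Γ (F x) (fderiv ℝ F x u) (fderiv ℝ F x v) (σ x) := by
  have hu := (differentiableAt_coordCovAlong hF hσ hΓ u).fderiv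
  have hv := (differentiableAt_coordCovAlong hF hσ hΓ v).fderiv
  -- The directions `u`, `v` are constant, so there is no bracket term, and the second derivatives
  -- of `σ` and `F` cancel by symmetry.
  have e1 := fderiv_fderiv_comm hσ u v
  have e2 := fderiv_fderiv_comm hF u v
  have eu : coordCovAlong F Γ (fun z ↦ coordCovAlong F Γ σ z u) x v =
      fderiv ℝ (fun z ↦ coordCovAlong F Γ σ z u) x v
        + Γ (F x) (fderiv ℝ F x v) (coordCovAlong F Γ σ x u) := rfl
  have ev : coordCovAlong F Γ (fun z ↦ coordCovAlong F Γ σ z v) x u =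
      fderiv ℝ (fun z ↦ coordCovAlong F Γ σ z v) x u
        + Γ (F x) (fderiv ℝ F x u) (coordCovAlong F Γ σ x v) := rfl
  rw [eu, ev, hu, hv]
  simp only [coordCovAlong, coordCurvature, add_apply,
    ContinuousLinearMap.flip_apply, ContinuousLinearMap.comp_apply, map_add, e1, e2]
  abel

/-- By the chain rule, metric compatibility at the single point `F x` yields a product rule for
fields along `F`, which need not come from ambient fields. -/
lemma fderiv_form_along {g : E' → E' →L[ℝ] E' →L[ℝ] ℝ} (hF : DifferentiableAt ℝ F x)
    (hg : DifferentiableAt ℝ g (F x))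
    (hm : ∀ u a b, fderiv ℝ g (F x) u a b = g (F x) (Γ (F x) u a) b + g (F x) a (Γ (F x) u b))
    {σ τ : E → E'} (hσ : DifferentiableAt ℝ σ x) (hτ : DifferentiableAt ℝ τ x) (u : E) :
    fderiv ℝ (fun z ↦ g (F z) (σ z) (τ z)) x u
      = g (F x) (coordCovAlong F Γ σ x u) (τ x) + g (F x) (σ x) (coordCovAlong F Γ τ x u) := by
  have h0 : HasFDerivAt (fun z ↦ g (F z)) ((fderiv ℝ g (F x)).comp (fderiv ℝ F x)) x :=
    HasFDerivAt.comp (g := g) x hg.hasFDerivAt hF.hasFDerivAt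
  have h := ((h0.clm_apply hσ.hasFDerivAt).clm_apply hτ.hasFDerivAt).fderiv
  rw [h]
  simp [coordCovAlong, hm]
  ring

lemma coordCovAlong_endomorphism {J : E' → E' →L[ℝ] E'} (hF : DifferentiableAt ℝ F x)
    (hJ : DifferentiableAt ℝ J (F x))
    (hp : ∀ u a, fderiv ℝ J (F x) u a + Γ (F x) u (J (F x) a) = J (F x) (Γ (F x) u a))
    {σ : E → E'} (hσ : DifferentiableAt ℝ σ x) (u : E) :
    coordCovAlong F Γ (fun z ↦ J (F z) (σ z)) x u = J (F x) (coordCovAlong F Γ σ x u) := by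
  have h0 : HasFDerivAt (fun z ↦ J (F z)) ((fderiv ℝ J (F x)).comp (fderiv ℝ F x)) x :=
    HasFDerivAt.comp (g := J) x hJ.hasFDerivAt hF.hasFDerivAt
  have h := (h0.clm_apply hσ.hasFDerivAt).fderiv
  simp only [coordCovAlong]
  rw [h]
  simp [← hp]
  abel

end Along

/-- Germ at `y₀` of a Kähler-Norden structure in coordinates. -/
structure IsKaehlerNordenGerm (J : E' → E' →L[ℝ] E') (g : E' → E' →L[ℝ] E' →L[ℝ] ℝ)
    (Γ : E' → E' →L[ℝ] E' →L[ℝ] E') (y₀ : E') : Prop where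
  contDiffAt_form : ContDiffAt ℝ 2 g y₀
  contDiffAt_endo : ContDiffAt ℝ 2 J y₀
  differentiableAt_christoffel : DifferentiableAt ℝ Γ y₀
  symm : ∀ᶠ y in 𝓝 y₀, ∀ a b, g y a b = g y b a
  nondegenerate : ∀ a, (∀ b, g y₀ a b = 0) → a = 0
  sq : ∀ᶠ y in 𝓝 y₀, ∀ a, J y (J y a) = -a
  anti : ∀ᶠ y in 𝓝 y₀, ∀ a b, g y (J y a) (J y b) = -g y a b
  torsion : ∀ᶠ y in 𝓝 y₀, ∀ a b, Γ y a b = Γ y b a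
  metric : ∀ᶠ y in 𝓝 y₀, ∀ u a b,
    fderiv ℝ g y u a b = g y (Γ y u a) b + g y a (Γ y u b)
  parallel : ∀ᶠ y in 𝓝 y₀, ∀ u a,
    fderiv ℝ J y u a + Γ y u (J y a) = J y (Γ y u a)

lemma fderiv_apply₂ {V : Type*} [NormedAddCommGroup V] [NormedSpace ℝ V]
    {T : E → E →L[ℝ] E →L[ℝ] V} {x : E} (hT : DifferentiableAt ℝ T x) (u v w : E) :
    fderiv ℝ (fun z ↦ T z v w) x u = fderiv ℝ T x u v w := by
  rw [((hT.hasFDerivAt.clm_apply (hasFDerivAt_const v x)).clm_apply (hasFDerivAt_const w x)).fderiv]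
  simp

lemma coordCovAlong_id_const (Γ : E → E →L[ℝ] E →L[ℝ] E) (a x u : E) :
    coordCovAlong (fun z ↦ z) Γ (fun _ ↦ a) x u = Γ x u a := by
  simp [coordCovAlong]

lemma coordCovAlong_christoffel {Γ : E → E →L[ℝ] E →L[ℝ] E} {x : E}
    (hΓ : DifferentiableAt ℝ Γ x) (a u v : E) :
    coordCovAlong (fun z ↦ z) Γ (fun z ↦ Γ z v a) x u
      - coordCovAlong (fun z ↦ z) Γ (fun z ↦ Γ z u a) x v = coordCurvature Γ x u v a := by
  have e : ∀ v, (fun z ↦ coordCovAlong (fun z ↦ z) Γ (fun _ ↦ a) z v) = fun z ↦ Γ z v a :=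
    fun v ↦ funext fun z ↦ coordCovAlong_id_const Γ a z v
  have h := coordCovAlong_coordCovAlong (F := fun z ↦ z) (Γ := Γ) (x := x) contDiffAt_id
      (σ := fun _ ↦ a) contDiffAt_const hΓ u v
  rw [e, e, fderiv_fun_id] at h
  exact h

namespace IsKaehlerNordenGerm

variable {J : E' → E' →L[ℝ] E'} {g : E' → E' →L[ℝ] E' →L[ℝ] ℝ}
  {Γ : E' → E' →L[ℝ] E' →L[ℝ] E'} {y₀ : E'}

/-- Both $g$ and $J$ are parallel, hence so is $g(J\cdot,\cdot)$. This is why one connection serves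
both metrics. -/
lemma metric_associated (h : IsKaehlerNordenGerm J g Γ y₀) (u a b : E') :
    fderiv ℝ (coordAssociated J g) y₀ u a b
      = coordAssociated J g y₀ (Γ y₀ u a) b + coordAssociated J g y₀ a (Γ y₀ u b) := by
  have hg := h.contDiffAt_form.differentiableAt (by norm_num)
  have hJ := h.contDiffAt_endo.differentiableAt (by norm_num)
  have hd : DifferentiableAt ℝ (coordAssociated J g) y₀ := hg.clm_comp hJ
  rw [← fderiv_apply₂ hd]
  have h1 := fderiv_form_along (F := fun z ↦ z) (Γ := Γ) (x := y₀) differentiableAt_fun_id hg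
    h.metric.self_of_nhds (σ := fun z ↦ J z a) (τ := fun _ ↦ b)
    (hJ.clm_apply (differentiableAt_const a)) (differentiableAt_const b) u
  have h2 := coordCovAlong_endomorphism (F := fun z ↦ z) (Γ := Γ) (x := y₀) differentiableAt_fun_id hJ
    h.parallel.self_of_nhds (σ := fun _ ↦ a) (differentiableAt_const a) u
  rw [coordCovAlong_id_const] at h1 h2
  simp only [coordAssociated_apply]
  rw [h1, h2]

/-- The curvature of a Kähler-Norden structure has the Kähler-Norden symmetries. -/
theorem isKaehlerNordenCurvature (h : IsKaehlerNordenGerm J g Γ y₀) :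
    IsKaehlerNordenCurvature (J y₀).toLinearMap
      ((ContinuousLinearMap.coeLM ℝ).comp (g y₀).toLinearMap) (coordCurvature Γ y₀) := by
  have hg := h.contDiffAt_form.differentiableAt (by norm_num)
  have hJ := h.contDiffAt_endo.differentiableAt (by norm_num)
  have hΓ := h.differentiableAt_christoffel
  have hd : ∀ v w, DifferentiableAt ℝ (fun y ↦ Γ y v w) y₀ := fun v w ↦
    (hΓ.clm_apply (differentiableAt_const v)).clm_apply (differentiableAt_const w)
  have ricci : ∀ a u v, coordCovAlong (fun z ↦ z) Γ (fun z ↦ Γ z v a) y₀ u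
      - coordCovAlong (fun z ↦ z) Γ (fun z ↦ Γ z u a) y₀ v = coordCurvature Γ y₀ u v a :=
    fun a u v ↦ coordCovAlong_christoffel hΓ a u v
  refine ⟨?_, ?_, ?_, ?_, ?_, ?_⟩
  · intro x x' y z
    simp only [coordCurvature, map_add, add_apply]; abel
  · intro c x y z
    have e1 := (fderiv ℝ Γ y₀).map_smul c x
    have e2 := (fderiv ℝ Γ y₀ y).map_smul c x
    have e3 := (Γ y₀).map_smul c x
    have e4 := (Γ y₀ y).map_smul c (Γ y₀ x z)
    simp only [coordCurvature, e1, e2, e3, smul_apply, e4]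
    module
  · intro x y z
    simp only [coordCurvature]; abel
  · intro u v a b
    simp only [LinearMap.comp_apply, ContinuousLinearMap.coeLM_apply, ContinuousLinearMap.coe_coe]
    -- Skewness of the curvature is the symmetry of the Hessian of $y\mapsto g_y(a,b)$, with every
    -- derivative expressed through `Γ`.
    have key : ∀ u v, fderiv ℝ (fderiv ℝ (fun y ↦ g y a b)) y₀ u v
        = g y₀ (coordCovAlong (fun z ↦ z) Γ (fun z ↦ Γ z v a) y₀ u) b
          + g y₀ (Γ y₀ v a) (Γ y₀ u b) + (g y₀ (Γ y₀ u a) (Γ y₀ v b)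
          + g y₀ a (coordCovAlong (fun z ↦ z) Γ (fun z ↦ Γ z v b) y₀ u)) := by
      intro u v
      have hc : ContDiffAt ℝ 2 (fun y ↦ g y a b) y₀ :=
        (h.contDiffAt_form.clm_apply contDiffAt_const).clm_apply contDiffAt_const
      have e0 : fderiv ℝ (fderiv ℝ (fun y ↦ g y a b)) y₀ u v
          = fderiv ℝ (fun y ↦ fderiv ℝ (fun y ↦ g y a b) y v) y₀ u := by
        rw [((hasFDerivAt_fderiv hc).clm_apply (hasFDerivAt_const v y₀)).fderiv]; simp
      have e1 : (fun y ↦ fderiv ℝ (fun y ↦ g y a b) y v)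
          =ᶠ[𝓝 y₀] fun y ↦ g y (Γ y v a) b + g y a (Γ y v b) := by
        have hgd : ∀ᶠ y in 𝓝 y₀, DifferentiableAt ℝ g y :=
          (h.contDiffAt_form.eventually (by simp)).mono fun y hy ↦ hy.differentiableAt (by norm_num)
        filter_upwards [h.metric, hgd] with y hy hy'
        rw [fderiv_apply₂ hy', hy]
      rw [e0, e1.fderiv_eq, fderiv_fun_add]
      rotate_left
      · exact (hg.clm_apply (hd v a)).clm_apply (differentiableAt_const b)
      · exact (hg.clm_apply (differentiableAt_const a)).clm_apply (hd v b)
      have e2 := fderiv_form_along (F := fun z ↦ z) (Γ := Γ) (x := y₀) differentiableAt_fun_id hg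
        h.metric.self_of_nhds (hd v a) (differentiableAt_const b) u
      have e3 := fderiv_form_along (F := fun z ↦ z) (Γ := Γ) (x := y₀) differentiableAt_fun_id hg
        h.metric.self_of_nhds (differentiableAt_const a) (hd v b) u
      rw [coordCovAlong_id_const] at e2 e3
      rw [add_apply, e2, e3]
    have hc : ContDiffAt ℝ 2 (fun y ↦ g y a b) y₀ :=
      (h.contDiffAt_form.clm_apply contDiffAt_const).clm_apply contDiffAt_const
    have hs := fderiv_fderiv_comm hc u v
    rw [key, key] at hs
    rw [← ricci a u v, ← ricci b u v, map_sub, map_sub, sub_apply,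
      sub_apply, h.symm.self_of_nhds _ a, h.symm.self_of_nhds _ a]
    linarith
  · intro u v w
    -- The Bianchi identity needs symmetry of the derivative of `Γ` too, which holds because the
    -- torsion vanishes near `y₀` and not only at it.
    have hs : ∀ u v w, fderiv ℝ Γ y₀ u v w = fderiv ℝ Γ y₀ u w v := by
      intro u v w
      rw [← fderiv_apply₂ hΓ, ← fderiv_apply₂ hΓ]
      have : (fun z ↦ Γ z v w) =ᶠ[𝓝 y₀] fun z ↦ Γ z w v := h.torsion.mono fun z hz ↦ hz v w
      rw [this.fderiv_eq]
    have ht := h.torsion.self_of_nhds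
    simp only [coordCurvature, hs w v u, hs v w u, hs u w v, ht w v, ht w u, ht v u]
    abel
  · intro u v w
    simp only [ContinuousLinearMap.coe_coe]
    have key : ∀ u v, coordCovAlong (fun z ↦ z) Γ (fun z ↦ coordCovAlong (fun z ↦ z) Γ
        (fun z ↦ J z w) z v) y₀ u = J y₀ (coordCovAlong (fun z ↦ z) Γ (fun z ↦ Γ z v w) y₀ u) := by
      intro u v
      rw [← coordCovAlong_endomorphism (F := fun z ↦ z) differentiableAt_fun_id hJ
        h.parallel.self_of_nhds (hd v w)]
      refine coordCovAlong_congr ?_ u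
      have hJd : ∀ᶠ y in 𝓝 y₀, DifferentiableAt ℝ J y :=
        (h.contDiffAt_endo.eventually (by simp)).mono fun y hy ↦ hy.differentiableAt (by norm_num)
      filter_upwards [h.parallel, hJd] with y hy hy'
      rw [coordCovAlong_endomorphism (F := fun z ↦ z) differentiableAt_fun_id hy' hy
        (differentiableAt_const w), coordCovAlong_id_const]
    -- The Ricci identity for the field $z\mapsto J_zw$, both of whose covariant derivatives pass
    -- through $J$.
    have h1 := coordCovAlong_coordCovAlong (F := fun z ↦ z) (Γ := Γ) (x := y₀) contDiffAt_id
      (σ := fun z ↦ J z w) (h.contDiffAt_endo.clm_apply contDiffAt_const) hΓ u v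
    rw [key, key, ← map_sub, ricci] at h1
    rw [fderiv_fun_id] at h1
    exact h1.symm

end IsKaehlerNordenGerm

end Coordinates

/-! ### Umbilical radical transversal hypersurfaces in coordinates -/

section CoordinateHypersurface

variable {E : Type*} [NormedAddCommGroup E] [NormedSpace ℝ E]
  {E' : Type*} [NormedAddCommGroup E'] [NormedSpace ℝ E']

namespace IsKaehlerNordenGerm

variable {J : E' → E' →L[ℝ] E'} {g : E' → E' →L[ℝ] E' →L[ℝ] ℝ}
  {Γ : E' → E' →L[ℝ] E' →L[ℝ] E'} {y₀ : E'}

lemma form_endo (h : IsKaehlerNordenGerm J g Γ y₀) (a b : E') :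
    g y₀ (J y₀ a) b = g y₀ a (J y₀ b) := by
  have := h.anti.self_of_nhds a (J y₀ b)
  rw [h.sq.self_of_nhds, map_neg] at this
  linarith

lemma associated_symm (h : IsKaehlerNordenGerm J g Γ y₀) (a b : E') :
    coordAssociated J g y₀ a b = coordAssociated J g y₀ b a := by
  rw [coordAssociated_apply, coordAssociated_apply, h.form_endo, h.symm.self_of_nhds]

lemma associated_endo (h : IsKaehlerNordenGerm J g Γ y₀) (a b : E') :
    coordAssociated J g y₀ (J y₀ a) b = coordAssociated J g y₀ a (J y₀ b) := by
  rw [coordAssociated_apply, coordAssociated_apply, h.form_endo]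

lemma associated_endo_right (h : IsKaehlerNordenGerm J g Γ y₀) (a b : E') :
    coordAssociated J g y₀ a (J y₀ b) = -g y₀ a b := by
  rw [coordAssociated_apply, h.anti.self_of_nhds]

lemma associated_nondegenerate (h : IsKaehlerNordenGerm J g Γ y₀) (a : E')
    (ha : ∀ b, coordAssociated J g y₀ a b = 0) : a = 0 := by
  have h1 : J y₀ a = 0 := h.nondegenerate _ ha
  have h2 := h.sq.self_of_nhds a
  rw [h1, map_zero] at h2
  simpa using h2.symm

lemma differentiableAt_associated (h : IsKaehlerNordenGerm J g Γ y₀) :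
    DifferentiableAt ℝ (coordAssociated J g) y₀ :=
  (h.contDiffAt_form.differentiableAt (by norm_num)).clm_comp
    (h.contDiffAt_endo.differentiableAt (by norm_num))

end IsKaehlerNordenGerm

/-- Germ at `x₀` of a totally umbilical radical transversal lightlike hypersurface of a
Kähler-Norden manifold, in coordinates. -/
structure IsUmbilicGerm (J : E' → E' →L[ℝ] E') (g : E' → E' →L[ℝ] E' →L[ℝ] ℝ)
    (Γ : E' → E' →L[ℝ] E' →L[ℝ] E') (F : E → E') (C : E → E →L[ℝ] E →L[ℝ] E)
    (ξ : E → E) (N : E → E') (ρ b : E → ℝ) (x₀ : E) : Prop where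
  ambient : IsKaehlerNordenGerm J g Γ (F x₀)
  contDiffAt_map : ContDiffAt ℝ 3 F x₀
  injective : Function.Injective (fderiv ℝ F x₀)
  differentiableAt_connection : DifferentiableAt ℝ C x₀
  differentiableAt_radical : DifferentiableAt ℝ ξ x₀
  differentiableAt_transversal : DifferentiableAt ℝ N x₀
  differentiableAt_factor : DifferentiableAt ℝ ρ x₀
  radical : ∀ᶠ x in 𝓝 x₀, ∀ w,
    coordAssociated J g (F x) (fderiv ℝ F x (ξ x)) (fderiv ℝ F x w) = 0
  pair : ∀ᶠ x in 𝓝 x₀, coordAssociated J g (F x) (N x) (fderiv ℝ F x (ξ x)) = 1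
  image : ∀ᶠ x in 𝓝 x₀, J (F x) (fderiv ℝ F x (ξ x)) = b x • N x
  gauss : ∀ᶠ x in 𝓝 x₀, ∀ u w,
    coordCovAlong F Γ (fun z ↦ fderiv ℝ F z w) x u = fderiv ℝ F x (C x u w)
      + (ρ x * coordAssociated J g (F x) (fderiv ℝ F x u) (fderiv ℝ F x w)) • N x

namespace IsUmbilicGerm

variable {J : E' → E' →L[ℝ] E'} {g : E' → E' →L[ℝ] E' →L[ℝ] ℝ}
  {Γ : E' → E' →L[ℝ] E' →L[ℝ] E'} {F : E → E'} {C : E → E →L[ℝ] E →L[ℝ] E}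
  {ξ : E → E} {N : E → E'} {ρ b : E → ℝ} {x₀ : E}

/-- The screen projection `u - g̃(N, u) ξ`. -/
def screenProj (J : E' → E' →L[ℝ] E') (g : E' → E' →L[ℝ] E' →L[ℝ] ℝ) (F : E → E') (ξ : E → E)
    (N : E → E') (x₀ u : E) : E :=
  u - coordAssociated J g (F x₀) (N x₀) (fderiv ℝ F x₀ u) • ξ x₀

/-- The `1`-form `τ(u) = g̃(∇_u N, ξ)`. -/
def transversalForm (J : E' → E' →L[ℝ] E') (g : E' → E' →L[ℝ] E' →L[ℝ] ℝ)
    (Γ : E' → E' →L[ℝ] E' →L[ℝ] E') (F : E → E') (ξ : E → E) (N : E → E') (x₀ u : E) : ℝ :=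
  coordAssociated J g (F x₀) (coordCovAlong F Γ N x₀ u) (fderiv ℝ F x₀ (ξ x₀))

section Pointwise

variable (h : IsUmbilicGerm J g Γ F C ξ N ρ b x₀)

include h

lemma radical_left (w : E) :
    coordAssociated J g (F x₀) (fderiv ℝ F x₀ (ξ x₀)) (fderiv ℝ F x₀ w) = 0 :=
  h.radical.self_of_nhds w

lemma radical_right (w : E) :
    coordAssociated J g (F x₀) (fderiv ℝ F x₀ w) (fderiv ℝ F x₀ (ξ x₀)) = 0 := by
  rw [h.ambient.associated_symm, h.radical_left]

/-- $J$ is injective, and $\xi\ne0$ because it pairs to 1 with $N$. -/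
lemma factor_ne_zero : b x₀ ≠ 0 := by
  intro hb
  have h1 := h.image.self_of_nhds
  rw [hb, zero_smul] at h1
  have h2 := h.ambient.sq.self_of_nhds (fderiv ℝ F x₀ (ξ x₀))
  rw [h1, map_zero] at h2
  have h3 := h.pair.self_of_nhds
  rw [← neg_neg (fderiv ℝ F x₀ (ξ x₀)), ← h2] at h3
  simp at h3

lemma transversal_eq : N x₀ = (b x₀)⁻¹ • J (F x₀) (fderiv ℝ F x₀ (ξ x₀)) := by
  rw [h.image.self_of_nhds, smul_smul, inv_mul_cancel₀ h.factor_ne_zero, one_smul]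

lemma endo_transversal : J (F x₀) (N x₀) = -(b x₀)⁻¹ • fderiv ℝ F x₀ (ξ x₀) := by
  rw [h.transversal_eq, map_smul, h.ambient.sq.self_of_nhds]; module

/-- Pairing with $\xi$ reads off the $N$-component of a vector, so this computes the transversal
part of $Ja$. In particular it vanishes for $a$ in the screen. -/
lemma associated_endo_radical (a : E') :
    coordAssociated J g (F x₀) (J (F x₀) a) (fderiv ℝ F x₀ (ξ x₀))
      = b x₀ * coordAssociated J g (F x₀) (N x₀) a := by
  rw [h.ambient.associated_endo, h.image.self_of_nhds, map_smul, h.ambient.associated_symm]; rfl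

/-- Pairing with $\xi$ shows that $N$ is not tangent; the dimension count does the rest. -/
lemma exists_decomposition [FiniteDimensional ℝ E] [FiniteDimensional ℝ E']
    (hdim : Module.finrank ℝ E' = Module.finrank ℝ E + 1) (a : E') :
    ∃ (u : E) (c : ℝ), a = fderiv ℝ F x₀ u + c • N x₀ := by
  let Φ : (E × ℝ) →ₗ[ℝ] E' := (fderiv ℝ F x₀).toLinearMap.coprod (LinearMap.toSpanSingleton ℝ E' (N x₀))
  have hΦ : Function.Injective Φ := by
    rw [← LinearMap.ker_eq_bot, LinearMap.ker_eq_bot']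
    rintro ⟨u, c⟩ huc
    have e : fderiv ℝ F x₀ u + c • N x₀ = 0 := huc
    have e1 : coordAssociated J g (F x₀) (fderiv ℝ F x₀ u + c • N x₀) (fderiv ℝ F x₀ (ξ x₀)) = 0 := by
      rw [e]; simp
    rw [map_add, map_smul, add_apply, smul_apply, h.radical_right, h.pair.self_of_nhds] at e1
    have hc : c = 0 := by simpa using e1
    rw [hc, zero_smul, add_zero] at e
    rw [hc, h.injective (e.trans (map_zero _).symm)]; rfl
  have hs := (LinearMap.injective_iff_surjective_of_finrank_eq_finrank
    (f := Φ) (by simp [hdim])).mp hΦ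
  obtain ⟨⟨u, c⟩, huc⟩ := hs a
  exact ⟨u, c, huc.symm⟩

/-- The main test for vector identities below: tangent vectors and $N$ span the ambient space, where
$\tilde g$ is nondegenerate. -/
lemma eq_zero_of_orthogonal [FiniteDimensional ℝ E] [FiniteDimensional ℝ E']
    (hdim : Module.finrank ℝ E' = Module.finrank ℝ E + 1) (a : E')
    (h1 : ∀ w, coordAssociated J g (F x₀) a (fderiv ℝ F x₀ w) = 0)
    (h2 : coordAssociated J g (F x₀) a (N x₀) = 0) : a = 0 := by
  refine h.ambient.associated_nondegenerate a fun c ↦ ?_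
  obtain ⟨u, t, rfl⟩ := h.exists_decomposition hdim c
  rw [map_add, map_smul, h1, h2]; simp

lemma screenProj_transversal (u : E) : coordAssociated J g (F x₀) (N x₀)
    (fderiv ℝ F x₀ (screenProj J g F ξ N x₀ u)) = 0 := by
  simp only [screenProj, map_sub, map_smul]
  rw [h.pair.self_of_nhds]; simp

lemma endo_pushforward (u : E) : J (F x₀) (fderiv ℝ F x₀ u)
    = J (F x₀) (fderiv ℝ F x₀ (screenProj J g F ξ N x₀ u))
      + (coordAssociated J g (F x₀) (N x₀) (fderiv ℝ F x₀ u) * b x₀) • N x₀ := by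
  simp only [screenProj, map_sub, map_smul]
  rw [h.image.self_of_nhds]; module

lemma exists_endo_screenProj [FiniteDimensional ℝ E] [FiniteDimensional ℝ E']
    (hdim : Module.finrank ℝ E' = Module.finrank ℝ E + 1) (u : E) :
    ∃ k, fderiv ℝ F x₀ k = J (F x₀) (fderiv ℝ F x₀ (screenProj J g F ξ N x₀ u)) := by
  obtain ⟨k, c, hk⟩ := h.exists_decomposition hdim
    (J (F x₀) (fderiv ℝ F x₀ (screenProj J g F ξ N x₀ u)))
  have e := h.associated_endo_radical (fderiv ℝ F x₀ (screenProj J g F ξ N x₀ u))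
  rw [h.screenProj_transversal, hk, map_add, map_smul, add_apply, smul_apply, h.radical_right,
    h.pair.self_of_nhds] at e
  have hc : c = 0 := by simpa using e
  exact ⟨k, by rw [hk, hc]; simp⟩

/-- The Gauss formula for non-constant fields. -/
lemma gauss_field {W : E → E} (hW : DifferentiableAt ℝ W x₀) (u : E) :
    coordCovAlong F Γ (fun z ↦ fderiv ℝ F z (W z)) x₀ u
      = fderiv ℝ F x₀ (fderiv ℝ W x₀ u + C x₀ u (W x₀))
        + (ρ x₀ * coordAssociated J g (F x₀) (fderiv ℝ F x₀ u) (fderiv ℝ F x₀ (W x₀))) • N x₀ := by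
  rw [coordCovAlong_pushforward (h.contDiffAt_map.of_le (by norm_num)) hW,
    h.gauss.self_of_nhds, map_add]
  abel

lemma differentiableAt_pushforward {W : E → E} (hW : DifferentiableAt ℝ W x₀) :
    DifferentiableAt ℝ (fun z ↦ fderiv ℝ F z (W z)) x₀ :=
  (hasFDerivAt_fderiv (h.contDiffAt_map.of_le (by norm_num))).differentiableAt.clm_apply hW

lemma fderiv_associated {σ τ : E → E'} (hσ : DifferentiableAt ℝ σ x₀)
    (hτ : DifferentiableAt ℝ τ x₀) (u : E) :
    fderiv ℝ (fun z ↦ coordAssociated J g (F z) (σ z) (τ z)) x₀ u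
      = coordAssociated J g (F x₀) (coordCovAlong F Γ σ x₀ u) (τ x₀)
        + coordAssociated J g (F x₀) (σ x₀) (coordCovAlong F Γ τ x₀ u) :=
  fderiv_form_along (h.contDiffAt_map.differentiableAt (by norm_num))
    h.ambient.differentiableAt_associated h.ambient.metric_associated hσ hτ u

lemma differentiableAt_associated_along {σ τ : E → E'} (hσ : DifferentiableAt ℝ σ x₀)
    (hτ : DifferentiableAt ℝ τ x₀) :
    DifferentiableAt ℝ (fun z ↦ coordAssociated J g (F z) (σ z) (τ z)) x₀ := by
  have h0 : DifferentiableAt ℝ (fun z ↦ coordAssociated J g (F z)) x₀ :=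
    DifferentiableAt.comp (g := coordAssociated J g) x₀ h.ambient.differentiableAt_associated
      (h.contDiffAt_map.differentiableAt (by norm_num))
  exact (h0.clm_apply hσ).clm_apply hτ

/-- Second derivatives of `F`, the ambient `Γ` and the second fundamental form are all symmetric, so
the tangential part is symmetric too. -/
lemma connection_symm (u v : E) : C x₀ u v = C x₀ v u := by
  have h1 := h.gauss.self_of_nhds u v
  have h2 := h.gauss.self_of_nhds v u
  have hF : ContDiffAt ℝ 2 F x₀ := h.contDiffAt_map.of_le (by norm_num)
  have e : coordCovAlong F Γ (fun z ↦ fderiv ℝ F z v) x₀ u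
      = coordCovAlong F Γ (fun z ↦ fderiv ℝ F z u) x₀ v := by
    have d : ∀ v, fderiv ℝ (fun z ↦ fderiv ℝ F z v) x₀ = (fderiv ℝ (fderiv ℝ F) x₀).flip v := by
      intro v
      rw [((hasFDerivAt_fderiv hF).clm_apply (hasFDerivAt_const v x₀)).fderiv]; simp
    simp only [coordCovAlong, d, ContinuousLinearMap.flip_apply]
    rw [fderiv_fderiv_comm hF u v, h.ambient.torsion.self_of_nhds]
  rw [h1, h2, h.ambient.associated_symm] at e
  exact h.injective (add_right_cancel e)

end Pointwise

variable [FiniteDimensional ℝ E] [FiniteDimensional ℝ E']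

/-- The covariant derivative of the radical section. -/
lemma covariant_radical (h : IsUmbilicGerm J g Γ F C ξ N ρ b x₀)
    (hdim : Module.finrank ℝ E' = Module.finrank ℝ E + 1) (u : E) :
    coordCovAlong F Γ (fun z ↦ fderiv ℝ F z (ξ z)) x₀ u
      = -(ρ x₀ • fderiv ℝ F x₀ (screenProj J g F ξ N x₀ u))
        - transversalForm J g Γ F ξ N x₀ u • fderiv ℝ F x₀ (ξ x₀) := by
  have hξ := h.differentiableAt_pushforward h.differentiableAt_radical
  have hN := h.differentiableAt_transversal
  have hG := h.gauss_field h.differentiableAt_radical u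
  rw [h.radical_right, mul_zero, zero_smul, add_zero] at hG
  -- Against tangent vectors, differentiate $\tilde g(\xi,w)=0$, which is where umbilicity enters.
  -- Against $N$, differentiate $\tilde g(N,\xi)=1$.
  refine sub_eq_zero.mp (h.eq_zero_of_orthogonal hdim _ (fun w ↦ ?_) ?_)
  · have hw := h.differentiableAt_pushforward (differentiableAt_const w)
    have e1 := h.fderiv_associated hξ hw u
    have e2 : (fun z ↦ coordAssociated J g (F z) (fderiv ℝ F z (ξ z)) (fderiv ℝ F z w))
        =ᶠ[𝓝 x₀] fun _ ↦ 0 := h.radical.mono fun z hz ↦ hz w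
    rw [e2.fderiv_eq, h.gauss.self_of_nhds, map_add, map_smul, h.radical_left,
      h.ambient.associated_symm _ (N x₀), h.pair.self_of_nhds] at e1
    simp only [fderiv_fun_const, Pi.zero_apply, zero_apply, smul_eq_mul, zero_add, mul_one] at e1
    have e3 : coordAssociated J g (F x₀) (fderiv ℝ F x₀ (screenProj J g F ξ N x₀ u))
        (fderiv ℝ F x₀ w) = coordAssociated J g (F x₀) (fderiv ℝ F x₀ u) (fderiv ℝ F x₀ w) := by
      simp only [screenProj, map_sub, map_smul, sub_apply, smul_apply]
      rw [h.radical_left]; simp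
    simp only [map_sub, map_neg, map_smul, sub_apply, neg_apply, smul_apply, h.radical_left, e3,
      smul_eq_mul]
    linarith
  · have e1 := h.fderiv_associated hN hξ u
    have e2 : (fun z ↦ coordAssociated J g (F z) (N z) (fderiv ℝ F z (ξ z)))
        =ᶠ[𝓝 x₀] fun _ ↦ 1 := h.pair
    rw [e2.fderiv_eq, h.ambient.associated_symm (N x₀)] at e1
    simp only [fderiv_fun_const, Pi.zero_apply, zero_apply] at e1
    have e3 := h.screenProj_transversal u
    rw [h.ambient.associated_symm] at e3
    have e4 := h.pair.self_of_nhds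
    rw [h.ambient.associated_symm] at e4
    simp only [map_sub, map_neg, map_smul, sub_apply, neg_apply, smul_apply, smul_eq_mul, e3, e4,
      transversalForm]
    linarith

omit [FiniteDimensional ℝ E] [FiniteDimensional ℝ E'] in
-- Nothing is assumed about the regularity of $b$; near the point it equals $\tilde g(J\xi,\xi)$.
lemma differentiableAt_factor_image (h : IsUmbilicGerm J g Γ F C ξ N ρ b x₀) :
    DifferentiableAt ℝ b x₀ := by
  have hξ := h.differentiableAt_pushforward h.differentiableAt_radical
  have hJ : DifferentiableAt ℝ (fun z ↦ J (F z)) x₀ :=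
    DifferentiableAt.comp (g := J) x₀ (h.ambient.contDiffAt_endo.differentiableAt (by norm_num))
      (h.contDiffAt_map.differentiableAt (by norm_num))
  refine (h.differentiableAt_associated_along (hJ.clm_apply hξ) hξ).congr_of_eventuallyEq ?_
  filter_upwards [h.image, h.pair] with z h1 h2
  rw [h1, map_smul, smul_apply, h2, smul_eq_mul, mul_one]

/-- The covariant derivative of the transversal section. -/
lemma covariant_transversal (h : IsUmbilicGerm J g Γ F C ξ N ρ b x₀)
    (hdim : Module.finrank ℝ E' = Module.finrank ℝ E + 1) (u : E) :
    transversalForm J g Γ F ξ N x₀ u = -(1 / (2 * b x₀)) * fderiv ℝ b x₀ u ∧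
    coordCovAlong F Γ N x₀ u
      = -((ρ x₀ / b x₀) • J (F x₀) (fderiv ℝ F x₀ (screenProj J g F ξ N x₀ u)))
        + transversalForm J g Γ F ξ N x₀ u • N x₀ := by
  have hξ := h.differentiableAt_pushforward h.differentiableAt_radical
  have hN := h.differentiableAt_transversal
  have hb := h.factor_ne_zero
  -- Differentiate $J\xi=bN$ in two ways: $J$ is parallel on the left, the Leibniz rule applies on
  -- the right.
  have e1 := coordCovAlong_endomorphism (Γ := Γ)
    (h.contDiffAt_map.differentiableAt (by norm_num))
    (h.ambient.contDiffAt_endo.differentiableAt (by norm_num)) h.ambient.parallel.self_of_nhds hξ u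
  rw [coordCovAlong_congr h.image, coordCovAlong_smul h.differentiableAt_factor_image hN,
    h.covariant_radical hdim, map_sub, map_neg, map_smul, map_smul, h.image.self_of_nhds] at e1
  -- The $N$-components give $db+b\tau=-b\tau$, which determines $\tau$.
  have e2 := congrArg (fun a ↦ coordAssociated J g (F x₀) a (fderiv ℝ F x₀ (ξ x₀))) e1
  simp only [map_add, map_sub, map_neg, map_smul, add_apply, sub_apply, neg_apply, smul_apply,
    smul_eq_mul, h.pair.self_of_nhds, h.associated_endo_radical, h.screenProj_transversal] at e2
  change _ + b x₀ * transversalForm J g Γ F ξ N x₀ u = _ at e2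
  have e3 : transversalForm J g Γ F ξ N x₀ u = -(1 / (2 * b x₀)) * fderiv ℝ b x₀ u := by
    field_simp; linarith
  refine ⟨e3, ?_⟩
  have e4 : fderiv ℝ b x₀ u = -2 * b x₀ * transversalForm J g Γ F ξ N x₀ u := by linarith
  rw [e4] at e1
  have e5 : b x₀ • coordCovAlong F Γ N x₀ u
      = -(ρ x₀ • J (F x₀) (fderiv ℝ F x₀ (screenProj J g F ξ N x₀ u)))
        + (b x₀ * transversalForm J g Γ F ξ N x₀ u) • N x₀ := by
    rw [eq_sub_of_add_eq' e1]; module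
  have e6 : coordCovAlong F Γ N x₀ u = (b x₀)⁻¹ • b x₀ • coordCovAlong F Γ N x₀ u := by
    rw [smul_smul, inv_mul_cancel₀ hb, one_smul]
  rw [e6, e5, smul_add, smul_neg, smul_smul, smul_smul, ← mul_assoc, inv_mul_cancel₀ hb, one_mul,
    div_eq_inv_mul]

end IsUmbilicGerm

end CoordinateHypersurface

/-! ### The Gauss-Codazzi equation and its consequences -/

section CoordinateHypersurface

variable {E : Type*} [NormedAddCommGroup E] [NormedSpace ℝ E]
  {E' : Type*} [NormedAddCommGroup E'] [NormedSpace ℝ E']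

namespace IsUmbilicGerm

variable {J : E' → E' →L[ℝ] E'} {g : E' → E' →L[ℝ] E' →L[ℝ] ℝ}
  {Γ : E' → E' →L[ℝ] E' →L[ℝ] E'} {F : E → E'} {C : E → E →L[ℝ] E →L[ℝ] E}
  {ξ : E → E} {N : E → E'} {ρ b : E → ℝ} {x₀ : E}

/-- Derivative of the Gauss formula. -/
lemma covariant_gauss (h : IsUmbilicGerm J g Γ F C ξ N ρ b x₀) (u v w : E) :
    coordCovAlong F Γ (fun x ↦ coordCovAlong F Γ (fun z ↦ fderiv ℝ F z w) x v) x₀ u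
      = fderiv ℝ F x₀ (fderiv ℝ C x₀ u v w + C x₀ u (C x₀ v w))
        + (ρ x₀ * coordAssociated J g (F x₀) (fderiv ℝ F x₀ v) (fderiv ℝ F x₀ w))
            • coordCovAlong F Γ N x₀ u
        + (ρ x₀ * coordAssociated J g (F x₀) (fderiv ℝ F x₀ u) (fderiv ℝ F x₀ (C x₀ v w))
          + fderiv ℝ ρ x₀ u * coordAssociated J g (F x₀) (fderiv ℝ F x₀ v) (fderiv ℝ F x₀ w)
          + ρ x₀ * (coordAssociated J g (F x₀) (fderiv ℝ F x₀ (C x₀ u v)) (fderiv ℝ F x₀ w)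
            + ρ x₀ * coordAssociated J g (F x₀) (fderiv ℝ F x₀ u) (fderiv ℝ F x₀ v)
              * coordAssociated J g (F x₀) (N x₀) (fderiv ℝ F x₀ w)
            + coordAssociated J g (F x₀) (fderiv ℝ F x₀ v) (fderiv ℝ F x₀ (C x₀ u w))
            + ρ x₀ * coordAssociated J g (F x₀) (fderiv ℝ F x₀ u) (fderiv ℝ F x₀ w)
              * coordAssociated J g (F x₀) (N x₀) (fderiv ℝ F x₀ v))) • N x₀ := by
  have hv := h.differentiableAt_pushforward (differentiableAt_const v)
  have hw := h.differentiableAt_pushforward (differentiableAt_const w)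
  have hC : DifferentiableAt ℝ (fun x ↦ C x v w) x₀ :=
    (h.differentiableAt_connection.clm_apply (differentiableAt_const v)).clm_apply
      (differentiableAt_const w)
  have hCF := h.differentiableAt_pushforward hC
  have hg := h.differentiableAt_associated_along hv hw
  have hρ := h.differentiableAt_factor
  have hN := h.differentiableAt_transversal
  have e : (fun x ↦ coordCovAlong F Γ (fun z ↦ fderiv ℝ F z w) x v) =ᶠ[𝓝 x₀] fun x ↦
      fderiv ℝ F x (C x v w)
        + (ρ x * coordAssociated J g (F x) (fderiv ℝ F x v) (fderiv ℝ F x w)) • N x :=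
    h.gauss.mono fun x hx ↦ hx v w
  have hρg : DifferentiableAt ℝ
      (fun x ↦ ρ x * coordAssociated J g (F x) (fderiv ℝ F x v) (fderiv ℝ F x w)) x₀ := hρ.mul hg
  have hρgN : DifferentiableAt ℝ (fun x ↦
      (ρ x * coordAssociated J g (F x) (fderiv ℝ F x v) (fderiv ℝ F x w)) • N x) x₀ := hρg.smul hN
  rw [coordCovAlong_congr e, coordCovAlong_add hCF hρgN, coordCovAlong_smul hρg hN, h.gauss_field hC, fderiv_fun_mul hρ hg,
    fderiv_apply₂ h.differentiableAt_connection]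
  simp only [add_apply, smul_apply, h.fderiv_associated hv hw, h.gauss.self_of_nhds, smul_eq_mul,
    map_add, map_smul]
  rw [h.ambient.associated_symm (fderiv ℝ F x₀ v) (N x₀)]
  module

/-- The Gauss-Codazzi equation. -/
lemma gauss_codazzi (h : IsUmbilicGerm J g Γ F C ξ N ρ b x₀) (u v w : E) :
    coordCurvature Γ (F x₀) (fderiv ℝ F x₀ u) (fderiv ℝ F x₀ v) (fderiv ℝ F x₀ w)
      = fderiv ℝ F x₀ (coordCurvature C x₀ u v w)
        + (ρ x₀ * coordAssociated J g (F x₀) (fderiv ℝ F x₀ v) (fderiv ℝ F x₀ w))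
            • coordCovAlong F Γ N x₀ u
        - (ρ x₀ * coordAssociated J g (F x₀) (fderiv ℝ F x₀ u) (fderiv ℝ F x₀ w))
            • coordCovAlong F Γ N x₀ v
        + (fderiv ℝ ρ x₀ u * coordAssociated J g (F x₀) (fderiv ℝ F x₀ v) (fderiv ℝ F x₀ w)
          - fderiv ℝ ρ x₀ v * coordAssociated J g (F x₀) (fderiv ℝ F x₀ u) (fderiv ℝ F x₀ w)
          + ρ x₀ ^ 2 * (coordAssociated J g (F x₀) (fderiv ℝ F x₀ u) (fderiv ℝ F x₀ w)
              * coordAssociated J g (F x₀) (N x₀) (fderiv ℝ F x₀ v)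
            - coordAssociated J g (F x₀) (fderiv ℝ F x₀ v) (fderiv ℝ F x₀ w)
              * coordAssociated J g (F x₀) (N x₀) (fderiv ℝ F x₀ u))) • N x₀ := by
  -- The Ricci identity needs a $C^2$ field, hence `F` of class $C^3$. In the difference of the two
  -- iterated derivatives, what survives of the derivative of the induced form is the $\rho^2$ term:
  -- that form is not parallel for the induced connection.
  have hσ : ContDiffAt ℝ 2 (fun z ↦ fderiv ℝ F z w) x₀ :=
    (h.contDiffAt_map.fderiv_right (m := 2) (by norm_num)).clm_apply contDiffAt_const
  rw [← coordCovAlong_coordCovAlong (h.contDiffAt_map.of_le (by norm_num)) hσ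
    h.ambient.differentiableAt_christoffel, h.covariant_gauss, h.covariant_gauss,
    h.connection_symm v u, h.ambient.associated_symm (fderiv ℝ F x₀ v) (fderiv ℝ F x₀ u)]
  simp only [coordCurvature, map_add, map_sub]
  module

/-- $J$ has no real eigenvector: combining the relation with its image under $J$ gives
$(c^2+d^2)a=0$. It is what splits one vector equation into two scalar ones. -/
lemma eq_zero_of_endo_smul {V : Type*} [AddCommGroup V] [Module ℝ V] (J : V →ₗ[ℝ] V)
    (hJ : ∀ v, J (J v) = -v) {a : V} (ha : a ≠ 0) {c d : ℝ} (h : c • J a + d • a = 0) :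
    c = 0 ∧ d = 0 := by
  have h1 := congrArg J h
  rw [map_add, map_smul, map_smul, hJ, map_zero] at h1
  have h2 : (c ^ 2 + d ^ 2) • a = 0 := by
    have : (c ^ 2 + d ^ 2) • a = d • (c • J a + d • a) - c • (c • -a + d • J a) := by module
    rw [this, h, h1]; simp
  have h3 := (smul_eq_zero.mp h2).resolve_right ha
  constructor <;> nlinarith [sq_nonneg c, sq_nonneg d]

variable [FiniteDimensional ℝ E] [FiniteDimensional ℝ E'] {ν ν' : ℝ}

/-- The transversal part of the Gauss-Codazzi equation in an ambient space of constant totally real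
sectional curvatures. -/
lemma codazzi_spaceForm (h : IsUmbilicGerm J g Γ F C ξ N ρ b x₀)
    (hdim : Module.finrank ℝ E' = Module.finrank ℝ E + 1)
    (hR : ∀ x y z, coordCurvature Γ (F x₀) x y z = spaceFormCurvature (J (F x₀)).toLinearMap
      ((ContinuousLinearMap.coeLM ℝ).comp (g (F x₀)).toLinearMap) ν ν' x y z) (u v w : E) :
    (fderiv ℝ ρ x₀ u + ρ x₀ * transversalForm J g Γ F ξ N x₀ u)
        * coordAssociated J g (F x₀) (fderiv ℝ F x₀ v) (fderiv ℝ F x₀ w)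
      - (fderiv ℝ ρ x₀ v + ρ x₀ * transversalForm J g Γ F ξ N x₀ v)
        * coordAssociated J g (F x₀) (fderiv ℝ F x₀ u) (fderiv ℝ F x₀ w)
      + (ρ x₀ ^ 2 - ν * b x₀) * (coordAssociated J g (F x₀) (fderiv ℝ F x₀ u) (fderiv ℝ F x₀ w)
            * coordAssociated J g (F x₀) (N x₀) (fderiv ℝ F x₀ v)
          - coordAssociated J g (F x₀) (fderiv ℝ F x₀ v) (fderiv ℝ F x₀ w)
            * coordAssociated J g (F x₀) (N x₀) (fderiv ℝ F x₀ u))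
      + ν' * b x₀ * (g (F x₀) (fderiv ℝ F x₀ v) (fderiv ℝ F x₀ w)
            * coordAssociated J g (F x₀) (N x₀) (fderiv ℝ F x₀ u)
          - g (F x₀) (fderiv ℝ F x₀ u) (fderiv ℝ F x₀ w)
            * coordAssociated J g (F x₀) (N x₀) (fderiv ℝ F x₀ v)) = 0 := by
  -- Pairing with $\xi$ annihilates all tangent vectors, in particular the intrinsic curvature and
  -- the images $JPu$.
  have e := congrArg (fun a ↦ coordAssociated J g (F x₀) a (fderiv ℝ F x₀ (ξ x₀)))
    (h.gauss_codazzi u v w)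
  simp only [hR, spaceFormCurvature, (h.covariant_transversal hdim _).2, LinearMap.comp_apply,
    ContinuousLinearMap.coeLM_apply, ContinuousLinearMap.coe_coe, map_add, map_sub, map_neg,
    map_smul, add_apply, sub_apply, neg_apply, smul_apply, smul_eq_mul, h.pair.self_of_nhds,
    h.associated_endo_radical, h.screenProj_transversal, h.radical_right,
    ← coordAssociated_apply J g] at e
  linear_combination -e

/-- The fundamental equations of a totally umbilical radical transversal lightlike hypersurface in
coordinates. -/
theorem fundamental_equations (h : IsUmbilicGerm J g Γ F C ξ N ρ b x₀)
    (hdim : Module.finrank ℝ E' = Module.finrank ℝ E + 1) (hE : 2 ≤ Module.finrank ℝ E)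
    (hR : ∀ x y z, coordCurvature Γ (F x₀) x y z = spaceFormCurvature (J (F x₀)).toLinearMap
      ((ContinuousLinearMap.coeLM ℝ).comp (g (F x₀)).toLinearMap) ν ν' x y z) :
    ν' = 0 ∧
    b x₀ * ν - ρ x₀ ^ 2 + fderiv ℝ ρ x₀ (ξ x₀)
      + ρ x₀ * transversalForm J g Γ F ξ N x₀ (ξ x₀) = 0 ∧
    (∀ u, fderiv ℝ ρ x₀ (screenProj J g F ξ N x₀ u)
      + ρ x₀ * transversalForm J g Γ F ξ N x₀ (screenProj J g F ξ N x₀ u) = 0) ∧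
    ∀ u v w, fderiv ℝ F x₀ (coordCurvature C x₀ u v w) =
      (ν - ρ x₀ ^ 2 / b x₀) •
        (coordAssociated J g (F x₀) (fderiv ℝ F x₀ u) (fderiv ℝ F x₀ w)
            • J (F x₀) (fderiv ℝ F x₀ (screenProj J g F ξ N x₀ v))
          - coordAssociated J g (F x₀) (fderiv ℝ F x₀ v) (fderiv ℝ F x₀ w)
            • J (F x₀) (fderiv ℝ F x₀ (screenProj J g F ξ N x₀ u)))
      + ν • (coordAssociated J g (F x₀) (fderiv ℝ F x₀ u) (J (F x₀) (fderiv ℝ F x₀ w))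
            • fderiv ℝ F x₀ v
          - coordAssociated J g (F x₀) (fderiv ℝ F x₀ v) (J (F x₀) (fderiv ℝ F x₀ w))
            • fderiv ℝ F x₀ u) := by
  have hcod := h.codazzi_spaceForm hdim hR
  have hb := h.factor_ne_zero
  have hsq := h.ambient.sq.self_of_nhds
  have hNJ : ∀ u, coordAssociated J g (F x₀)
      (J (F x₀) (fderiv ℝ F x₀ (screenProj J g F ξ N x₀ u))) (N x₀) = 0 := by
    intro u
    rw [h.ambient.associated_endo, h.endo_transversal, map_smul, h.radical_right, smul_zero]
  have hNP : ∀ u, coordAssociated J g (F x₀)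
      (fderiv ℝ F x₀ (screenProj J g F ξ N x₀ u)) (N x₀) = 0 := by
    intro u
    rw [h.ambient.associated_symm, h.screenProj_transversal]
  -- The screen is nonzero because the radical is a line and the hypersurface has dimension at least
  -- 2.
  obtain ⟨u₀, hu₀⟩ : ∃ u, screenProj J g F ξ N x₀ u ≠ 0 := by
    by_contra! hcon
    have : Module.finrank ℝ E ≤ 1 := finrank_le_one (ξ x₀) fun u ↦ ⟨_, (sub_eq_zero.mp (hcon u)).symm⟩
    omega
  have hLu₀ : fderiv ℝ F x₀ (screenProj J g F ξ N x₀ u₀) ≠ 0 := fun h0 ↦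
    hu₀ (h.injective (h0.trans (map_zero _).symm))
  -- The Codazzi equation at $(\xi,Pu_0,w)$ for all $w$, rewritten as orthogonality of
  -- $cJPu_0+dPu_0$ to tangent vectors; orthogonality to $N$ is automatic. Then $c=0$ gives $\nu'=0$
  -- and $d=0$ the equation along $\xi$.
  have hcd := eq_zero_of_endo_smul (J (F x₀)).toLinearMap hsq hLu₀
    (c := ν' * b x₀)
    (d := -(fderiv ℝ ρ x₀ (ξ x₀) + ρ x₀ * transversalForm J g Γ F ξ N x₀ (ξ x₀)
      - ρ x₀ ^ 2 + ν * b x₀)) (by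
    refine h.eq_zero_of_orthogonal hdim _ (fun w ↦ ?_) ?_
    · have e := hcod (ξ x₀) (screenProj J g F ξ N x₀ u₀) w
      rw [h.radical_left, h.pair.self_of_nhds, h.screenProj_transversal] at e
      simp only [ContinuousLinearMap.coe_coe, map_add, map_smul, add_apply, smul_apply, smul_eq_mul,
        h.ambient.associated_endo, h.ambient.associated_endo_right]
      linear_combination -e
    · simp only [ContinuousLinearMap.coe_coe, map_add, map_smul, add_apply, smul_apply, smul_eq_mul,
        hNJ, hNP]
      ring)
  have hν' : ν' = 0 := (mul_eq_zero.mp hcd.1).resolve_right hb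
  refine ⟨hν', by linarith [hcd.2], fun u ↦ ?_, fun u v w ↦ ?_⟩
  · by_cases hu : screenProj J g F ξ N x₀ u = 0
    · rw [hu]
      have : transversalForm J g Γ F ξ N x₀ 0 = 0 := by
        rw [(h.covariant_transversal hdim 0).1]; simp
      rw [this]; simp
    have hLu : fderiv ℝ F x₀ (screenProj J g F ξ N x₀ u) ≠ 0 := fun h0 ↦
      hu (h.injective (h0.trans (map_zero _).symm))
    -- The Codazzi equation is used at $Pu$ and $k=JPu$. Both are orthogonal to $N$, so only the
    -- derivative terms survive.
    obtain ⟨k, hk⟩ := h.exists_endo_screenProj hdim u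
    refine (eq_zero_of_endo_smul (J (F x₀)).toLinearMap hsq hLu (d :=
      -(fderiv ℝ ρ x₀ k + ρ x₀ * transversalForm J g Γ F ξ N x₀ k)) ?_).1
    refine h.eq_zero_of_orthogonal hdim _ (fun w ↦ ?_) ?_
    · have e := hcod (screenProj J g F ξ N x₀ u) k w
      rw [hk, hν', h.screenProj_transversal, h.ambient.associated_symm (N x₀), hNJ] at e
      simp only [ContinuousLinearMap.coe_coe, map_add, map_smul, add_apply, smul_apply, smul_eq_mul]
      linear_combination e
    · simp only [ContinuousLinearMap.coe_coe, map_add, map_smul, add_apply, smul_apply, smul_eq_mul,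
        hNJ, hNP]
      ring
  · have e := h.gauss_codazzi u v w
    have ec := hcod u v w
    rw [hR, hν'] at e
    rw [hν'] at ec
    simp only [spaceFormCurvature, (h.covariant_transversal hdim _).2, LinearMap.comp_apply,
      ContinuousLinearMap.coeLM_apply, ContinuousLinearMap.coe_coe, ← coordAssociated_apply J g,
      zero_smul, sub_zero] at e
    -- Splitting $Ju=JPu+b\,\tilde g(N,u)N$ leaves multiples of $N$, which the scalar Codazzi
    -- equation `ec` cancels.
    rw [h.endo_pushforward u, h.endo_pushforward v] at e
    rw [h.ambient.associated_endo_right, h.ambient.associated_endo_right]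
    linear_combination (norm := module) (-1 : ℝ) • e - ec • N x₀

end IsUmbilicGerm

end CoordinateHypersurface

/-! ### Fields and connections in the chart at a point -/

section Charts

variable {E : Type*} [NormedAddCommGroup E] [NormedSpace ℝ E]
  {M : Type*} [TopologicalSpace M] [ChartedSpace E M] [IsManifold 𝓘(ℝ, E) ∞ M]
  {E' : Type*} [NormedAddCommGroup E'] [NormedSpace ℝ E']
  {M' : Type*} [TopologicalSpace M'] [ChartedSpace E' M'] [IsManifold 𝓘(ℝ, E') ∞ M']
  {V : Type*} [NormedAddCommGroup V] [NormedSpace ℝ V]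

/-- Coordinates of tangent vectors at `q` in the chart at `p`. -/
def coord (p q : M) : TangentSpace 𝓘(ℝ, E) q →L[ℝ] E :=
  (trivializationAt E (TangentSpace 𝓘(ℝ, E)) p).continuousLinearMapAt ℝ q

variable (E) in
/-- The field with constant coordinates `a` in the chart at `p`. -/
def frame (p : M) (a : E) (q : M) : TangentSpace 𝓘(ℝ, E) q :=
  (trivializationAt E (TangentSpace 𝓘(ℝ, E)) p).symmL ℝ q a

variable (E) in
/-- The coordinate expression of a field in the chart at `p`. -/
def fieldCoord (p : M) (X : ∀ q : M, TangentSpace 𝓘(ℝ, E) q) (x : E) : E :=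
  coord p ((chartAt E p).symm x) (X ((chartAt E p).symm x))

variable {p q : M}

lemma mem_baseSet_iff : q ∈ (trivializationAt E (TangentSpace 𝓘(ℝ, E)) p).baseSet ↔
    q ∈ (chartAt E p).source := Iff.rfl

lemma frame_eq_symm (hq : q ∈ (chartAt E p).source) (a : E) :
    frame E p a q = (trivializationAt E (TangentSpace 𝓘(ℝ, E)) p).symm q a :=
  Trivialization.symmL_apply _ (mem_baseSet_iff.2 hq) a

lemma coord_apply (hq : q ∈ (chartAt E p).source) (v : TangentSpace 𝓘(ℝ, E) q) :
    coord p q v = (trivializationAt E (TangentSpace 𝓘(ℝ, E)) p ⟨q, v⟩).2 :=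
  Trivialization.continuousLinearMapAt_apply_of_mem ℝ _ (mem_baseSet_iff.2 hq) v

lemma coord_frame (hq : q ∈ (chartAt E p).source) (a : E) : coord p q (frame E p a q) = a := by
  rw [frame]
  exact Trivialization.continuousLinearMapAt_symmL _ (mem_baseSet_iff.2 hq) a

lemma frame_coord (hq : q ∈ (chartAt E p).source) (v : TangentSpace 𝓘(ℝ, E) q) :
    frame E p (coord p q v) q = v := by
  rw [frame]
  exact Trivialization.symmL_continuousLinearMapAt _ (mem_baseSet_iff.2 hq) v

lemma frame_add (p : M) (a b : E) (q : M) : frame E p (a + b) q = frame E p a q + frame E p b q := by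
  simp only [frame, map_add]

lemma frame_smul (p : M) (c : ℝ) (a : E) (q : M) : frame E p (c • a) q = c • frame E p a q := by
  simp only [frame, map_smul]

/-- Identifying the bundle trivialization with the derivative of the chart makes the chain rule
available. -/
lemma coord_eq_mfderiv (hq : q ∈ (chartAt E p).source) :
    coord p q = mfderiv 𝓘(ℝ, E) 𝓘(ℝ, E) (chartAt E p) q := by
  have := TangentBundle.continuousLinearMapAt_trivializationAt (I := 𝓘(ℝ, E)) hq
  simpa [coord, extChartAt, OpenPartialHomeomorph.extend] using this

lemma frame_eq_mfderiv {x : E} (hx : x ∈ (chartAt E p).target) (a : E) :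
    frame E p a ((chartAt E p).symm x)
      = mfderiv 𝓘(ℝ, E) 𝓘(ℝ, E) (chartAt E p).symm x a := by
  have := TangentBundle.symmL_trivializationAt (I := 𝓘(ℝ, E)) ((chartAt E p).map_target hx)
  have h2 := congrArg (fun L ↦ L a) this
  simp only [mfld_simps] at h2
  rw [frame]
  refine h2.trans ?_
  rw [(chartAt E p).right_inv hx]
  rfl

/-- A coordinate change from a chart to itself is the identity. At the centre of its own chart a
tangent vector is thus its own coordinate vector. -/
lemma coord_self (p : M) (v : TangentSpace 𝓘(ℝ, E) p) : coord p p v = v := by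
  rw [coord, TangentBundle.continuousLinearMapAt_trivializationAt_eq_core (mem_chart_source E p)]
  exact (tangentBundleCore 𝓘(ℝ, E) M).coordChange_self (achart E p) p (mem_chart_source E p) v

lemma mdifferentiableAt_chart (hq : q ∈ (chartAt E p).source) :
    MDifferentiableAt 𝓘(ℝ, E) 𝓘(ℝ, E) (chartAt E p) q :=
  mdifferentiableAt_atlas (chart_mem_atlas E p) hq

lemma mdifferentiableAt_chart_symm {x : E} (hx : x ∈ (chartAt E p).target) :
    MDifferentiableAt 𝓘(ℝ, E) 𝓘(ℝ, E) (chartAt E p).symm x :=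
  mdifferentiableAt_atlas_symm (chart_mem_atlas E p) hx

/-- Directional derivatives in the chart at `p`. -/
lemma fderiv_comp_chart_symm {G : M → V} {x : E} (hx : x ∈ (chartAt E p).target)
    (hG : MDifferentiableAt 𝓘(ℝ, E) 𝓘(ℝ, V) G ((chartAt E p).symm x)) (a : E) :
    fderiv ℝ (G ∘ (chartAt E p).symm) x a
      = mvfderiv 𝓘(ℝ, E) G ((chartAt E p).symm x) (frame E p a ((chartAt E p).symm x)) := by
  rw [frame_eq_mfderiv hx, ← mfderiv_eq_fderiv, mfderiv_comp x hG (mdifferentiableAt_chart_symm hx)]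
  rfl

lemma mvfderiv_eq_fderiv_chart {G : M → V} (hq : q ∈ (chartAt E p).source)
    (hG : MDifferentiableAt 𝓘(ℝ, E) 𝓘(ℝ, V) G q) (v : TangentSpace 𝓘(ℝ, E) q) :
    mvfderiv 𝓘(ℝ, E) G q v
      = fderiv ℝ (G ∘ (chartAt E p).symm) (chartAt E p q) (coord p q v) := by
  have e := (chartAt E p).left_inv hq
  rw [fderiv_comp_chart_symm ((chartAt E p).map_source hq) (by rwa [e])]
  rw [← frame_coord hq v]
  simp only [coord_frame hq]
  rw [e]

/-- Derivatives of maps in charts. -/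
lemma coord_mfderiv_frame {f : M → M'} {p' : M'} {x : E} (hx : x ∈ (chartAt E p).target)
    (hx' : f ((chartAt E p).symm x) ∈ (chartAt E' p').source)
    (hf : MDifferentiableAt 𝓘(ℝ, E) 𝓘(ℝ, E') f ((chartAt E p).symm x)) (a : E) :
    coord p' (f ((chartAt E p).symm x)) (mfderiv 𝓘(ℝ, E) 𝓘(ℝ, E') f ((chartAt E p).symm x)
        (frame E p a ((chartAt E p).symm x)))
      = fderiv ℝ (chartAt E' p' ∘ f ∘ (chartAt E p).symm) x a := by
  rw [frame_eq_mfderiv hx, coord_eq_mfderiv hx', ← mfderiv_eq_fderiv]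
  have h1 := mdifferentiableAt_chart_symm hx
  rw [mfderiv_comp x (g := chartAt E' p') (f := f ∘ (chartAt E p).symm)
    (mdifferentiableAt_chart hx') (hf.comp x h1), mfderiv_comp x hf h1]
  rfl

lemma contMDiffAt_iff_chart {n : WithTop ℕ∞} (hn : n ≤ ∞) {G : M → V}
    (hq : q ∈ (chartAt E p).source) :
    ContMDiffAt 𝓘(ℝ, E) 𝓘(ℝ, V) n G q
      ↔ ContDiffAt ℝ n (G ∘ (chartAt E p).symm) (chartAt E p q) := by
  have : IsManifold 𝓘(ℝ, E) n M := IsManifold.of_le hn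
  have hx := (chartAt E p).map_source hq
  rw [← contMDiffAt_iff_contDiffAt]
  constructor
  · intro h
    rw [← (chartAt E p).left_inv hq] at h
    exact h.comp _ ((contMDiffOn_chart_symm (I := 𝓘(ℝ, E)) (n := n)).contMDiffAt
      ((chartAt E p).open_target.mem_nhds hx))
  · intro h
    refine (h.comp q ((contMDiffOn_chart (I := 𝓘(ℝ, E)) (n := n)).contMDiffAt
      ((chartAt E p).open_source.mem_nhds hq))).congr_of_eventuallyEq ?_
    filter_upwards [(chartAt E p).open_source.mem_nhds hq] with z hz
    simp [(chartAt E p).left_inv hz]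

lemma mdifferentiableAt_iff_chart {G : M → V} (hq : q ∈ (chartAt E p).source) :
    MDifferentiableAt 𝓘(ℝ, E) 𝓘(ℝ, V) G q
      ↔ DifferentiableAt ℝ (G ∘ (chartAt E p).symm) (chartAt E p q) := by
  have hx := (chartAt E p).map_source hq
  rw [← mdifferentiableAt_iff_differentiableAt]
  constructor
  · intro h
    rw [← (chartAt E p).left_inv hq] at h
    exact h.comp _ (mdifferentiableAt_chart_symm hx)
  · intro h
    refine (h.comp q (mdifferentiableAt_chart hq)).congr_of_eventuallyEq ?_
    filter_upwards [(chartAt E p).open_source.mem_nhds hq] with z hz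
    simp [(chartAt E p).left_inv hz]

lemma eventually_coord_eq (hq : q ∈ (chartAt E p).source) (X : ∀ q : M, TangentSpace 𝓘(ℝ, E) q) :
    (fun q ↦ coord p q (X q)) =ᶠ[𝓝 q]
      fun q ↦ (trivializationAt E (TangentSpace 𝓘(ℝ, E)) p ⟨q, X q⟩).2 := by
  filter_upwards [(chartAt E p).open_source.mem_nhds hq] with z hz
  exact coord_apply hz _

lemma contMDiffAt_field_iff {n : WithTop ℕ∞} (hn : n ≤ ∞) {X : ∀ q : M, TangentSpace 𝓘(ℝ, E) q}
    (hq : q ∈ (chartAt E p).source) :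
    ContMDiffAt 𝓘(ℝ, E) (𝓘(ℝ, E).prod 𝓘(ℝ, E)) n (T% X) q
      ↔ ContDiffAt ℝ n (fieldCoord E p X) (chartAt E p q) := by
  have : ContMDiffVectorBundle n E (TangentSpace 𝓘(ℝ, E) : M → Type _) 𝓘(ℝ, E) :=
    ContMDiffVectorBundle.of_le hn
  rw [Trivialization.contMDiffAt_section_iff (trivializationAt E (TangentSpace 𝓘(ℝ, E)) p)
    (mem_baseSet_iff.2 hq), ← (eventually_coord_eq hq X).contMDiffAt_iff,
    contMDiffAt_iff_chart hn hq]
  rfl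

lemma mdifferentiableAt_field_iff {X : ∀ q : M, TangentSpace 𝓘(ℝ, E) q}
    (hq : q ∈ (chartAt E p).source) :
    MDifferentiableAt 𝓘(ℝ, E) (𝓘(ℝ, E).prod 𝓘(ℝ, E)) (T% X) q
      ↔ DifferentiableAt ℝ (fieldCoord E p X) (chartAt E p q) := by
  rw [Trivialization.mdifferentiableAt_section_iff 𝓘(ℝ, E)
    (trivializationAt E (TangentSpace 𝓘(ℝ, E)) p) X (mem_baseSet_iff.2 hq),
    ← (eventually_coord_eq hq X).mdifferentiableAt_iff, mdifferentiableAt_iff_chart hq]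
  rfl

lemma fieldCoord_frame_eventuallyEq (a : E) {x : E} (hx : x ∈ (chartAt E p).target) :
    fieldCoord E p (frame E p a) =ᶠ[𝓝 x] fun _ ↦ a := by
  filter_upwards [(chartAt E p).open_target.mem_nhds hx] with z hz
  exact coord_frame ((chartAt E p).map_target hz) a

lemma contMDiffAt_frame (hq : q ∈ (chartAt E p).source) (a : E) :
    ContMDiffAt 𝓘(ℝ, E) (𝓘(ℝ, E).prod 𝓘(ℝ, E)) ∞ (T% (frame E p a)) q := by
  rw [contMDiffAt_field_iff le_rfl hq]
  exact contDiffAt_const.congr_of_eventuallyEq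
    (fieldCoord_frame_eventuallyEq a ((chartAt E p).map_source hq))

lemma mdifferentiableAt_frame (hq : q ∈ (chartAt E p).source) (a : E) :
    MDifferentiableAt 𝓘(ℝ, E) (𝓘(ℝ, E).prod 𝓘(ℝ, E)) (T% (frame E p a)) q :=
  (contMDiffAt_frame hq a).mdifferentiableAt (by simp)

/-- The pull-back of vector fields is defined through this inverse, so this describes pull-backs
under the chart. -/
lemma inverse_mfderiv_chart {z : M} (hz : z ∈ (chartAt E p).source)
    (a : E) :
    (mfderiv 𝓘(ℝ, E) 𝓘(ℝ, E) (chartAt E p) z).inverse a = frame E p a z := by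
  have h1 : (mfderiv 𝓘(ℝ, E) 𝓘(ℝ, E) (chartAt E p) z).IsInvertible :=
    isInvertible_mfderiv_extChartAt (I := 𝓘(ℝ, E)) (x := p) (y := z) (by simpa using hz)
  obtain ⟨e, he⟩ := h1
  rw [← he, ContinuousLinearMap.inverse_equiv]
  refine e.symm_apply_eq.2 ?_
  have h2 : e (frame E p a z) = mfderiv 𝓘(ℝ, E) 𝓘(ℝ, E) (chartAt E p) z (frame E p a z) := by
    rw [← he]; rfl
  rw [h2, ← coord_eq_mfderiv hz]
  exact (coord_frame hz a).symm

lemma mdifferentiableAt_model_field {U : E → E} {x : E} (hU : DifferentiableAt ℝ U x) :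
    MDifferentiableAt 𝓘(ℝ, E) (𝓘(ℝ, E).prod 𝓘(ℝ, E))
      (fun y ↦ (⟨y, U y⟩ : TotalSpace E (TangentSpace 𝓘(ℝ, E)))) x := by
  refine (mdifferentiableAt_field_iff (M := E) (p := x) (q := x) (X := U)
    (mem_chart_source E x)).2 ?_
  have h : ∀ y : E, coord (M := E) x y = ContinuousLinearMap.id ℝ E := fun y ↦
    (coord_eq_mfderiv (E := E) (M := E) (p := x) (q := y) (Set.mem_univ y)).trans mfderiv_id
  have h2 : fieldCoord E (M := E) x U = U := by
    ext y
    exact congrArg (fun L : E →L[ℝ] E ↦ L (U y)) (h y)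
  rw [h2]
  exact hU

/-- The Lie bracket in the chart at `p`. -/
lemma coord_mlieBracket [CompleteSpace E] {X Y : ∀ q : M, TangentSpace 𝓘(ℝ, E) q}
    (hq : q ∈ (chartAt E p).source)
    (hX : DifferentiableAt ℝ (fieldCoord E p X) (chartAt E p q))
    (hY : DifferentiableAt ℝ (fieldCoord E p Y) (chartAt E p q)) :
    coord p q (VectorField.mlieBracket 𝓘(ℝ, E) X Y q)
      = fderiv ℝ (fieldCoord E p Y) (chartAt E p q) (coord p q (X q))
        - fderiv ℝ (fieldCoord E p X) (chartAt E p q) (coord p q (Y q)) := by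
  let U : ∀ x : E, TangentSpace 𝓘(ℝ, E) x := fun x ↦ fieldCoord E p X x
  let W : ∀ x : E, TangentSpace 𝓘(ℝ, E) x := fun x ↦ fieldCoord E p Y x
  -- Near $q$ each field is the pull-back of its coordinate expression, and Lie brackets commute
  -- with pull-back.
  have hpull : ∀ X : (∀ q : M, TangentSpace 𝓘(ℝ, E) q),
      X =ᶠ[𝓝 q] VectorField.mpullback 𝓘(ℝ, E) 𝓘(ℝ, E) (chartAt E p)
        (fun x ↦ (fieldCoord E p X x : TangentSpace 𝓘(ℝ, E) x)) := by
    intro X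
    filter_upwards [(chartAt E p).open_source.mem_nhds hq] with z hz
    refine Eq.trans ?_ (inverse_mfderiv_chart hz _).symm
    simp only [fieldCoord]
    rw [(chartAt E p).left_inv hz]
    exact (frame_coord hz _).symm
  have : IsManifold 𝓘(ℝ, E) (minSmoothness ℝ 2) M := by
    rw [minSmoothness_of_isRCLikeNormedField]
    exact IsManifold.of_le (n := ∞) (WithTop.coe_le_coe.2 le_top)
  have key : VectorField.mlieBracket 𝓘(ℝ, E) X Y q
      = VectorField.mpullback 𝓘(ℝ, E) 𝓘(ℝ, E) (chartAt E p)
        (VectorField.mlieBracket 𝓘(ℝ, E) U W) q := by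
    rw [VectorField.mpullback_mlieBracket (n := ∞)]
    · exact (hpull X).mlieBracket_vectorField_eq (hpull Y)
    · exact mdifferentiableAt_model_field hX
    · exact mdifferentiableAt_model_field hY
    · exact (contMDiffOn_chart (I := 𝓘(ℝ, E)) (n := ∞)).contMDiffAt
        ((chartAt E p).open_source.mem_nhds hq)
    · simp [minSmoothness_of_isRCLikeNormedField]
      exact WithTop.coe_le_coe.2 le_top
  rw [key]
  have h1 : VectorField.mlieBracket 𝓘(ℝ, E) U W (chartAt E p q)
      = VectorField.lieBracket ℝ (fieldCoord E p X) (fieldCoord E p Y) (chartAt E p q) := by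
    rw [← VectorField.mlieBracketWithin_univ, ← VectorField.lieBracketWithin_univ]
    exact congrFun (VectorField.mlieBracketWithin_eq_lieBracketWithin (𝕜 := ℝ)) _
  refine (congrArg (coord p q) ((inverse_mfderiv_chart hq _).trans
    (congrArg (fun a ↦ frame E p a q) h1))).trans ?_
  rw [coord_frame hq]
  simp only [VectorField.lieBracket, fieldCoord]
  rw [(chartAt E p).left_inv hq]

end Charts

/-! ### Christoffel symbols -/

section Christoffel

variable {E : Type*} [NormedAddCommGroup E] [NormedSpace ℝ E]
  {M : Type*} [TopologicalSpace M] [ChartedSpace E M] [IsManifold 𝓘(ℝ, E) ∞ M]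

lemma AffineConnection.add (D : AffineConnection 𝓘(ℝ, E) M) {q : M}
    {X Y : ∀ q : M, TangentSpace 𝓘(ℝ, E) q}
    (hX : MDifferentiableAt 𝓘(ℝ, E) (𝓘(ℝ, E).prod 𝓘(ℝ, E)) (T% X) q)
    (hY : MDifferentiableAt 𝓘(ℝ, E) (𝓘(ℝ, E).prod 𝓘(ℝ, E)) (T% Y) q) :
    D (X + Y) q = D X q + D Y q :=
  D.isCovariantDerivativeOnUniv.add hX hY

variable [FiniteDimensional ℝ E]

/-- The field with constant coordinates `a` depends linearly on `a`, and linear maps are continuous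
in finite dimension. Outside the chart target the value is set to 0. -/
lemma exists_christoffel (D : AffineConnection 𝓘(ℝ, E) M) (p : M) :
    ∃ Γ : E → E →L[ℝ] E →L[ℝ] E, ∀ x ∈ (chartAt E p).target, ∀ u a,
      Γ x u a = coord p ((chartAt E p).symm x)
        (D (frame E p a) ((chartAt E p).symm x) (frame E p u ((chartAt E p).symm x))) := by
  have key : ∀ x : E, ∃ B : E →L[ℝ] E →L[ℝ] E, x ∈ (chartAt E p).target → ∀ u a,
      B u a = coord p ((chartAt E p).symm x)
        (D (frame E p a) ((chartAt E p).symm x) (frame E p u ((chartAt E p).symm x))) := by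
    intro x
    by_cases hx : x ∈ (chartAt E p).target
    · have hq := (chartAt E p).map_target hx
      set q := (chartAt E p).symm x
      let fr : E →L[ℝ] TangentSpace 𝓘(ℝ, E) q :=
        (trivializationAt E (TangentSpace 𝓘(ℝ, E)) p).symmL ℝ q
      let L : E →ₗ[ℝ] E →L[ℝ] E :=
        { toFun := fun a ↦ ((coord p q).comp (D (frame E p a) q)).comp fr
          map_add' := by
            intro a b
            have h : (frame E p (a + b) : ∀ q : M, TangentSpace 𝓘(ℝ, E) q)
                = frame E p a + frame E p b := funext fun z ↦ frame_add p a b z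
            ext u
            rw [h, AffineConnection.add D (mdifferentiableAt_frame hq a)
              (mdifferentiableAt_frame hq b)]
            simp
          map_smul' := by
            intro c a
            have h : (frame E p (c • a) : ∀ q : M, TangentSpace 𝓘(ℝ, E) q)
                = c • frame E p a := funext fun z ↦ frame_smul p c a z
            ext u
            rw [h, D.isCovariantDerivativeOnUniv.smul_const c (mdifferentiableAt_frame hq a)]
            simp }
      refine ⟨(LinearMap.toContinuousLinearMap L).flip, fun _ u a ↦ rfl⟩
    · exact ⟨0, fun h ↦ absurd h hx⟩
  choose Γ hΓ using key
  exact ⟨Γ, hΓ⟩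

/-- The Christoffel symbols of a connection in the chart at `p`. -/
def christoffel (D : AffineConnection 𝓘(ℝ, E) M) (p : M) : E → E →L[ℝ] E →L[ℝ] E :=
  (exists_christoffel D p).choose

lemma christoffel_apply (D : AffineConnection 𝓘(ℝ, E) M) {p : M} {x : E}
    (hx : x ∈ (chartAt E p).target) (u a : E) :
    christoffel D p x u a = coord p ((chartAt E p).symm x)
      (D (frame E p a) ((chartAt E p).symm x) (frame E p u ((chartAt E p).symm x))) :=
  (exists_christoffel D p).choose_spec x hx u a

lemma fieldCoord_add (p : M) (X Y : ∀ q : M, TangentSpace 𝓘(ℝ, E) q) :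
    fieldCoord E p (X + Y) = fieldCoord E p X + fieldCoord E p Y := by
  ext x
  simp only [fieldCoord, Pi.add_apply]
  exact map_add _ _ _

lemma fieldCoord_smul (p : M) (f : M → ℝ) (X : ∀ q : M, TangentSpace 𝓘(ℝ, E) q) :
    fieldCoord E p (f • X) = fun x ↦ (f ∘ (chartAt E p).symm) x • fieldCoord E p X x := by
  ext x
  simp only [fieldCoord, Pi.smul_apply']
  exact map_smul _ _ _

lemma fieldCoord_chart {p q : M} (hq : q ∈ (chartAt E p).source)
    (X : ∀ q : M, TangentSpace 𝓘(ℝ, E) q) :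
    fieldCoord E p X (chartAt E p q) = coord p q (X q) := by
  simp only [fieldCoord]
  rw [(chartAt E p).left_inv hq]

/-- The covariant derivative in the chart at `p`. -/
lemma coord_connection (D : AffineConnection 𝓘(ℝ, E) M) {p q : M}
    (hq : q ∈ (chartAt E p).source) {Z : ∀ q : M, TangentSpace 𝓘(ℝ, E) q}
    (hZ : MDifferentiableAt 𝓘(ℝ, E) (𝓘(ℝ, E).prod 𝓘(ℝ, E)) (T% Z) q)
    (v : TangentSpace 𝓘(ℝ, E) q) :
    coord p q (D Z q v) = fderiv ℝ (fieldCoord E p Z) (chartAt E p q) (coord p q v)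
      + christoffel D p (chartAt E p q) (coord p q v) (coord p q (Z q)) := by
  have hx := (chartAt E p).map_source hq
  -- The Leibniz terms of the connection and of the coordinate derivative cancel, so the difference
  -- depends only on the value of $Z$ at $q$. It can be evaluated on a field with locally constant
  -- coordinates.
  let Φ : (∀ q : M, TangentSpace 𝓘(ℝ, E) q) → E := fun Z ↦
    coord p q (D Z q v) - fderiv ℝ (fieldCoord E p Z) (chartAt E p q) (coord p q v)
  have hΦ : TensorialAt 𝓘(ℝ, E) E Φ q := by
    constructor
    · intro f σ hf hσ
      have h1 := D.isCovariantDerivativeOnUniv.leibniz hσ hf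
      have h2 := (mdifferentiableAt_field_iff hq).1 hσ
      have h3 := (mdifferentiableAt_iff_chart hq).1 hf
      simp only [Φ]
      rw [h1, fieldCoord_smul, fderiv_fun_smul h3 h2]
      have h4 := mvfderiv_eq_fderiv_chart hq hf v
      simp only [add_apply, smul_apply,
        ContinuousLinearMap.smulRight_apply, map_add, map_smul, Function.comp_apply]
      rw [(chartAt E p).left_inv hq, h4, fieldCoord_chart hq]
      module
    · intro σ σ' hσ hσ'
      have h2 := (mdifferentiableAt_field_iff hq).1 hσ
      have h3 := (mdifferentiableAt_field_iff hq).1 hσ'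
      simp only [Φ]
      rw [AffineConnection.add D hσ hσ', fieldCoord_add, fderiv_add h2 h3]
      simp only [add_apply, map_add]
      module
  have h := hΦ.pointwise hZ (mdifferentiableAt_frame hq (coord p q (Z q)))
    (frame_coord hq (Z q)).symm
  have h1 : fderiv ℝ (fieldCoord E p (frame E p (coord p q (Z q)))) (chartAt E p q) = 0 := by
    rw [(fieldCoord_frame_eventuallyEq (coord p q (Z q)) hx).fderiv_eq]
    simp
  have h2 := christoffel_apply D hx (coord p q v) (coord p q (Z q))
  rw [(chartAt E p).left_inv hq, frame_coord hq] at h2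
  simp only [Φ, h1, zero_apply, sub_zero, ← h2] at h
  rw [← h]
  abel

/-- The curvature in the chart at `p`. -/
lemma coord_curvature (D : AffineConnection 𝓘(ℝ, E) M) {p q : M}
    (hq : q ∈ (chartAt E p).source) {X Y Z : ∀ q : M, TangentSpace 𝓘(ℝ, E) q}
    (hX : DifferentiableAt ℝ (fieldCoord E p X) (chartAt E p q))
    (hY : DifferentiableAt ℝ (fieldCoord E p Y) (chartAt E p q))
    (hZ : ContDiffAt ℝ 2 (fieldCoord E p Z) (chartAt E p q))
    (hΓ : DifferentiableAt ℝ (christoffel D p) (chartAt E p q)) :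
    coord p q (curvature D X Y Z q)
      = coordCurvature (christoffel D p) (chartAt E p q) (coord p q (X q)) (coord p q (Y q))
          (coord p q (Z q)) := by
  set x := chartAt E p q with hxdef
  set Γ := christoffel D p with hΓdef
  set z := fieldCoord E p Z with hz
  have hx : x ∈ (chartAt E p).target := (chartAt E p).map_source hq
  have hz1 : DifferentiableAt ℝ z x := hZ.differentiableAt (by simp)
  have hz2 : DifferentiableAt ℝ (fderiv ℝ z) x :=
    (hZ.fderiv_right (m := 1) le_rfl).differentiableAt (by simp)
  have aux : ∀ X Y : (∀ q : M, TangentSpace 𝓘(ℝ, E) q),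
      DifferentiableAt ℝ (fieldCoord E p Y) x →
      coord p q (D (fun r ↦ D Z r (Y r)) q (X q))
        = fderiv ℝ (fderiv ℝ z) x (coord p q (X q)) (coord p q (Y q))
          + fderiv ℝ z x (fderiv ℝ (fieldCoord E p Y) x (coord p q (X q)))
          + fderiv ℝ Γ x (coord p q (X q)) (coord p q (Y q)) (coord p q (Z q))
          + Γ x (fderiv ℝ (fieldCoord E p Y) x (coord p q (X q))) (coord p q (Z q))
          + Γ x (coord p q (Y q)) (fderiv ℝ z x (coord p q (X q)))
          + Γ x (coord p q (X q)) (fderiv ℝ z x (coord p q (Y q))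
            + Γ x (coord p q (Y q)) (coord p q (Z q))) := by
    intro X Y hY
    set y := fieldCoord E p Y with hy
    have hev : fieldCoord E p (fun r ↦ D Z r (Y r))
        =ᶠ[𝓝 x] fun t ↦ fderiv ℝ z t (y t) + Γ t (y t) (z t) := by
      filter_upwards [(chartAt E p).open_target.mem_nhds hx,
        hZ.eventually (by simp)] with t ht htz
      have hq' := (chartAt E p).map_target ht
      have h1 : MDifferentiableAt 𝓘(ℝ, E) (𝓘(ℝ, E).prod 𝓘(ℝ, E)) (T% Z)
          ((chartAt E p).symm t) := by
        rw [mdifferentiableAt_field_iff hq', (chartAt E p).right_inv ht]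
        exact htz.differentiableAt (by simp)
      have h2 := coord_connection D hq' h1 (Y ((chartAt E p).symm t))
      rw [(chartAt E p).right_inv ht] at h2
      exact h2
    have hder : HasFDerivAt (fun t ↦ fderiv ℝ z t (y t) + Γ t (y t) (z t)) _ x :=
      (hz2.hasFDerivAt.clm_apply hY.hasFDerivAt).add
        ((hΓ.hasFDerivAt.clm_apply hY.hasFDerivAt).clm_apply hz1.hasFDerivAt)
    have hm : MDifferentiableAt 𝓘(ℝ, E) (𝓘(ℝ, E).prod 𝓘(ℝ, E)) (T% (fun r ↦ D Z r (Y r))) q := by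
      rw [mdifferentiableAt_field_iff hq]
      exact hder.differentiableAt.congr_of_eventuallyEq hev
    have hyq : y x = coord p q (Y q) := fieldCoord_chart hq Y
    have hzq : z x = coord p q (Z q) := fieldCoord_chart hq Z
    have hmZ := (mdifferentiableAt_field_iff hq).2 hz1
    rw [coord_connection D hq hm, hev.fderiv_eq, hder.fderiv, coord_connection D hq hmZ, ← hyq,
      ← hzq]
    simp only [add_apply, ContinuousLinearMap.comp_apply,
      ContinuousLinearMap.flip_apply, map_add]
    abel
  have hmZ := (mdifferentiableAt_field_iff hq).2 hz1
  -- The bracket term cancels the derivatives of `X` and `Y` left by the iterated covariant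
  -- derivatives.
  have hb := coord_connection D hq hmZ (VectorField.mlieBracket 𝓘(ℝ, E) X Y q)
  rw [coord_mlieBracket hq hX hY] at hb
  have hsymm := fderiv_fderiv_comm hZ (coord p q (X q)) (coord p q (Y q))
  have e : coord p q (curvature D X Y Z q) = coord p q (D (fun r ↦ D Z r (Y r)) q (X q))
      - coord p q (D (fun r ↦ D Z r (X r)) q (Y q))
      - coord p q (D Z q (VectorField.mlieBracket 𝓘(ℝ, E) X Y q)) := by
    simp only [curvature]
    exact (map_sub _ _ _).trans (congrArg₂ _ (map_sub _ _ _) rfl)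
  rw [e, aux X Y hY, aux Y X hX, hb, hsymm, coordCurvature]
  simp only [map_add, map_sub, sub_apply]
  abel

/-- Values of the connection on germs of fields. -/
lemma connection_congr (D : AffineConnection 𝓘(ℝ, E) M) {q : M}
    {X Y : ∀ q : M, TangentSpace 𝓘(ℝ, E) q}
    (hX : MDifferentiableAt 𝓘(ℝ, E) (𝓘(ℝ, E).prod 𝓘(ℝ, E)) (T% X) q) (h : ∀ᶠ z in 𝓝 q, X z = Y z) :
    D X q = D Y q := by
  have hY : MDifferentiableAt 𝓘(ℝ, E) (𝓘(ℝ, E).prod 𝓘(ℝ, E)) (T% Y) q := by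
    refine hX.congr_of_eventuallyEq ?_
    filter_upwards [h] with z hz
    simp [hz]
  exact D.isCovariantDerivativeOnUniv.congr_of_eventuallyEq hX hY Filter.univ_mem h

/-- The standard extension has constant coordinates in the trivialization at `p`, so the pointwise
curvature is computed on frame fields. -/
lemma extend_eventuallyEq_frame {p : M} (v : TangentSpace 𝓘(ℝ, E) p) :
    ∀ᶠ z in 𝓝 p, FiberBundle.extend E v z = frame E p v z := by
  filter_upwards [(chartAt E p).open_source.mem_nhds (mem_chart_source E p)] with z hz
  refine Eq.trans ?_ (frame_eq_symm hz v).symm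
  exact congrArg (fun a ↦ (trivializationAt E (TangentSpace 𝓘(ℝ, E)) p).symm z a)
    ((coord_apply (mem_chart_source E p) v).symm.trans (coord_self p v))

/-- The curvature tensor at the centre of a chart. -/
lemma curvatureAt_eq_coordCurvature (D : AffineConnection 𝓘(ℝ, E) M) {p : M}
    (hΓ : DifferentiableAt ℝ (christoffel D p) (chartAt E p p)) (u v w : TangentSpace 𝓘(ℝ, E) p) :
    curvatureAt D p u v w = coordCurvature (christoffel D p) (chartAt E p p) u v w := by
  have hp := mem_chart_source E p
  have hs : ∀ v : TangentSpace 𝓘(ℝ, E) p,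
      ContDiffAt ℝ ∞ (fieldCoord E p (FiberBundle.extend E v)) (chartAt E p p) := by
    intro v
    rw [← contMDiffAt_field_iff le_rfl hp]
    refine (contMDiffAt_frame hp v).congr_of_eventuallyEq ?_
    filter_upwards [extend_eventuallyEq_frame v] with z hz
    simp only [hz]
  have h := coord_curvature D hp ((hs u).differentiableAt (by simp))
    ((hs v).differentiableAt (by simp)) ((hs w).of_le (WithTop.coe_le_coe.2 le_top)) hΓ
  simp only [coord_self, FiberBundle.extend_apply_self] at h
  exact h

end Christoffel

/-! ### The Koszul formula -/

section Koszul

variable {E : Type*} [NormedAddCommGroup E] [NormedSpace ℝ E]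
  {F : Type*} [NormedAddCommGroup F] [NormedSpace ℝ F]

lemma differentiableAt_of_clm_apply [FiniteDimensional ℝ E] {X : Type*} [NormedAddCommGroup X]
    [NormedSpace ℝ X] {T : X → E →L[ℝ] F} {x : X} (h : ∀ a, DifferentiableAt ℝ (fun y ↦ T y a) x) :
    DifferentiableAt ℝ T x := by
  let b := Module.finBasis ℝ E
  have e : T = fun y ↦ ∑ i, ContinuousLinearMap.smulRightL ℝ E F
      (LinearMap.toContinuousLinearMap (b.coord i)) (T y (b i)) := by
    ext y v
    have h1 := congrArg (T y) (b.sum_repr v).symm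
    rw [map_sum] at h1
    simpa using h1
  rw [e]
  exact DifferentiableAt.fun_sum fun i _ ↦
    (ContinuousLinearMap.differentiableAt _).comp x (h (b i))

lemma differentiableAt_clm_inverse [CompleteSpace E] {X : Type*} [NormedAddCommGroup X]
    [NormedSpace ℝ X] {T : X → E →L[ℝ] F} {x : X} (hT : DifferentiableAt ℝ T x) (e : E ≃L[ℝ] F)
    (he : (e : E →L[ℝ] F) = T x) : DifferentiableAt ℝ (fun y ↦ (T y).inverse) x := by
  have h1 : DifferentiableAt ℝ ContinuousLinearMap.inverse (T x) := by
    rw [← he]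
    exact (contDiffAt_map_inverse (n := 1) e).differentiableAt (by simp)
  exact h1.comp x hT

lemma exists_equiv_of_nondegenerate [FiniteDimensional ℝ E] (B : E →L[ℝ] E →L[ℝ] ℝ)
    (hB : ∀ a, (∀ b, B a b = 0) → a = 0) :
    ∃ e : E ≃L[ℝ] (E →L[ℝ] ℝ), (e : E →L[ℝ] E →L[ℝ] ℝ) = B := by
  have hinj : Function.Injective B.toLinearMap := by
    rw [← LinearMap.ker_eq_bot, LinearMap.ker_eq_bot']
    exact fun a ha ↦ hB a fun b ↦ congrArg (fun L : E →L[ℝ] ℝ ↦ L b) ha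
  have hfin : Module.finrank ℝ E = Module.finrank ℝ (E →L[ℝ] ℝ) := by
    rw [← (LinearMap.toContinuousLinearMap : (E →ₗ[ℝ] ℝ) ≃ₗ[ℝ] (E →L[ℝ] ℝ)).finrank_eq]
    exact (Subspace.dual_finrank_eq (K := ℝ) (V := E)).symm
  refine ⟨(LinearMap.linearEquivOfInjective B.toLinearMap hinj hfin).toContinuousLinearEquiv, ?_⟩
  ext a b
  rfl

variable {h : E → E →L[ℝ] E →L[ℝ] ℝ} {Γ Γ' : E → E →L[ℝ] E →L[ℝ] E}

lemma koszul {y : E} (hs : ∀ a b, h y a b = h y b a) (ht : ∀ a b, Γ y a b = Γ y b a)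
    (hm : ∀ u a b, fderiv ℝ h y u a b = h y (Γ y u a) b + h y a (Γ y u b)) (u v w : E) :
    2 * h y (Γ y u v) w = fderiv ℝ h y u v w + fderiv ℝ h y v u w - fderiv ℝ h y w u v := by
  rw [hm, hm, hm, ht v u, ht w u, ht w v, hs v (Γ y u w)]
  ring

/-- By the Koszul formula, $h(\Gamma(u,v),w)$ depends only on derivatives of $h$, and $h$ is
nondegenerate. -/
lemma christoffel_unique {y : E} (hs : ∀ a b, h y a b = h y b a)
    (hnd : ∀ a, (∀ b, h y a b = 0) → a = 0)
    (ht : ∀ a b, Γ y a b = Γ y b a)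
    (hm : ∀ u a b, fderiv ℝ h y u a b = h y (Γ y u a) b + h y a (Γ y u b))
    (ht' : ∀ a b, Γ' y a b = Γ' y b a)
    (hm' : ∀ u a b, fderiv ℝ h y u a b = h y (Γ' y u a) b + h y a (Γ' y u b)) : Γ y = Γ' y := by
  ext u v
  refine sub_eq_zero.1 (hnd _ fun w ↦ ?_)
  have h1 := koszul hs ht hm u v w
  have h2 := koszul hs ht' hm' u v w
  simp only [map_sub, sub_apply]
  linarith

/-- The Koszul formula writes $\Gamma(u,v)$ as the inverse of $h$ applied to first derivatives of
$h$, both differentiable for $h$ of class $C^2$. -/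
lemma differentiableAt_christoffel [FiniteDimensional ℝ E] {y₀ : E} (hh : ContDiffAt ℝ 2 h y₀)
    (hs : ∀ᶠ y in 𝓝 y₀, ∀ a b, h y a b = h y b a)
    (hnd : ∀ᶠ y in 𝓝 y₀, ∀ a, (∀ b, h y a b = 0) → a = 0)
    (ht : ∀ᶠ y in 𝓝 y₀, ∀ a b, Γ y a b = Γ y b a)
    (hm : ∀ᶠ y in 𝓝 y₀, ∀ u a b, fderiv ℝ h y u a b = h y (Γ y u a) b + h y a (Γ y u b)) :
    DifferentiableAt ℝ Γ y₀ := by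
  have : CompleteSpace E := FiniteDimensional.complete ℝ E
  have hd2 := (hasFDerivAt_fderiv hh).differentiableAt
  have hd1 : DifferentiableAt ℝ h y₀ := hh.differentiableAt (by simp)
  refine differentiableAt_of_clm_apply fun u ↦ differentiableAt_of_clm_apply fun v ↦ ?_
  have hinv : DifferentiableAt ℝ (fun y ↦ (h y).inverse) y₀ := by
    obtain ⟨e, he⟩ := exists_equiv_of_nondegenerate _ hnd.self_of_nhds
    exact differentiableAt_clm_inverse hd1 e he
  let K : E → E →L[ℝ] ℝ := fun y ↦
    (1 / 2 : ℝ) • (fderiv ℝ h y u v + fderiv ℝ h y v u - ((fderiv ℝ h y).flip u).flip v)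
  have hK : DifferentiableAt ℝ K y₀ := by
    refine differentiableAt_of_clm_apply fun w ↦ ?_
    have hc : ∀ a b c : E, DifferentiableAt ℝ (fun y ↦ fderiv ℝ h y a b c) y₀ := fun a b c ↦
      ((hd2.clm_apply (differentiableAt_const a)).clm_apply (differentiableAt_const b)).clm_apply
        (differentiableAt_const c)
    exact (((hc u v w).add (hc v u w)).sub (hc w u v)).const_smul (1 / 2 : ℝ)
  refine (hinv.clm_apply hK).congr_of_eventuallyEq ?_
  filter_upwards [hs, hnd, ht, hm] with y hs hnd ht hm
  obtain ⟨e, he⟩ := exists_equiv_of_nondegenerate _ hnd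
  have e1 : h y (Γ y u v) = K y := by
    ext w
    have := koszul hs ht hm u v w
    simp only [K, smul_apply, sub_apply, add_apply, ContinuousLinearMap.flip_apply, smul_eq_mul]
    linarith
  rw [← e1, ← he, ContinuousLinearMap.inverse_equiv]
  simp

end Koszul

/-! ### Kähler–Norden structures in charts -/

section Ambient

variable {E : Type*} [NormedAddCommGroup E] [NormedSpace ℝ E] [FiniteDimensional ℝ E]
  {M : Type*} [TopologicalSpace M] [ChartedSpace E M] [IsManifold 𝓘(ℝ, E) ∞ M]

/-- A field of bilinear forms in the chart at `p`. -/
def coordForm (h : BilinField 𝓘(ℝ, E) M) (p : M) (x : E) : E →L[ℝ] E →L[ℝ] ℝ :=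
  (ContinuousLinearMap.precomp ℝ
    ((trivializationAt E (TangentSpace 𝓘(ℝ, E)) p).symmL ℝ ((chartAt E p).symm x))).comp
    ((h ((chartAt E p).symm x)).comp
      ((trivializationAt E (TangentSpace 𝓘(ℝ, E)) p).symmL ℝ ((chartAt E p).symm x)))

/-- A field of endomorphisms in the chart at `p`. -/
def coordEndo (J : EndField 𝓘(ℝ, E) M) (p : M) (x : E) : E →L[ℝ] E :=
  (coord p ((chartAt E p).symm x)).comp ((J ((chartAt E p).symm x)).comp
    ((trivializationAt E (TangentSpace 𝓘(ℝ, E)) p).symmL ℝ ((chartAt E p).symm x)))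

lemma coordForm_apply (h : BilinField 𝓘(ℝ, E) M) (p : M) (x a b : E) :
    coordForm h p x a b = h ((chartAt E p).symm x) (frame E p a ((chartAt E p).symm x))
      (frame E p b ((chartAt E p).symm x)) := rfl

lemma coordEndo_apply (J : EndField 𝓘(ℝ, E) M) (p : M) (x a : E) :
    coordEndo J p x a = coord p ((chartAt E p).symm x)
      (J ((chartAt E p).symm x) (frame E p a ((chartAt E p).symm x))) := rfl

lemma coordForm_chart (h : BilinField 𝓘(ℝ, E) M) {p q : M} (hq : q ∈ (chartAt E p).source)
    (a b : TangentSpace 𝓘(ℝ, E) q) :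
    coordForm h p (chartAt E p q) (coord p q a) (coord p q b) = h q a b := by
  rw [coordForm_apply, (chartAt E p).left_inv hq, frame_coord hq, frame_coord hq]

lemma coordEndo_chart (J : EndField 𝓘(ℝ, E) M) {p q : M} (hq : q ∈ (chartAt E p).source)
    (a : TangentSpace 𝓘(ℝ, E) q) :
    coordEndo J p (chartAt E p q) (coord p q a) = coord p q (J q a) := by
  rw [coordEndo_apply, (chartAt E p).left_inv hq, frame_coord hq]

lemma coordForm_associated (J : EndField 𝓘(ℝ, E) M) (h : BilinField 𝓘(ℝ, E) M) {p : M} {x : E}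
    (hx : x ∈ (chartAt E p).target) :
    coordForm (associated J h) p x = coordAssociated (coordEndo J p) (coordForm h p) x := by
  ext a b
  rw [coordAssociated_apply, coordForm_apply, coordForm_apply, coordEndo_apply,
    frame_coord ((chartAt E p).map_target hx)]
  rfl

lemma contDiffOn_chart_symm_of_contMDiffAt {V : Type*} [NormedAddCommGroup V] [NormedSpace ℝ V]
    {p : M} {G : M → V} (h : ∀ q ∈ (chartAt E p).source, ContMDiffAt 𝓘(ℝ, E) 𝓘(ℝ, V) ∞ G q) :
    ContDiffOn ℝ ∞ (fun x ↦ G ((chartAt E p).symm x)) (chartAt E p).target := by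
  intro x hx
  have h1 := (contMDiffAt_iff_chart le_rfl ((chartAt E p).map_target hx)).1
    (h _ ((chartAt E p).map_target hx))
  rw [(chartAt E p).right_inv hx] at h1
  exact h1.contDiffWithinAt

lemma contDiffOn_coordForm {h : BilinField 𝓘(ℝ, E) M} (hh : IsSemiRiemannianMetric h) (p : M) :
    ContDiffOn ℝ ∞ (coordForm h p) (chartAt E p).target := by
  refine contDiffOn_clm_apply.2 fun a ↦ contDiffOn_clm_apply.2 fun b ↦ ?_
  refine contDiffOn_chart_symm_of_contMDiffAt (E := E) (p := p) (G := fun q ↦ h q (frame E p a q) (frame E p b q))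
    fun q hq ↦ ?_
  have h1 := ContMDiffAt.clm_bundle_apply₂ (F₁ := E) (F₂ := E) (F₃ := ℝ)
    (E₁ := fun q : M ↦ TangentSpace 𝓘(ℝ, E) q) (E₂ := fun q : M ↦ TangentSpace 𝓘(ℝ, E) q)
    (E₃ := fun _ : M ↦ ℝ)
    (hh.smooth q) (contMDiffAt_frame hq a) (contMDiffAt_frame hq b)
  simp only [contMDiffAt_totalSpace] at h1
  exact h1.2

lemma contMDiffAt_endo_apply {J : EndField 𝓘(ℝ, E) M} {g : BilinField 𝓘(ℝ, E) M}
    (hJ : IsAlmostComplexNorden J g) {q : M} {X : ∀ q : M, TangentSpace 𝓘(ℝ, E) q}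
    (hX : ContMDiffAt 𝓘(ℝ, E) (𝓘(ℝ, E).prod 𝓘(ℝ, E)) ∞ (T% X) q) :
    ContMDiffAt 𝓘(ℝ, E) (𝓘(ℝ, E).prod 𝓘(ℝ, E)) ∞ (T% (fun q ↦ J q (X q))) q :=
  ContMDiffAt.clm_bundle_apply (F₁ := E) (F₂ := E)
    (E₁ := fun q : M ↦ TangentSpace 𝓘(ℝ, E) q) (E₂ := fun q : M ↦ TangentSpace 𝓘(ℝ, E) q)
    (hJ.smooth q) hX

lemma contDiffOn_coordEndo {J : EndField 𝓘(ℝ, E) M} {g : BilinField 𝓘(ℝ, E) M}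
    (hJ : IsAlmostComplexNorden J g) (p : M) :
    ContDiffOn ℝ ∞ (coordEndo J p) (chartAt E p).target := by
  refine contDiffOn_clm_apply.2 fun a x hx ↦ ?_
  have hq := (chartAt E p).map_target hx
  have h1 := (contMDiffAt_field_iff le_rfl hq).1
    (contMDiffAt_endo_apply hJ (contMDiffAt_frame hq a))
  rw [(chartAt E p).right_inv hx] at h1
  exact h1.contDiffWithinAt

section LeviCivita

variable {h : BilinField 𝓘(ℝ, E) M} {D : AffineConnection 𝓘(ℝ, E) M} {p : M} {x : E}

/-- Fields with constant coordinates commute, so vanishing torsion becomes symmetry. -/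
lemma IsLeviCivita.christoffel_symm [CompleteSpace E] (hD : IsLeviCivita h D)
    (hx : x ∈ (chartAt E p).target) (a b : E) :
    christoffel D p x a b = christoffel D p x b a := by
  have hq := (chartAt E p).map_target hx
  have h1 := D.torsion_eq_zero_iff.1 hD.torsion_eq_zero (mdifferentiableAt_frame hq a)
    (mdifferentiableAt_frame hq b)
  have hc : ∀ c : E, fderiv ℝ (fieldCoord E p (frame E p c)) x = 0 := fun c ↦ by
    rw [(fieldCoord_frame_eventuallyEq c hx).fderiv_eq]
    simp
  have hdc : ∀ c : E, DifferentiableAt ℝ (fieldCoord E p (frame E p c)) x := fun c ↦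
    (differentiableAt_const c).congr_of_eventuallyEq (fieldCoord_frame_eventuallyEq c hx)
  have h2 := coord_mlieBracket (X := frame E p a) (Y := frame E p b) hq
    (by rw [(chartAt E p).right_inv hx]; exact hdc a)
    (by rw [(chartAt E p).right_inv hx]; exact hdc b)
  rw [(chartAt E p).right_inv hx, hc, hc] at h2
  have h3 := congrArg (coord p ((chartAt E p).symm x)) h1
  have h4 := (map_sub (coord p ((chartAt E p).symm x)) _ _).symm.trans (h3.trans h2)
  rw [christoffel_apply D hx, christoffel_apply D hx]
  exact sub_eq_zero.1 (h4.trans (by simp))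

lemma IsLeviCivita.fderiv_coordForm [CompleteSpace E] (hD : IsLeviCivita h D)
    (hx : x ∈ (chartAt E p).target) (hd : DifferentiableAt ℝ (coordForm h p) x) (u a b : E) :
    fderiv ℝ (coordForm h p) x u a b
      = coordForm h p x (christoffel D p x u a) b + coordForm h p x a (christoffel D p x u b) := by
  have hq := (chartAt E p).map_target hx
  have h1 := hD.metric _ _ _ (mdifferentiableAt_frame hq a) (mdifferentiableAt_frame hq b)
    (frame E p u ((chartAt E p).symm x))
  rw [← fderiv_apply₂ hd, coordForm_apply, coordForm_apply, christoffel_apply D hx,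
    christoffel_apply D hx, frame_coord hq, frame_coord hq, ← h1]
  have hG : DifferentiableAt ℝ
      ((fun q ↦ h q (frame E p a q) (frame E p b q)) ∘ (chartAt E p).symm) x :=
    (hd.clm_apply (differentiableAt_const a)).clm_apply (differentiableAt_const b)
  refine fderiv_comp_chart_symm (G := fun q ↦ h q (frame E p a q) (frame E p b q)) hx ?_ u
  rw [mdifferentiableAt_iff_chart hq, (chartAt E p).right_inv hx]
  exact hG

end LeviCivita

variable {J : EndField 𝓘(ℝ, E) M} {g : BilinField 𝓘(ℝ, E) M} {D D' : AffineConnection 𝓘(ℝ, E) M}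
  {p : M} {x : E}

lemma coordForm_nondegenerate {h : BilinField 𝓘(ℝ, E) M} (hh : IsSemiRiemannianMetric h)
    (hx : x ∈ (chartAt E p).target) (a : E) (ha : ∀ b, coordForm h p x a b = 0) : a = 0 := by
  have hq := (chartAt E p).map_target hx
  have h1 := hh.nondegenerate _ (frame E p a ((chartAt E p).symm x)) fun w ↦ by
    have := ha (coord p _ w)
    rwa [coordForm_apply, frame_coord hq] at this
  have h2 := coord_frame hq a
  rw [h1, map_zero] at h2
  exact h2.symm

/-- Each global identity is tested on frame fields. They are available at every point of the chart,
so the identities hold on a neighbourhood and can be differentiated. -/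
theorem isKaehlerNordenGerm [CompleteSpace E] (hJg : IsAlmostComplexNorden J g)
    (hD : IsLeviCivita g D) (hK : IsParallel D J) (hx : x ∈ (chartAt E p).target) :
    IsKaehlerNordenGerm (coordEndo J p) (coordForm g p) (christoffel D p) x := by
  have hopen := (chartAt E p).open_target
  have hev := hopen.mem_nhds hx
  have hg : ∀ y ∈ (chartAt E p).target, ContDiffAt ℝ 2 (coordForm g p) y := fun y hy ↦
    ((contDiffOn_coordForm hJg.metric p).contDiffAt (hopen.mem_nhds hy)).of_le
      (WithTop.coe_le_coe.2 le_top)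
  have hJ : ∀ y ∈ (chartAt E p).target, ContDiffAt ℝ 2 (coordEndo J p) y := fun y hy ↦
    ((contDiffOn_coordEndo hJg p).contDiffAt (hopen.mem_nhds hy)).of_le
      (WithTop.coe_le_coe.2 le_top)
  have hs : ∀ᶠ y in 𝓝 x, ∀ a b, coordForm g p y a b = coordForm g p y b a :=
    Filter.Eventually.of_forall fun y a b ↦ by
      simp only [coordForm_apply]
      exact hJg.metric.symm _ _ _
  have hnd : ∀ᶠ y in 𝓝 x, ∀ a, (∀ b, coordForm g p y a b = 0) → a = 0 := by
    filter_upwards [hev] with y hy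
    exact coordForm_nondegenerate hJg.metric hy
  have ht : ∀ᶠ y in 𝓝 x, ∀ a b, christoffel D p y a b = christoffel D p y b a := by
    filter_upwards [hev] with y hy
    exact hD.christoffel_symm hy
  have hm : ∀ᶠ y in 𝓝 x, ∀ u a b, fderiv ℝ (coordForm g p) y u a b
      = coordForm g p y (christoffel D p y u a) b + coordForm g p y a (christoffel D p y u b) := by
    filter_upwards [hev] with y hy
    exact hD.fderiv_coordForm hy ((hg y hy).differentiableAt (by simp))
  refine ⟨hg x hx, hJ x hx, differentiableAt_christoffel (hg x hx) hs hnd ht hm, hs,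
    hnd.self_of_nhds, ?_, ?_, ht, hm, ?_⟩
  · filter_upwards [hev] with y hy a
    have hq := (chartAt E p).map_target hy
    rw [coordEndo_apply, coordEndo_apply, frame_coord hq, hJg.sq]
    exact (map_neg _ _).trans (congrArg _ (coord_frame hq a))
  · filter_upwards [hev] with y hy a b
    have hq := (chartAt E p).map_target hy
    rw [coordForm_apply, coordEndo_apply, coordEndo_apply, frame_coord hq, frame_coord hq,
      hJg.anti, coordForm_apply]
  · filter_upwards [hev] with y hy u a
    have hq := (chartAt E p).map_target hy
    have h1 := hK _ _ (mdifferentiableAt_frame hq a) (frame E p u ((chartAt E p).symm y))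
    have h2 := coord_connection D hq
      ((contMDiffAt_endo_apply hJg (contMDiffAt_frame hq a)).mdifferentiableAt (by simp))
      (frame E p u ((chartAt E p).symm y))
    rw [h1, (chartAt E p).right_inv hy, coord_frame hq] at h2
    have h3 : fderiv ℝ (coordEndo J p) y u a
        = fderiv ℝ (fieldCoord E p fun q ↦ J q (frame E p a q)) y u := by
      have hd := (hJ y hy).differentiableAt (by simp)
      have := (hd.hasFDerivAt.clm_apply (hasFDerivAt_const a y)).fderiv
      refine Eq.trans ?_ (congrArg (fun L : E →L[ℝ] E ↦ L u) this.symm)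
      simp
    rw [h3]
    refine h2.symm.trans ?_
    rw [christoffel_apply D hy, coordEndo_apply, frame_coord hq]

/-- The Levi-Civita connections of the two Norden metrics coincide. -/
theorem christoffel_associated [CompleteSpace E] (hJg : IsAlmostComplexNorden J g)
    (hD : IsLeviCivita g D) (hD' : IsLeviCivita (associated J g) D') (hK : IsParallel D J)
    (hx : x ∈ (chartAt E p).target) : christoffel D' p x = christoffel D p x := by
  have hG := isKaehlerNordenGerm hJg hD hK hx
  have hev : coordForm (associated J g) p =ᶠ[𝓝 x] coordAssociated (coordEndo J p) (coordForm g p) := by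
    filter_upwards [(chartAt E p).open_target.mem_nhds hx] with y hy
    exact coordForm_associated J g hy
  have hd : DifferentiableAt ℝ (coordForm (associated J g) p) x :=
    ((hG.contDiffAt_form.differentiableAt (by simp)).clm_comp
      (hG.contDiffAt_endo.differentiableAt (by simp))).congr_of_eventuallyEq hev
  have hsymm : ∀ a b : E, coordForm (associated J g) p x a b
      = coordForm (associated J g) p x b a := by
    intro a b
    simp only [coordForm_apply]
    change g _ (J _ _) _ = g _ (J _ _) _
    have h1 := hJg.anti ((chartAt E p).symm x) (frame E p a _) (J _ (frame E p b _))
    rw [hJg.sq, map_neg, neg_inj] at h1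
    rw [h1, hJg.metric.symm]
  -- Both connections are torsion-free and metric for the associated form, the one of $g$ by
  -- `metric_associated`.
  refine christoffel_unique hsymm ?_ (hD'.christoffel_symm hx) (hD'.fderiv_coordForm hx hd)
    (hD.christoffel_symm hx) ?_
  · intro a ha
    have hJ0 : coordEndo J p x a = 0 := hG.nondegenerate _ fun b ↦ by
      rw [← coordAssociated_apply, ← coordForm_associated J g hx]
      exact ha b
    have := hG.sq.self_of_nhds a
    rw [hJ0, map_zero] at this
    simpa using this.symm
  · intro u a b
    rw [hev.fderiv_eq, hev.eq_of_nhds]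
    exact hG.metric_associated u a b

end Ambient

/-! ### Fields along a map in charts -/

section Along

variable {E : Type*} [NormedAddCommGroup E] [NormedSpace ℝ E]
  {M : Type*} [TopologicalSpace M] [ChartedSpace E M] [IsManifold 𝓘(ℝ, E) ∞ M]
  {E' : Type*} [NormedAddCommGroup E'] [NormedSpace ℝ E']
  {M' : Type*} [TopologicalSpace M'] [ChartedSpace E' M'] [IsManifold 𝓘(ℝ, E') ∞ M']

/-- Coordinates of a field along `f` in the charts at `p` and `p'`. -/
def alongCoord (p : M) (p' : M') (f : M → M') (σ : ∀ q : M, TangentSpace 𝓘(ℝ, E') (f q)) (x : E) :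
    E' :=
  coord p' (f ((chartAt E p).symm x)) (σ ((chartAt E p).symm x))

variable {p q : M} {p' : M'} {f : M → M'} {σ : ∀ q : M, TangentSpace 𝓘(ℝ, E') (f q)}

lemma alongCoord_chart (hq : q ∈ (chartAt E p).source) :
    alongCoord p p' f σ (chartAt E p q) = coord p' (f q) (σ q) := by
  simp only [alongCoord]
  rw [(chartAt E p).left_inv hq]

lemma eventually_coord_along (hf : ContinuousAt f q) (hq' : f q ∈ (chartAt E' p').source) :
    (fun z ↦ coord p' (f z) (σ z)) =ᶠ[𝓝 q]
      fun z ↦ (trivializationAt E' (TangentSpace 𝓘(ℝ, E')) p'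
        (TotalSpace.mk' E' (f z) (σ z))).2 := by
  filter_upwards [hf ((chartAt E' p').open_source.mem_nhds hq')] with z hz
  exact coord_apply hz _

/-- Smoothness of a field along `f` does not depend on the target chart: the bundle uses the one at
`f q`, the local expressions the one at `p'`. -/
lemma contMDiffAt_along_iff (hf : ContMDiffAt 𝓘(ℝ, E) 𝓘(ℝ, E') ∞ f q)
    (hq : q ∈ (chartAt E p).source) (hq' : f q ∈ (chartAt E' p').source) :
    ContMDiffAt 𝓘(ℝ, E) (𝓘(ℝ, E').prod 𝓘(ℝ, E')) ∞
      (fun z ↦ (TotalSpace.mk' E' (f z) (σ z) : TotalSpace E' (TangentSpace 𝓘(ℝ, E')))) q ↔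
    ContDiffAt ℝ ∞ (alongCoord p p' f σ) (chartAt E p q) := by
  have h1 := contMDiffAt_iff_chart le_rfl hq (G := fun z ↦ coord p' (f z) (σ z))
  have h2 := Trivialization.contMDiffWithinAt_snd_comp_iff₂ (IB := 𝓘(ℝ, E')) (n := ∞)
    (IM := 𝓘(ℝ, E)) (s := Set.univ) (x := q)
    (e := trivializationAt E' (TangentSpace 𝓘(ℝ, E')) (f q))
    (e' := trivializationAt E' (TangentSpace 𝓘(ℝ, E')) p')
    (f := fun z ↦ (TotalSpace.mk' E' (f z) (σ z) : TotalSpace E' (TangentSpace 𝓘(ℝ, E'))))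
    hf.contMDiffWithinAt
    ((Trivialization.mem_source _).2 (mem_baseSet_iff.2 (mem_chart_source E' (f q))))
    ((Trivialization.mem_source _).2 (mem_baseSet_iff.2 hq'))
  rw [contMDiffWithinAt_univ, contMDiffWithinAt_univ] at h2
  rw [contMDiffAt_totalSpace]
  refine (and_iff_right hf).trans (h2.trans ?_)
  rw [← (eventually_coord_along (σ := σ) hf.continuousAt hq').contMDiffAt_iff, h1]
  rfl

variable [FiniteDimensional ℝ E']

/-- Covariant derivatives along a map in charts. -/
lemma coord_covAlong (D : AffineConnection 𝓘(ℝ, E') M') (hf : ContMDiffAt 𝓘(ℝ, E) 𝓘(ℝ, E') ∞ f q)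
    (hq : q ∈ (chartAt E p).source) (hq' : f q ∈ (chartAt E' p').source)
    (hσ : ContMDiffAt 𝓘(ℝ, E) (𝓘(ℝ, E').prod 𝓘(ℝ, E')) ∞
      (fun z ↦ (TotalSpace.mk' E' (f z) (σ z) : TotalSpace E' (TangentSpace 𝓘(ℝ, E')))) q)
    (v : TangentSpace 𝓘(ℝ, E) q) :
    coord p' (f q) (covAlong f D σ q v)
      = coordCovAlong (chartAt E' p' ∘ f ∘ (chartAt E p).symm) (christoffel D p')
          (alongCoord p p' f σ) (chartAt E p q) (coord p q v) := by
  set x := chartAt E p q with hx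
  have hxt : x ∈ (chartAt E p).target := (chartAt E p).map_source hq
  have hxq : (chartAt E p).symm x = q := (chartAt E p).left_inv hq
  have hfq := mem_chart_source E' (f q)
  set F : E → E' := chartAt E' p' ∘ f ∘ (chartAt E p).symm with hF
  have hFx : F x = chartAt E' p' (f q) := by simp [hF, hxq]
  have hfd : MDifferentiableAt 𝓘(ℝ, E) 𝓘(ℝ, E') f q := hf.mdifferentiableAt (by simp)
  have hFd : DifferentiableAt ℝ F x := by
    have h1 := (mdifferentiableAt_iff_chart hq (G := chartAt E' p' ∘ f)).1
      ((mdifferentiableAt_chart hq').comp q hfd)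
    exact h1
  have hdF : fderiv ℝ F x (coord p q v)
      = coord p' (f q) (mfderiv 𝓘(ℝ, E) 𝓘(ℝ, E') f q v) := by
    have h1 := coord_mfderiv_frame (p := p) (p' := p') (f := f) hxt (by rwa [hxq]) (by rwa [hxq])
      (coord p q v)
    rw [hxq, frame_coord hq] at h1
    exact h1.symm
  -- coordinates in the chart at `f q`
  set c : E → E' := alongCoord p (f q) f σ with hc
  have hcd : DifferentiableAt ℝ c x :=
    ((contMDiffAt_along_iff hf hq hfq).1 hσ).differentiableAt (by simp)
  -- The definition of `covAlong` uses the trivialization at `f q`, and `A` is the transition to the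
  -- chart at `p'`, followed along `f`. Its derivative is that of the frame field in the second term
  -- of the definition.
  let A : E → E' →L[ℝ] E' := fun z ↦ (coord p' (f ((chartAt E p).symm z))).comp
    ((trivializationAt E' (TangentSpace 𝓘(ℝ, E')) (f q)).symmL ℝ (f ((chartAt E p).symm z)))
  have hA : ∀ z a, A z a = coord p' (f ((chartAt E p).symm z))
      (frame E' (f q) a (f ((chartAt E p).symm z))) := fun z a ↦ rfl
  have hcont : ContinuousAt (fun z ↦ f ((chartAt E p).symm z)) x := by
    refine ContinuousAt.comp (g := f) ?_ ((chartAt E p).continuousAt_symm hxt)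
    rw [hxq]
    exact hf.continuousAt
  have hevA : ∀ a, (fun z ↦ A z a) =ᶠ[𝓝 x] fun z ↦ fieldCoord E' p' (frame E' (f q) a) (F z) := by
    intro a
    have : ∀ᶠ z in 𝓝 x, f ((chartAt E p).symm z) ∈ (chartAt E' p').source := by
      refine hcont ((chartAt E' p').open_source.mem_nhds ?_)
      simpa only [hxq]
    filter_upwards [this] with z hz
    have hs : (chartAt E' p').symm (F z) = f ((chartAt E p).symm z) := (chartAt E' p').left_inv hz
    rw [hA, fieldCoord, hs]
  have hfr : ∀ a, DifferentiableAt ℝ (fieldCoord E' p' (frame E' (f q) a)) (F x) := by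
    intro a
    rw [hFx]
    exact (mdifferentiableAt_field_iff hq').1 (mdifferentiableAt_frame hfq a)
  have hAd : DifferentiableAt ℝ A x := by
    refine differentiableAt_of_clm_apply fun a ↦ ?_
    exact ((hfr a).comp x hFd).congr_of_eventuallyEq (hevA a)
  have hdA : ∀ u a, fderiv ℝ A x u a
      = fderiv ℝ (fieldCoord E' p' (frame E' (f q) a)) (F x) (fderiv ℝ F x u) := by
    intro u a
    have h1 := (hAd.hasFDerivAt.clm_apply (hasFDerivAt_const a x)).fderiv
    rw [(hevA a).fderiv_eq] at h1
    have h2 := ((hfr a).hasFDerivAt.comp x hFd.hasFDerivAt).fderiv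
    have h3 := congrArg (fun L : E →L[ℝ] E' ↦ L u) (h1.symm.trans h2)
    simpa using h3
  have hev : alongCoord p p' f σ =ᶠ[𝓝 x] fun z ↦ A z (c z) := by
    have : ∀ᶠ z in 𝓝 x, f ((chartAt E p).symm z) ∈ (chartAt E' (f q)).source := by
      refine hcont ((chartAt E' (f q)).open_source.mem_nhds ?_)
      simp only [hxq, hfq]
    filter_upwards [this] with z hz
    rw [hA, hc, alongCoord, alongCoord, frame_coord hz]
  have hder := hev.fderiv_eq.trans (hAd.hasFDerivAt.clm_apply hcd.hasFDerivAt).fderiv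
  -- the definition of the covariant derivative along `f`
  have hcq : c x = σ q := by
    rw [hc, alongCoord_chart hq, coord_self]
  have hZ : ∀ᶠ y in 𝓝 (f q), frame E' (f q) (c x) y
      = (trivializationAt E' (TangentSpace 𝓘(ℝ, E')) (f q)).symm y (c x) := by
    filter_upwards [(chartAt E' (f q)).open_source.mem_nhds hfq] with y hy
    exact frame_eq_symm hy _
  have hdef : covAlong f D σ q v = frame E' (f q) (fderiv ℝ c x (coord p q v)) (f q)
      + D (frame E' (f q) (c x)) (f q) (mfderiv 𝓘(ℝ, E) 𝓘(ℝ, E') f q v) := by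
    have hevc := eventually_coord_along (σ := σ) hf.continuousAt hfq
    have hG : MDifferentiableAt 𝓘(ℝ, E) 𝓘(ℝ, E') (fun z ↦ coord (f q) (f z) (σ z)) q :=
      (mdifferentiableAt_iff_chart hq).2 hcd
    have h1 := mvfderiv_eq_fderiv_chart hq hG v
    have h2 : mvfderiv 𝓘(ℝ, E) (fun z ↦ coord (f q) (f z) (σ z)) q v
      = mvfderiv 𝓘(ℝ, E) (fun z ↦ (trivializationAt E' (TangentSpace 𝓘(ℝ, E')) (f q)
        (TotalSpace.mk' E' (f z) (σ z))).2) q v := by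
      simp only [mvfderiv]
      rw [hevc.mfderiv_eq]
      rfl
    have h3 : (trivializationAt E' (TangentSpace 𝓘(ℝ, E')) (f q)
        (TotalSpace.mk' E' (f q) (σ q))).2 = c x :=
      (hevc.eq_of_nhds.symm).trans (by rw [hc, alongCoord_chart hq])
    rw [connection_congr D (mdifferentiableAt_frame hfq (c x)) hZ, frame_eq_symm hfq]
    simp only [covAlong]
    rw [h3, ← h2, h1]
    rfl
  have hAx : ∀ a, coord p' (f q) (frame E' (f q) a (f q)) = A x a := fun a ↦ by
    rw [hA, hxq]
  have hL1 := coord_connection D hq' (mdifferentiableAt_frame hfq (c x))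
    (mfderiv 𝓘(ℝ, E) 𝓘(ℝ, E') f q v)
  rw [hdef, map_add, hL1, ← hdF, hAx, hAx, ← hFx, coordCovAlong, hder, hev.eq_of_nhds]
  have h4 := hdA (coord p q v) (c x)
  simp only [add_apply, ContinuousLinearMap.comp_apply, ContinuousLinearMap.flip_apply]
  rw [h4]
  abel

end Along

/-! ### Linear algebra of lightlike hyperplanes -/

section Hyperplane

variable {V W : Type*} [AddCommGroup V] [Module ℝ V] [FiniteDimensional ℝ V]
  [AddCommGroup W] [Module ℝ W] [FiniteDimensional ℝ W] {L : V →ₗ[ℝ] W} {B : W →ₗ[ℝ] W →ₗ[ℝ] ℝ}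
  {ξ : V} {N : W}

lemma exists_eq_add_smul (hL : Function.Injective L)
    (hdim : Module.finrank ℝ W = Module.finrank ℝ V + 1) (hsymm : ∀ a b, B a b = B b a)
    (hξ : ∀ w, B (L ξ) (L w) = 0) (hN : B N (L ξ) = 1) (a : W) :
    ∃ (u : V) (c : ℝ), a = L u + c • N := by
  let Φ : (V × ℝ) →ₗ[ℝ] W := L.coprod (LinearMap.toSpanSingleton ℝ W N)
  have hΦ : Function.Injective Φ := by
    rw [← LinearMap.ker_eq_bot, LinearMap.ker_eq_bot']
    rintro ⟨u, c⟩ huc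
    have e : L u + c • N = 0 := huc
    have e1 : B (L u + c • N) (L ξ) = 0 := by rw [e]; simp
    rw [map_add, map_smul, LinearMap.add_apply, LinearMap.smul_apply, hsymm (L u), hξ, hN] at e1
    have hc : c = 0 := by simpa using e1
    rw [hc, zero_smul, add_zero] at e
    rw [hc, (map_eq_zero_iff L hL).1 e]
    rfl
  have hs : Function.Surjective Φ := by
    refine (LinearMap.injective_iff_surjective_of_finrank_eq_finrank ?_).1 hΦ
    rw [Module.finrank_prod, Module.finrank_self, hdim]
  obtain ⟨⟨u, c⟩, huc⟩ := hs a
  exact ⟨u, c, huc.symm⟩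

/-- The difference is orthogonal to the hyperplane, and to $N$ by the choice of the coefficient. In
particular the radical is a line. -/
lemma eq_smul_of_mem_radical (hL : Function.Injective L)
    (hdim : Module.finrank ℝ W = Module.finrank ℝ V + 1) (hsymm : ∀ a b, B a b = B b a)
    (hnd : ∀ a, (∀ b, B a b = 0) → a = 0) (hξ : ∀ w, B (L ξ) (L w) = 0) (hN : B N (L ξ) = 1)
    {v : V} (hv : ∀ w, B (L v) (L w) = 0) : v = B N (L v) • ξ := by
  refine sub_eq_zero.1 ((map_eq_zero_iff L hL).1 (hnd _ fun b ↦ ?_))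
  obtain ⟨u, c, rfl⟩ := exists_eq_add_smul hL hdim hsymm hξ hN b
  simp only [map_sub, map_smul, map_add, LinearMap.sub_apply, LinearMap.smul_apply, hv, hξ,
    hsymm _ N, hN, smul_eq_mul]
  ring

/-- Write $N'=Lu+cN$. Orthogonality to the screen puts $u$ in the radical, so $Lu$ is a multiple of
$L\xi$. Nullity of $N'$ removes that multiple, because $c\ne0$. -/
lemma eq_smul_of_transversal (hL : Function.Injective L)
    (hdim : Module.finrank ℝ W = Module.finrank ℝ V + 1) (hsymm : ∀ a b, B a b = B b a)
    (hnd : ∀ a, (∀ b, B a b = 0) → a = 0) (hξ : ∀ w, B (L ξ) (L w) = 0) (hN : B N (L ξ) = 1)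
    (hNN : B N N = 0) {S : Set V}
    (hS : ∀ u, ∃ s ∈ S, ∃ r, (∀ w, B (L r) (L w) = 0) ∧ u = s + r) (hNS : ∀ w ∈ S, B N (L w) = 0)
    {ξ' : V} {N' : W} (hξ' : ∀ w, B (L ξ') (L w) = 0) (hN' : B N' (L ξ') = 1) (hNN' : B N' N' = 0)
    (hNS' : ∀ w ∈ S, B N' (L w) = 0) : ∃ c : ℝ, N' = c • N := by
  obtain ⟨u, c, rfl⟩ := exists_eq_add_smul hL hdim hsymm hξ hN N'
  have hu : ∀ w, B (L u) (L w) = 0 := by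
    intro w
    obtain ⟨s, hs, r, hr, rfl⟩ := hS w
    have h1 := hNS' s hs
    rw [map_add, map_smul, LinearMap.add_apply, LinearMap.smul_apply, hNS s hs, smul_zero,
      add_zero] at h1
    rw [map_add, map_add, h1, hsymm, hr, add_zero]
  have e1 := eq_smul_of_mem_radical hL hdim hsymm hnd hξ hN hu
  have e2 := eq_smul_of_mem_radical hL hdim hsymm hnd hξ hN hξ'
  simp only [map_add, map_smul, LinearMap.add_apply, LinearMap.smul_apply, hu, smul_eq_mul,
    zero_add] at hN'
  simp only [map_add, map_smul, LinearMap.add_apply, LinearMap.smul_apply, hu, smul_eq_mul, hNN,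
    hsymm (L u) N] at hNN'
  have hc : c ≠ 0 := fun h ↦ by simp [h] at hN'
  have h3 : B N (L u) = 0 := by
    have : c * (2 * B N (L u)) = 0 := by linarith
    simpa [hc] using this
  rw [h3, zero_smul] at e1
  exact ⟨c, by rw [e1, map_zero, zero_add]⟩

end Hyperplane

lemma trace_eq_sum_repr {V ι : Type*} [AddCommGroup V] [Module ℝ V] [Fintype ι] [DecidableEq ι]
    (b : Module.Basis ι ℝ V) (T : V →ₗ[ℝ] V) :
    LinearMap.trace ℝ V T = ∑ i, b.repr (T (b i)) i := by
  rw [LinearMap.trace_eq_matrix_trace ℝ b, Matrix.trace]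
  simp [LinearMap.toMatrix_apply]

/-! ### The Ricci tensor -/

namespace IsUmbilicGerm

variable {E : Type*} [NormedAddCommGroup E] [NormedSpace ℝ E] [FiniteDimensional ℝ E]
  {E' : Type*} [NormedAddCommGroup E'] [NormedSpace ℝ E'] [FiniteDimensional ℝ E']
  {J : E' → E' →L[ℝ] E'} {g : E' → E' →L[ℝ] E' →L[ℝ] ℝ}
  {Γ : E' → E' →L[ℝ] E' →L[ℝ] E'} {F : E → E'} {C : E → E →L[ℝ] E →L[ℝ] E}
  {ξ : E → E} {N : E → E'} {ρ b : E → ℝ} {x₀ : E} {ν ν' : ℝ}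

/-- The endomorphism `J ∘ P` of the hypersurface. -/
lemma exists_endo_trace_eq_zero (h : IsUmbilicGerm J g Γ F C ξ N ρ b x₀)
    (hdim : Module.finrank ℝ E' = Module.finrank ℝ E + 1) :
    ∃ K : E →ₗ[ℝ] E, (∀ u, fderiv ℝ F x₀ (K u)
      = J (F x₀) (fderiv ℝ F x₀ (screenProj J g F ξ N x₀ u))) ∧ LinearMap.trace ℝ E K = 0 := by
  choose K hK using h.exists_endo_screenProj hdim
  have hadd : ∀ u v, screenProj J g F ξ N x₀ (u + v)
      = screenProj J g F ξ N x₀ u + screenProj J g F ξ N x₀ v := by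
    intro u v
    simp only [screenProj, map_add]
    module
  have hsmul : ∀ (c : ℝ) u, screenProj J g F ξ N x₀ (c • u) = c • screenProj J g F ξ N x₀ u := by
    intro c u
    simp only [screenProj, map_smul, smul_eq_mul]
    module
  -- $J(JPu)=-Pu$ is tangent, so $\tilde g(N,JPu)=0$ and $JP$ takes values in the screen. Hence
  -- $K^2=-P$ and $K^3=-K$.
  have hPK : ∀ u, screenProj J g F ξ N x₀ (K u) = K u := by
    intro u
    have e := h.associated_endo_radical (J (F x₀) (fderiv ℝ F x₀ (screenProj J g F ξ N x₀ u)))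
    rw [h.ambient.sq.self_of_nhds, map_neg, neg_apply, h.radical_right, neg_zero] at e
    rw [screenProj, hK, (mul_eq_zero.1 e.symm).resolve_left h.factor_ne_zero]
    simp
  let K' : E →ₗ[ℝ] E :=
    { toFun := K
      map_add' := fun u v ↦ h.injective (by simp only [map_add, hK, hadd])
      map_smul' := fun c u ↦ h.injective (by simp only [map_smul, hK, hsmul, RingHom.id_apply]) }
  refine ⟨K', hK, trace_eq_zero_of_cube K' fun u ↦ h.injective ?_⟩
  change fderiv ℝ F x₀ (K (K (K u))) = fderiv ℝ F x₀ (-K u)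
  rw [hK, hPK, hK (K u), hPK, h.ambient.sq.self_of_nhds, map_neg]

/-- In the trace over the first argument the rank-one terms give their values, the identity gives
$\dim M$, and $JP$ gives 0. One rank-one term lowers $\dim M$ to $\dim M-1$; the other gives $\tilde
g(JPu,v)=-g(Pu,Pv)$. -/
theorem ricci_equation (h : IsUmbilicGerm J g Γ F C ξ N ρ b x₀)
    (hdim : Module.finrank ℝ E' = Module.finrank ℝ E + 1) (hE : 2 ≤ Module.finrank ℝ E)
    (hR : ∀ x y z, coordCurvature Γ (F x₀) x y z = spaceFormCurvature (J (F x₀)).toLinearMap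
      ((ContinuousLinearMap.coeLM ℝ).comp (g (F x₀)).toLinearMap) ν ν' x y z)
    {ι : Type*} [Fintype ι] (bs : Module.Basis ι ℝ E) (u v : E) :
    ∑ i, bs.repr (coordCurvature C x₀ (bs i) u v) i
      = ((Module.finrank ℝ E : ℝ) - 1) * ν * g (F x₀) (fderiv ℝ F x₀ u) (fderiv ℝ F x₀ v)
        - (ν - ρ x₀ ^ 2 / b x₀) * g (F x₀) (fderiv ℝ F x₀ (screenProj J g F ξ N x₀ u))
            (fderiv ℝ F x₀ (screenProj J g F ξ N x₀ v)) := by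
  classical
  obtain ⟨K, hK, htr⟩ := h.exists_endo_trace_eq_zero hdim
  have hcurv := (h.fundamental_equations hdim hE hR).2.2.2
  set κ := ν - ρ x₀ ^ 2 / b x₀
  let gt : E →ₗ[ℝ] ℝ :=
    ((coordAssociated J g (F x₀)).flip (fderiv ℝ F x₀ v)).toLinearMap.comp (fderiv ℝ F x₀).toLinearMap
  let gl : E →ₗ[ℝ] ℝ :=
    ((g (F x₀)).flip (fderiv ℝ F x₀ v)).toLinearMap.comp (fderiv ℝ F x₀).toLinearMap
  let T : E →ₗ[ℝ] E := κ • (gt.smulRight (K u) - gt u • K)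
    + ν • (gl u • LinearMap.id - gl.smulRight u)
  have hT : ∀ z, coordCurvature C x₀ z u v = T z := by
    intro z
    refine h.injective ?_
    rw [hcurv]
    simp only [T, LinearMap.add_apply, LinearMap.smul_apply, LinearMap.sub_apply,
      LinearMap.smulRight_apply, LinearMap.id_apply, map_add, map_smul, map_sub, hK]
    rw [h.ambient.associated_endo_right, h.ambient.associated_endo_right]
    simp only [gt, gl, LinearMap.comp_apply, ContinuousLinearMap.coe_coe,
      ContinuousLinearMap.flip_apply]
    module
  have h1 : ∑ i, bs.repr (coordCurvature C x₀ (bs i) u v) i = LinearMap.trace ℝ E T := by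
    rw [trace_eq_sum_repr bs]
    simp only [hT]
  have h2 : gt (K u) = - g (F x₀) (fderiv ℝ F x₀ (screenProj J g F ξ N x₀ u))
      (fderiv ℝ F x₀ (screenProj J g F ξ N x₀ v)) := by
    have e1 : gt (K u) = coordAssociated J g (F x₀) (fderiv ℝ F x₀ (K u)) (fderiv ℝ F x₀ v) := rfl
    -- The screen and the radical are also $g$-orthogonal, since $J\xi$ is a multiple of $N$.
    have e2 : g (F x₀) (fderiv ℝ F x₀ (screenProj J g F ξ N x₀ u)) (fderiv ℝ F x₀ (ξ x₀)) = 0 := by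
      rw [← neg_eq_zero, ← h.ambient.associated_endo_right, h.image.self_of_nhds, map_smul,
        h.ambient.associated_symm, h.screenProj_transversal, smul_zero]
    rw [e1, hK, coordAssociated_apply, h.ambient.sq.self_of_nhds, map_neg, neg_apply]
    conv_rhs => rw [screenProj.eq_def J g F ξ N x₀ v]
    rw [map_sub, map_smul, map_sub, map_smul, e2]
    simp
  rw [h1]
  simp only [T, map_add, map_smul, map_sub, LinearMap.trace_smulRight, htr, LinearMap.trace_id]
  rw [h2]
  simp only [gl, LinearMap.comp_apply, ContinuousLinearMap.coe_coe,
    ContinuousLinearMap.flip_apply, smul_eq_mul]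
  ring

end IsUmbilicGerm

/-! ### Immersions -/

section Immersion

variable {E : Type*} [NormedAddCommGroup E] [NormedSpace ℝ E]
  {M : Type*} [TopologicalSpace M] [ChartedSpace E M] [IsManifold 𝓘(ℝ, E) ∞ M]
  {E' : Type*} [NormedAddCommGroup E'] [NormedSpace ℝ E']
  {M' : Type*} [TopologicalSpace M'] [ChartedSpace E' M'] [IsManifold 𝓘(ℝ, E') ∞ M']

/-- In adapted charts `f` is the injective linear map $x\mapsto(x,0)$ followed by an isomorphism,
and the derivative of the domain chart is injective. -/
lemma mfderiv_injective_of_isImmersionAt {f : M → M'} {p : M}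
    (hf : Manifold.IsImmersionAt 𝓘(ℝ, E) 𝓘(ℝ, E') ∞ f p) :
    Function.Injective (mfderiv 𝓘(ℝ, E) 𝓘(ℝ, E') f p) := by
  have hp := hf.mem_domChart_source
  have hφ : MDifferentiableAt 𝓘(ℝ, E) 𝓘(ℝ, E) hf.domChart p :=
    (contMDiffAt_of_mem_maximalAtlas hf.domChart_mem_maximalAtlas hp).mdifferentiableAt (by simp)
  have hφ' : MDifferentiableAt 𝓘(ℝ, E) 𝓘(ℝ, E) hf.domChart.symm (hf.domChart p) :=
    (contMDiffAt_symm_of_mem_maximalAtlas hf.domChart_mem_maximalAtlas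
      (hf.domChart.map_source hp)).mdifferentiableAt (by simp)
  have hψ : MDifferentiableAt 𝓘(ℝ, E') 𝓘(ℝ, E') hf.codChart (f p) :=
    (contMDiffAt_of_mem_maximalAtlas hf.codChart_mem_maximalAtlas
      hf.mem_codChart_source).mdifferentiableAt (by simp)
  have hfd : MDifferentiableAt 𝓘(ℝ, E) 𝓘(ℝ, E') f p := hf.contMDiffAt.mdifferentiableAt (by simp)
  -- the derivative of the chart is injective
  have hinj : ∀ v, mfderiv 𝓘(ℝ, E) 𝓘(ℝ, E) hf.domChart p v = 0 → v = 0 := by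
    intro v hv
    have h1 : hf.domChart.symm ∘ hf.domChart =ᶠ[𝓝 p] id := by
      filter_upwards [hf.domChart.open_source.mem_nhds hp] with z hz
      exact hf.domChart.left_inv hz
    have h2 := (mfderiv_comp p hφ' hφ).symm.trans (h1.mfderiv_eq.trans mfderiv_id)
    have h3 := congrArg (fun L : E →L[ℝ] E ↦ L v) h2
    exact h3.symm.trans ((congrArg
      (mfderiv 𝓘(ℝ, E) 𝓘(ℝ, E) hf.domChart.symm (hf.domChart p)) hv).trans (map_zero _))
  have h1 : hf.codChart ∘ f =ᶠ[𝓝 p]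
      (fun x ↦ hf.equiv (x, 0)) ∘ hf.domChart := by
    filter_upwards [hf.domChart.open_source.mem_nhds hp] with z hz
    have := hf.writtenInCharts
      (show hf.domChart z ∈ (hf.domChart.extend 𝓘(ℝ, E)).target by simpa using hf.domChart.map_source hz)
    simpa [hf.domChart.left_inv hz] using this
  let Λ : E →L[ℝ] E' := (hf.equiv : (E × hf.complement) →L[ℝ] E').comp
    (ContinuousLinearMap.inl ℝ E hf.complement)
  have hΛ : MDifferentiableAt 𝓘(ℝ, E) 𝓘(ℝ, E') Λ (hf.domChart p) :=
    Λ.differentiableAt.mdifferentiableAt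
  have h2 := (mfderiv_comp p hψ hfd).symm.trans (h1.mfderiv_eq.trans (mfderiv_comp p hΛ hφ))
  have h3 : mfderiv 𝓘(ℝ, E) 𝓘(ℝ, E') Λ (hf.domChart p) = Λ := by
    rw [mfderiv_eq_fderiv]
    exact Λ.fderiv
  refine (injective_iff_map_eq_zero _).2 fun v hv ↦ hinj v ?_
  have h4 := congrArg (fun L : E →L[ℝ] E' ↦ L v) h2
  have h5 : Λ (mfderiv 𝓘(ℝ, E) 𝓘(ℝ, E) hf.domChart p v) = 0 := by
    refine (congrArg (fun L : E →L[ℝ] E' ↦ L (mfderiv 𝓘(ℝ, E) 𝓘(ℝ, E) hf.domChart p v))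
      h3).symm.trans (h4.symm.trans ?_)
    exact (congrArg (mfderiv 𝓘(ℝ, E') 𝓘(ℝ, E') hf.codChart (f p)) hv).trans (map_zero _)
  have h6 : ((mfderiv 𝓘(ℝ, E) 𝓘(ℝ, E) hf.domChart p v, 0) : E × hf.complement) = 0 :=
    hf.equiv.map_eq_zero_iff.1 h5
  exact congrArg Prod.fst h6

end Immersion

/-! ### The immersion and its push-forwards in charts -/

section LocalExpressions

variable {E : Type*} [NormedAddCommGroup E] [NormedSpace ℝ E]
  {M : Type*} [TopologicalSpace M] [ChartedSpace E M] [IsManifold 𝓘(ℝ, E) ∞ M]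
  {E' : Type*} [NormedAddCommGroup E'] [NormedSpace ℝ E']
  {M' : Type*} [TopologicalSpace M'] [ChartedSpace E' M'] [IsManifold 𝓘(ℝ, E') ∞ M']

variable (E E') in
/-- The expression of `f` in the charts at `p` and `f p`. -/
def localMap (f : M → M') (p : M) : E → E' :=
  chartAt E' (f p) ∘ f ∘ (chartAt E p).symm

variable (E E') in
/-- The domain of `localMap`. -/
def localDomain (f : M → M') (p : M) : Set E :=
  (chartAt E p).target ∩ (chartAt E p).symm ⁻¹' (f ⁻¹' (chartAt E' (f p)).source)

variable {f : M → M'} {p : M} {x : E}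

lemma localDomain_mem_nhds (hf : Continuous f) (hx : x ∈ localDomain E E' f p) :
    localDomain E E' f p ∈ 𝓝 x :=
  ((chartAt E p).isOpen_inter_preimage_symm
    ((chartAt E' (f p)).open_source.preimage hf)).mem_nhds hx

lemma chart_mem_localDomain : chartAt E p p ∈ localDomain E E' f p := by
  refine ⟨mem_chart_target E p, ?_⟩
  simp only [Set.mem_preimage]
  rw [(chartAt E p).left_inv (mem_chart_source E p)]
  exact mem_chart_source E' (f p)

lemma localMap_mem_target (hx : x ∈ localDomain E E' f p) :
    localMap E E' f p x ∈ (chartAt E' (f p)).target :=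
  (chartAt E' (f p)).map_source hx.2

lemma localMap_chart : localMap E E' f p (chartAt E p p) = chartAt E' (f p) (f p) := by
  simp only [localMap, Function.comp_apply]
  rw [(chartAt E p).left_inv (mem_chart_source E p)]

variable (hf : ContMDiff 𝓘(ℝ, E) 𝓘(ℝ, E') ∞ f)

include hf

lemma contDiffAt_localMap (hx : x ∈ localDomain E E' f p) :
    ContDiffAt ℝ ∞ (localMap E E' f p) x := by
  have hq := (chartAt E p).map_target hx.1
  have h1 : ContMDiffAt 𝓘(ℝ, E) 𝓘(ℝ, E') ∞ (chartAt E' (f p) ∘ f) ((chartAt E p).symm x) :=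
    ContMDiffAt.comp _ ((contMDiffOn_chart (I := 𝓘(ℝ, E')) (n := ∞)).contMDiffAt
      ((chartAt E' (f p)).open_source.mem_nhds hx.2)) (hf _)
  have h2 := (contMDiffAt_iff_chart le_rfl hq).1 h1
  rwa [(chartAt E p).right_inv hx.1] at h2

lemma fderiv_localMap (hx : x ∈ localDomain E E' f p) (w : E) :
    fderiv ℝ (localMap E E' f p) x w = coord (f p) (f ((chartAt E p).symm x))
      (mfderiv 𝓘(ℝ, E) 𝓘(ℝ, E') f ((chartAt E p).symm x) (frame E p w ((chartAt E p).symm x))) :=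
  (coord_mfderiv_frame hx.1 hx.2 ((hf _).mdifferentiableAt (by simp)) w).symm

lemma fderiv_localMap_coord (hx : x ∈ localDomain E E' f p)
    (v : TangentSpace 𝓘(ℝ, E) ((chartAt E p).symm x)) :
    fderiv ℝ (localMap E E' f p) x (coord p ((chartAt E p).symm x) v)
      = coord (f p) (f ((chartAt E p).symm x))
        (mfderiv 𝓘(ℝ, E) 𝓘(ℝ, E') f ((chartAt E p).symm x) v) := by
  rw [fderiv_localMap hf hx, frame_coord ((chartAt E p).map_target hx.1)]

lemma fderiv_localMap_center (v : TangentSpace 𝓘(ℝ, E) p) :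
    fderiv ℝ (localMap E E' f p) (chartAt E p p) v = mfderiv 𝓘(ℝ, E) 𝓘(ℝ, E') f p v := by
  have h := coord_mfderiv_frame (f := f) (p := p) (p' := f p) (x := chartAt E p p)
    (mem_chart_target E p) (chart_mem_localDomain (f := f)).2 ((hf _).mdifferentiableAt (by simp)) v
  rw [(chartAt E p).left_inv (mem_chart_source E p)] at h
  refine h.symm.trans ((coord_self (f p) _).trans ?_)
  congr 1
  exact (congrArg (fun a ↦ frame E p a p) (coord_self p v).symm).trans
    (frame_coord (mem_chart_source E p) v)

lemma alongCoord_pushforward_frame (hx : x ∈ localDomain E E' f p) (w : E) :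
    alongCoord p (f p) f (fun q ↦ mfderiv 𝓘(ℝ, E) 𝓘(ℝ, E') f q (frame E p w q)) =ᶠ[𝓝 x]
      fun z ↦ fderiv ℝ (localMap E E' f p) z w := by
  filter_upwards [localDomain_mem_nhds hf.continuous hx] with z hz
  rw [fderiv_localMap hf hz]
  rfl

variable [FiniteDimensional ℝ E']

lemma coord_covAlong_pushforward_frame (D : AffineConnection 𝓘(ℝ, E') M')
    (hx : x ∈ localDomain E E' f p) (u w : E) :
    coord (f p) (f ((chartAt E p).symm x)) (covAlong f D
        (fun q ↦ mfderiv 𝓘(ℝ, E) 𝓘(ℝ, E') f q (frame E p w q)) ((chartAt E p).symm x)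
        (frame E p u ((chartAt E p).symm x)))
      = coordCovAlong (localMap E E' f p) (christoffel D (f p))
          (fun z ↦ fderiv ℝ (localMap E E' f p) z w) x u := by
  have hq := (chartAt E p).map_target hx.1
  have hev := alongCoord_pushforward_frame hf hx w
  have hsm : ContDiffAt ℝ ∞ (fun z ↦ fderiv ℝ (localMap E E' f p) z w) x :=
    ((contDiffAt_localMap hf hx).fderiv_right (m := ∞) (by simp)).clm_apply contDiffAt_const
  have h1 := coord_covAlong (p := p) (p' := f p) D (hf _) hq hx.2
    ((contMDiffAt_along_iff (hf _) hq hx.2).2 (by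
      rw [(chartAt E p).right_inv hx.1]
      exact hsm.congr_of_eventuallyEq hev)) (frame E p u ((chartAt E p).symm x))
  rw [(chartAt E p).right_inv hx.1, coord_frame hq] at h1
  exact h1.trans (coordCovAlong_congr hev u)

end LocalExpressions

/-! ### Regularity of the induced connection -/

section Differentiability

variable {E : Type*} [NormedAddCommGroup E] [NormedSpace ℝ E] [FiniteDimensional ℝ E]
  {E' : Type*} [NormedAddCommGroup E'] [NormedSpace ℝ E'] [FiniteDimensional ℝ E']

/-- A fixed left inverse of the derivative at `x₀`, composed with the derivative at `x`, is the
identity at `x₀` and stays invertible nearby. Inverting it solves for `C` in terms of differentiable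
data. -/
lemma differentiableAt_of_pushforward {F : E → E'} {x₀ : E} (hF : ContDiffAt ℝ 2 F x₀)
    (hinj : Function.Injective (fderiv ℝ F x₀)) {C : E → E →L[ℝ] E →L[ℝ] E} {R : E → E → E → E'}
    (hR : ∀ u w, DifferentiableAt ℝ (fun x ↦ R x u w) x₀)
    (h : ∀ᶠ x in 𝓝 x₀, ∀ u w, fderiv ℝ F x (C x u w) = R x u w) : DifferentiableAt ℝ C x₀ := by
  have : CompleteSpace E := FiniteDimensional.complete ℝ E
  obtain ⟨Λ₀, hΛ₀⟩ := (fderiv ℝ F x₀).toLinearMap.exists_leftInverse_of_injective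
    (LinearMap.ker_eq_bot.2 hinj)
  let Λ : E' →L[ℝ] E := LinearMap.toContinuousLinearMap Λ₀
  let T : E → E →L[ℝ] E := fun x ↦ Λ.comp (fderiv ℝ F x)
  have hT : DifferentiableAt ℝ T x₀ :=
    (differentiableAt_const Λ).clm_comp (hasFDerivAt_fderiv hF).differentiableAt
  have hT₀ : ((ContinuousLinearEquiv.refl ℝ E : E ≃L[ℝ] E) : E →L[ℝ] E) = T x₀ := by
    ext v
    exact (congrArg (fun L : E →ₗ[ℝ] E ↦ L v) hΛ₀).symm
  have hinv := differentiableAt_clm_inverse hT _ hT₀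
  have hev : ∀ᶠ x in 𝓝 x₀, T x ∈ Set.range ((↑) : (E ≃L[ℝ] E) → E →L[ℝ] E) := by
    refine hT.continuousAt ?_
    rw [← hT₀]
    exact ContinuousLinearEquiv.nhds _
  refine differentiableAt_of_clm_apply fun u ↦ differentiableAt_of_clm_apply fun w ↦ ?_
  have hd : DifferentiableAt ℝ (fun x ↦ (T x).inverse (Λ (R x u w))) x₀ :=
    hinv.clm_apply ((Λ.differentiableAt).comp x₀ (hR u w))
  refine hd.congr_of_eventuallyEq ?_
  filter_upwards [h, hev] with x hx ⟨e, he⟩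
  have h1 : Λ (R x u w) = T x (C x u w) := by rw [← hx]; rfl
  rw [h1, ← he, ContinuousLinearMap.inverse_equiv]
  simp

end Differentiability

/-! ### From the hypersurface to its germ in coordinates -/

section Umbilic

variable {E : Type*} [NormedAddCommGroup E] [NormedSpace ℝ E] [FiniteDimensional ℝ E]
  {M : Type*} [TopologicalSpace M] [ChartedSpace E M] [IsManifold 𝓘(ℝ, E) ∞ M]
  {E' : Type*} [NormedAddCommGroup E'] [NormedSpace ℝ E'] [FiniteDimensional ℝ E']
  [CompleteSpace E']
  {M' : Type*} [TopologicalSpace M'] [ChartedSpace E' M'] [IsManifold 𝓘(ℝ, E') ∞ M']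
  {f : M → M'} {p : M} {x : E}
  {J : EndField 𝓘(ℝ, E') M'} {g : BilinField 𝓘(ℝ, E') M'} {D D' : AffineConnection 𝓘(ℝ, E') M'}

lemma coordAssociated_localMap (hx : x ∈ localDomain E E' f p)
    (a b : TangentSpace 𝓘(ℝ, E') (f ((chartAt E p).symm x))) :
    coordAssociated (coordEndo J (f p)) (coordForm g (f p)) (localMap E E' f p x)
      (coord (f p) (f ((chartAt E p).symm x)) a) (coord (f p) (f ((chartAt E p).symm x)) b)
      = associated J g (f ((chartAt E p).symm x)) a b := by
  rw [← coordForm_associated J g (localMap_mem_target hx)]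
  exact coordForm_chart (associated J g) hx.2 a b

/-- The coordinate expression of a totally umbilical radical transversal lightlike hypersurface. -/
theorem isUmbilicGerm (hf : Manifold.IsImmersion 𝓘(ℝ, E) 𝓘(ℝ, E') ∞ f)
    (hJg : IsAlmostComplexNorden J g) (hD : IsLeviCivita g D)
    (hD' : IsLeviCivita (associated J g) D') (hK : IsParallel D J)
    {S : ScreenDistribution 𝓘(ℝ, E) f (associated J g)} {C : AffineConnection 𝓘(ℝ, E) M}
    {U : Set M} (hUo : IsOpen U) {ξ : ∀ q : M, TangentSpace 𝓘(ℝ, E) q}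
    {N : ∀ q : M, TangentSpace 𝓘(ℝ, E') (f q)} {B : BilinField 𝓘(ℝ, E) M} {ρ b : M → ℝ}
    (hloc : IsLocalPair S U ξ N) (hgauss : GaussFormula f D' C U N B)
    (himage : ∀ q ∈ U, J (f q) (mfderiv 𝓘(ℝ, E) 𝓘(ℝ, E') f q (ξ q)) = b q • N q)
    (humb : IsUmbilicalOn f (associated J g) U B ρ) (hp : p ∈ U) :
    IsUmbilicGerm (coordEndo J (f p)) (coordForm g (f p)) (christoffel D (f p))
      (localMap E E' f p) (christoffel C p) (fieldCoord E p ξ) (alongCoord p (f p) f N)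
      (ρ ∘ (chartAt E p).symm) (b ∘ (chartAt E p).symm) (chartAt E p p) := by
  have hfs : ContMDiff 𝓘(ℝ, E) 𝓘(ℝ, E') ∞ f := hf.contMDiff
  set x₀ := chartAt E p p with hx₀
  have hps := mem_chart_source E p
  have hx₀d : x₀ ∈ localDomain E E' f p := chart_mem_localDomain
  have hx₀p : (chartAt E p).symm x₀ = p := (chartAt E p).left_inv hps
  have hdom : ∀ᶠ y in 𝓝 x₀, y ∈ localDomain E E' f p := localDomain_mem_nhds hfs.continuous hx₀d
  have hUev : ∀ᶠ y in 𝓝 x₀, (chartAt E p).symm y ∈ U := by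
    refine ((chartAt E p).continuousAt_symm hx₀d.1) (hUo.mem_nhds ?_)
    rwa [hx₀p]
  have hamb := isKaehlerNordenGerm (p := f p) hJg hD hK (localMap_mem_target hx₀d)
  have hF3 : ContDiffAt ℝ 3 (localMap E E' f p) x₀ :=
    (contDiffAt_localMap hfs hx₀d).of_le (WithTop.coe_le_coe.2 le_top)
  have hinj : Function.Injective (fderiv ℝ (localMap E E' f p) x₀) := by
    intro u v huv
    exact mfderiv_injective_of_isImmersionAt (hf.isImmersionAt p)
      ((fderiv_localMap_center hfs u).symm.trans (huv.trans (fderiv_localMap_center hfs v)))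
  have hξd : DifferentiableAt ℝ (fieldCoord E p ξ) x₀ :=
    ((contMDiffAt_field_iff le_rfl hps).1
      (hloc.smooth_left.contMDiffAt (hUo.mem_nhds hp))).differentiableAt (by simp)
  have hNd : DifferentiableAt ℝ (alongCoord p (f p) f N) x₀ :=
    ((contMDiffAt_along_iff (hfs p) hps (mem_chart_source E' (f p))).1
      (hloc.smooth_right.contMDiffAt (hUo.mem_nhds hp))).differentiableAt (by simp)
  have hρd : DifferentiableAt ℝ (ρ ∘ (chartAt E p).symm) x₀ :=
    ((contMDiffAt_iff_chart le_rfl hps).1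
      (humb.smooth.contMDiffAt (hUo.mem_nhds hp))).differentiableAt (by simp)
  have hG : ∀ᶠ x in 𝓝 x₀, ∀ u w,
      coordCovAlong (localMap E E' f p) (christoffel D (f p))
        (fun z ↦ fderiv ℝ (localMap E E' f p) z w) x u
      = fderiv ℝ (localMap E E' f p) x (christoffel C p x u w)
        + ((ρ ∘ (chartAt E p).symm) x * coordAssociated (coordEndo J (f p)) (coordForm g (f p))
            (localMap E E' f p x) (fderiv ℝ (localMap E E' f p) x u)
            (fderiv ℝ (localMap E E' f p) x w)) • alongCoord p (f p) f N x := by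
    filter_upwards [hdom, hUev] with x hx hxU u w
    have hq := (chartAt E p).map_target hx.1
    have h1 := hgauss _ hxU _ (contMDiffAt_frame hq w) (frame E p u ((chartAt E p).symm x))
    rw [humb.eq _ hxU] at h1
    have h2 := congrArg (coord (f p) (f ((chartAt E p).symm x))) h1
    have h3 := coord_covAlong_pushforward_frame hfs D' hx u w
    -- The Gauss formula is stated for the connection of $\tilde g$, the germ for that of $g$; their
    -- Christoffel symbols agree.
    have h4 : coordCovAlong (localMap E E' f p) (christoffel D' (f p))
          (fun z ↦ fderiv ℝ (localMap E E' f p) z w) x u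
        = coordCovAlong (localMap E E' f p) (christoffel D (f p))
          (fun z ↦ fderiv ℝ (localMap E E' f p) z w) x u := by
      simp only [coordCovAlong]
      rw [christoffel_associated hJg hD hD' hK (localMap_mem_target hx)]
    rw [← h4, ← h3]
    refine h2.trans ((map_add _ _ _).trans (congrArg₂ _ ?_ ?_))
    · rw [christoffel_apply C hx.1, fderiv_localMap_coord hfs hx]
    · refine (map_smul _ _ _).trans ?_
      rw [fderiv_localMap hfs hx, fderiv_localMap hfs hx, coordAssociated_localMap hx]
      rfl
  have hCd : DifferentiableAt ℝ (christoffel C p) x₀ := by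
    have hF2 : ContDiffAt ℝ 2 (localMap E E' f p) x₀ := hF3.of_le (by norm_num)
    have hg0 : DifferentiableAt ℝ (fun z ↦ coordAssociated (coordEndo J (f p))
        (coordForm g (f p)) (localMap E E' f p z)) x₀ :=
      DifferentiableAt.comp (g := coordAssociated (coordEndo J (f p)) (coordForm g (f p))) x₀
        hamb.differentiableAt_associated (hF2.differentiableAt (by norm_num))
    have hFw : ∀ w, DifferentiableAt ℝ (fun z ↦ fderiv ℝ (localMap E E' f p) z w) x₀ := fun w ↦
      (hasFDerivAt_fderiv hF2).differentiableAt.clm_apply (differentiableAt_const w)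
    -- `R` is the Gauss formula solved for its tangential term.
    refine differentiableAt_of_pushforward hF2 hinj (R := fun x u w ↦
      coordCovAlong (localMap E E' f p) (christoffel D (f p))
        (fun z ↦ fderiv ℝ (localMap E E' f p) z w) x u
      - ((ρ ∘ (chartAt E p).symm) x * coordAssociated (coordEndo J (f p)) (coordForm g (f p))
            (localMap E E' f p x) (fderiv ℝ (localMap E E' f p) x u)
            (fderiv ℝ (localMap E E' f p) x w)) • alongCoord p (f p) f N x)
      (fun u w ↦ ?_) ?_
    · refine DifferentiableAt.sub ?_ ((hρd.mul ((hg0.clm_apply (hFw u)).clm_apply (hFw w))).smul hNd)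
      exact (differentiableAt_coordCovAlong hF2
        ((hF3.fderiv_right (m := 2) (by norm_num)).clm_apply contDiffAt_const)
        hamb.differentiableAt_christoffel u).differentiableAt
    · filter_upwards [hG] with x hx u w
      rw [hx, add_sub_cancel_right]
  refine ⟨hamb, hF3, hinj, hCd, hξd, hNd, hρd, ?_, ?_, ?_, hG⟩
  · filter_upwards [hdom, hUev] with x hx hxU w
    rw [fieldCoord, fderiv_localMap_coord hfs hx, fderiv_localMap hfs hx,
      coordAssociated_localMap hx]
    exact hloc.mem_radical _ hxU _
  · filter_upwards [hdom, hUev] with x hx hxU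
    rw [fieldCoord, fderiv_localMap_coord hfs hx, alongCoord, coordAssociated_localMap hx]
    exact (hloc.isTransversalPair _ hxU).1
  · filter_upwards [hdom, hUev] with x hx hxU
    rw [fieldCoord, fderiv_localMap_coord hfs hx, alongCoord]
    have h1 := coordEndo_chart J hx.2
      (mfderiv 𝓘(ℝ, E) 𝓘(ℝ, E') f ((chartAt E p).symm x) (ξ ((chartAt E p).symm x)))
    refine h1.trans ?_
    rw [himage _ hxU]
    exact map_smul _ _ _

end Umbilic

/-! ### Ambient curvature at the centre of a chart -/

section SpaceForm

variable {E : Type*} [NormedAddCommGroup E] [NormedSpace ℝ E] [FiniteDimensional ℝ E]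
  [CompleteSpace E]
  {M : Type*} [TopologicalSpace M] [ChartedSpace E M] [IsManifold 𝓘(ℝ, E) ∞ M]
  {J : EndField 𝓘(ℝ, E) M} {g : BilinField 𝓘(ℝ, E) M} {D : AffineConnection 𝓘(ℝ, E) M}

omit [CompleteSpace E] in
lemma coordForm_center (h : BilinField 𝓘(ℝ, E) M) (p : M) (a b : TangentSpace 𝓘(ℝ, E) p) :
    coordForm h p (chartAt E p p) a b = h p a b := by
  have := coordForm_chart h (mem_chart_source E p) a b
  rwa [coord_self, coord_self] at this

omit [CompleteSpace E] in
lemma coordEndo_center (J : EndField 𝓘(ℝ, E) M) (p : M) (a : TangentSpace 𝓘(ℝ, E) p) :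
    coordEndo J p (chartAt E p p) a = J p a := by
  have := coordEndo_chart J (mem_chart_source E p) a
  rwa [coord_self, coord_self] at this

omit [CompleteSpace E] [FiniteDimensional ℝ E] in
-- On orthonormal pairs the Gram determinant is 1, so the quotients reduce to curvature components,
-- the only values that the algebra needs.
lemma HasConstantTotallyRealCurvatures.apply_orthonormal {ν ν' : M → ℝ}
    (hν : HasConstantTotallyRealCurvatures J g D ν ν') (hJg : IsAlmostComplexNorden J g) (p : M)
    {x y : TangentSpace 𝓘(ℝ, E) p} (hxx : g p x x = 1) (hyy : g p y y = 1) (hxy : g p x y = 0)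
    (hJxx : g p (J p x) x = 0) (hJyy : g p (J p y) y = 0) (hJxy : g p (J p x) y = 0) :
    g p (curvatureAt D p x y y) x = ν p ∧ g p (curvatureAt D p x y y) (J p x) = ν' p := by
  have hJyx : g p (J p y) x = 0 := by
    have h1 := hJg.anti p x (J p y)
    rw [hJg.sq, map_neg, hJxy, neg_zero, eq_comm, neg_eq_zero] at h1
    rw [hJg.metric.symm, h1]
  have hgram : gram g p x y = 1 := by
    simp [gram, hxx, hyy, hxy]
  have htr : IsTotallyReal J g p x y := by
    intro u hu v hv
    obtain ⟨a, b, rfl⟩ := Submodule.mem_span_pair.1 hu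
    obtain ⟨c, d, rfl⟩ := Submodule.mem_span_pair.1 hv
    simp only [map_add, map_smul, add_apply, smul_apply, hJxx, hJyy, hJxy, hJyx]
    simp
  have h := hν p x y (by rw [hgram]; exact one_ne_zero) htr
  rwa [sectionalCurvature, associatedSectionalCurvature, hgram, div_one, div_one] at h

/-- The curvature of a Kähler–Norden manifold with constant totally real sectional curvatures. -/
theorem coordCurvature_eq_spaceFormCurvature (hdim : 3 ≤ Module.finrank ℝ E)
    (hJg : IsAlmostComplexNorden J g) (hD : IsLeviCivita g D) (hK : IsParallel D J)
    {ν ν' : M → ℝ} (hν : HasConstantTotallyRealCurvatures J g D ν ν') (p : M) (x y z : E) :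
    coordCurvature (christoffel D p) (chartAt E p p) x y z
      = spaceFormCurvature (coordEndo J p (chartAt E p p)).toLinearMap
        ((ContinuousLinearMap.coeLM ℝ).comp (coordForm g p (chartAt E p p)).toLinearMap)
        (ν p) (ν' p) x y z := by
  have hG := isKaehlerNordenGerm (p := p) hJg hD hK (mem_chart_target E p)
  refine eq_spaceFormCurvature hdim hG.isKaehlerNordenCurvature hG.sq.self_of_nhds
    hG.anti.self_of_nhds hG.symm.self_of_nhds hG.nondegenerate (ν p) (ν' p) ?_ x y z
  intro x y hxx hyy hxy hJxx hJyy hJxy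
  replace hxx : g p x x = 1 := (coordForm_center g p x x).symm.trans hxx
  replace hyy : g p y y = 1 := (coordForm_center g p y y).symm.trans hyy
  replace hxy : g p x y = 0 := (coordForm_center g p x y).symm.trans hxy
  have hJf : ∀ a b : TangentSpace 𝓘(ℝ, E) p, coordForm g p (chartAt E p p)
      (coordEndo J p (chartAt E p p) a) b = g p (J p a) b := fun a b ↦ by
    rw [coordEndo_center]; exact coordForm_center g p _ _
  replace hJxx : g p (J p x) x = 0 := (hJf x x).symm.trans hJxx
  replace hJyy : g p (J p y) y = 0 := (hJf y y).symm.trans hJyy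
  replace hJxy : g p (J p x) y = 0 := (hJf x y).symm.trans hJxy
  have h := hν.apply_orthonormal hJg p hxx hyy hxy hJxx hJyy hJxy
  have hc := curvatureAt_eq_coordCurvature D hG.differentiableAt_christoffel x y y
  refine ⟨(coordForm_center g p _ _).trans ?_, Eq.trans ?_ ((coordForm_center g p _ _).trans
    ((congrArg (fun w : TangentSpace 𝓘(ℝ, E) p ↦ g p w (J p x)) hc).symm.trans h.2))⟩
  · exact (congrArg (fun w : TangentSpace 𝓘(ℝ, E) p ↦ g p w x) hc).symm.trans h.1
  · exact congrArg (coordForm g p (chartAt E p p) _) (coordEndo_center J p x)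

end SpaceForm

/-! ### Radical transversal lightlike hypersurfaces -/

section Hypersurface

variable {E : Type*} [NormedAddCommGroup E] [NormedSpace ℝ E] [FiniteDimensional ℝ E]
  {M : Type*} [TopologicalSpace M] [ChartedSpace E M] [IsManifold 𝓘(ℝ, E) ∞ M]
  {E' : Type*} [NormedAddCommGroup E'] [NormedSpace ℝ E'] [FiniteDimensional ℝ E']
  {M' : Type*} [TopologicalSpace M'] [ChartedSpace E' M'] [IsManifold 𝓘(ℝ, E') ∞ M']
  {f : M → M'} {J : EndField 𝓘(ℝ, E') M'} {g : BilinField 𝓘(ℝ, E') M'}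

lemma IsAlmostComplexNorden.associated_symm (hJg : IsAlmostComplexNorden J g) (y : M')
    (a b : TangentSpace 𝓘(ℝ, E') y) : associated J g y a b = associated J g y b a := by
  change g y (J y a) b = g y (J y b) a
  have h1 := hJg.anti y a (J y b)
  rw [hJg.sq, map_neg, neg_inj] at h1
  rw [h1, hJg.metric.symm]

lemma IsAlmostComplexNorden.associated_nondegenerate (hJg : IsAlmostComplexNorden J g) (y : M')
    (a : TangentSpace 𝓘(ℝ, E') y) (ha : ∀ b, associated J g y a b = 0) : a = 0 := by
  have h1 : J y a = 0 := hJg.metric.nondegenerate y _ ha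
  have h2 := hJg.sq y a
  rw [h1, map_zero] at h2
  exact neg_eq_zero.1 h2.symm

lemma ScreenDistribution.proj_mem {h : BilinField 𝓘(ℝ, E') M'} (S : ScreenDistribution 𝓘(ℝ, E) f h)
    (p : M) (u : TangentSpace 𝓘(ℝ, E) p) : S.proj p u ∈ S.space p :=
  Submodule.projection_apply_mem _ _

lemma ScreenDistribution.sub_proj_mem {h : BilinField 𝓘(ℝ, E') M'}
    (S : ScreenDistribution 𝓘(ℝ, E) f h) (p : M) (u : TangentSpace 𝓘(ℝ, E) p) :
    u - S.proj p u ∈ radical 𝓘(ℝ, E) f h p := by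
  have h1 : S.proj p (u - S.proj p u) = 0 := by
    rw [map_sub, sub_eq_zero]
    exact (Submodule.projection_apply_of_mem_left _ (S.proj_mem p u)).symm
  exact (Submodule.projection_apply_eq_zero_iff _).1 h1

variable {p : M} (hJg : IsAlmostComplexNorden J g)
  (hinj : Function.Injective (mfderiv 𝓘(ℝ, E) 𝓘(ℝ, E') f p))
  (hdim : Module.finrank ℝ E' = Module.finrank ℝ E + 1)
  {S : ScreenDistribution 𝓘(ℝ, E) f (associated J g)} {ξ : TangentSpace 𝓘(ℝ, E) p}
  {N : TangentSpace 𝓘(ℝ, E') (f p)} (hξ : ξ ∈ radical 𝓘(ℝ, E) f (associated J g) p)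
  (hN : IsTransversalPair S p ξ N)

include hJg hinj hdim hξ hN

/-- $u-Pu$ is radical, hence a multiple of $\xi$; $N$ annihilates the screen, so the coefficient is
$\tilde g(N,u)$. -/
lemma screen_proj_eq (u : TangentSpace 𝓘(ℝ, E) p) :
    S.proj p u = u - associated J g (f p) N (mfderiv 𝓘(ℝ, E) 𝓘(ℝ, E') f p u) • ξ := by
  have h1 := eq_smul_of_mem_radical (L := (mfderiv 𝓘(ℝ, E) 𝓘(ℝ, E') f p).toLinearMap)
    (B := (ContinuousLinearMap.coeLM ℝ).comp (associated J g (f p)).toLinearMap) (ξ := ξ) (N := N)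
    hinj hdim (hJg.associated_symm _) (hJg.associated_nondegenerate _) hξ hN.1
    (v := u - S.proj p u) (S.sub_proj_mem p u)
  have h2 : associated J g (f p) N (mfderiv 𝓘(ℝ, E) 𝓘(ℝ, E') f p (u - S.proj p u))
      = associated J g (f p) N (mfderiv 𝓘(ℝ, E) 𝓘(ℝ, E') f p u) := by
    rw [map_sub, map_sub, hN.2.2 _ (S.proj_mem p u), sub_zero]
  rw [← h2]
  exact eq_sub_of_add_eq (by rw [add_comm]; exact eq_add_of_sub_eq h1 ▸ by abel)

lemma transversal_le_span : transversal S p ≤ Submodule.span ℝ {N} := by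
  refine Submodule.span_le.2 ?_
  rintro N' ⟨ξ', hξ', hN'⟩
  obtain ⟨c, hc⟩ := eq_smul_of_transversal
    (L := (mfderiv 𝓘(ℝ, E) 𝓘(ℝ, E') f p).toLinearMap)
    (B := (ContinuousLinearMap.coeLM ℝ).comp (associated J g (f p)).toLinearMap) (ξ := ξ) (N := N)
    hinj hdim (hJg.associated_symm _) (hJg.associated_nondegenerate _) hξ hN.1 hN.2.1
    (S := (S.space p : Set (TangentSpace 𝓘(ℝ, E) p)))
    (fun u ↦ ⟨S.proj p u, S.proj_mem p u, u - S.proj p u, S.sub_proj_mem p u, by abel⟩) hN.2.2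
    hξ' hN'.1 hN'.2.1 hN'.2.2
  exact Submodule.mem_span_singleton.2 ⟨c, hc.symm⟩

/-- $J\xi$ lies in the transversal line, which $N$ spans, and pairing with $\xi$ gives the
coefficient. So an explicit $b$ exists for every local pair. -/
lemma endo_radical_eq (hS : IsRadicalTransversalLightlike J S) :
    J (f p) (mfderiv 𝓘(ℝ, E) 𝓘(ℝ, E') f p ξ)
      = associated J g (f p) (J (f p) (mfderiv 𝓘(ℝ, E) 𝓘(ℝ, E') f p ξ))
          (mfderiv 𝓘(ℝ, E) 𝓘(ℝ, E') f p ξ) • N := by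
  have h1 : J (f p) (mfderiv 𝓘(ℝ, E) 𝓘(ℝ, E') f p ξ) ∈ transversal S p := by
    rw [← hS.radical_transversal p]
    exact ⟨_, ⟨ξ, hξ, rfl⟩, rfl⟩
  obtain ⟨c, hc⟩ := Submodule.mem_span_singleton.1 (transversal_le_span hJg hinj hdim hξ hN h1)
  rw [← hc, map_smul, smul_apply, hN.1, smul_eq_mul, mul_one]

end Hypersurface

/-! ### The equations on the manifold -/

section Equations

variable {E : Type*} [NormedAddCommGroup E] [NormedSpace ℝ E] [FiniteDimensional ℝ E]
  {M : Type*} [TopologicalSpace M] [ChartedSpace E M] [IsManifold 𝓘(ℝ, E) ∞ M]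
  {E' : Type*} [NormedAddCommGroup E'] [NormedSpace ℝ E'] [FiniteDimensional ℝ E']
  [CompleteSpace E']
  {M' : Type*} [TopologicalSpace M'] [ChartedSpace E' M'] [IsManifold 𝓘(ℝ, E') ∞ M']
  {f : M → M'} {p : M}
  {J : EndField 𝓘(ℝ, E') M'} {g : BilinField 𝓘(ℝ, E') M'} {D D' : AffineConnection 𝓘(ℝ, E') M'}

/-- The fundamental equations of a totally umbilical radical transversal lightlike hypersurface of a
Kähler–Norden manifold with constant totally real sectional curvatures. -/
theorem hypersurface_equations (hdim : Module.finrank ℝ E' = Module.finrank ℝ E + 1)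
    (hE : 2 ≤ Module.finrank ℝ E)
    (hf : Manifold.IsImmersion 𝓘(ℝ, E) 𝓘(ℝ, E') ∞ f)
    (hJg : IsAlmostComplexNorden J g) (hD : IsLeviCivita g D)
    (hD' : IsLeviCivita (associated J g) D') (hK : IsParallel D J) {ν ν' : M' → ℝ}
    (hν : HasConstantTotallyRealCurvatures J g D ν ν')
    {S : ScreenDistribution 𝓘(ℝ, E) f (associated J g)} {C : AffineConnection 𝓘(ℝ, E) M}
    {U : Set M} (hUo : IsOpen U) {ξ : ∀ q : M, TangentSpace 𝓘(ℝ, E) q}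
    {N : ∀ q : M, TangentSpace 𝓘(ℝ, E') (f q)} {B : BilinField 𝓘(ℝ, E) M} {ρ b : M → ℝ}
    (hloc : IsLocalPair S U ξ N) (hgauss : GaussFormula f D' C U N B)
    (himage : ∀ q ∈ U, J (f q) (mfderiv 𝓘(ℝ, E) 𝓘(ℝ, E') f q (ξ q)) = b q • N q)
    (humb : IsUmbilicalOn f (associated J g) U B ρ) (hp : p ∈ U) :
    ν' (f p) = 0 ∧ b p ≠ 0 ∧
    (∀ (A : EndField 𝓘(ℝ, E) M) (τ : ∀ q : M, TangentSpace 𝓘(ℝ, E) q →L[ℝ] ℝ),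
      WeingartenFormula f D' U N A τ →
      (∀ v, τ p v = -(1 / (2 * b p)) * mvfderiv 𝓘(ℝ, E) b p v) ∧
      b p * ν (f p) - ρ p ^ 2 + mvfderiv 𝓘(ℝ, E) ρ p (ξ p) + ρ p * τ p (ξ p) = 0 ∧
      (∀ v, mvfderiv 𝓘(ℝ, E) ρ p (S.proj p v) + ρ p * τ p (S.proj p v) = 0)) ∧
    (∀ X Y Z : (∀ q : M, TangentSpace 𝓘(ℝ, E) q),
      IsSmoothFieldAt X p → IsSmoothFieldAt Y p → IsSmoothFieldAt Z p →
      let df := mfderiv 𝓘(ℝ, E) 𝓘(ℝ, E') f p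
      let gt := associated J g (f p)
      df (curvature C X Y Z p) =
        (ν (f p) - ρ p ^ 2 / b p) •
          (gt (df (X p)) (df (Z p)) • J (f p) (df (S.proj p (Y p)))
            - gt (df (Y p)) (df (Z p)) • J (f p) (df (S.proj p (X p))))
        + ν (f p) •
          (gt (df (X p)) (J (f p) (df (Z p))) • df (Y p)
            - gt (df (Y p)) (J (f p) (df (Z p))) • df (X p))) ∧
    (∀ x y : TangentSpace 𝓘(ℝ, E) p,
      ricci C p x y =
        ((Module.finrank ℝ E : ℝ) - 1) * ν (f p) * induced 𝓘(ℝ, E) f g p x y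
        - (ν (f p) - ρ p ^ 2 / b p) * induced 𝓘(ℝ, E) f g p (S.proj p x) (S.proj p y)) := by
  have hfs : ContMDiff 𝓘(ℝ, E) 𝓘(ℝ, E') ∞ f := hf.contMDiff
  have hinj := mfderiv_injective_of_isImmersionAt (hf.isImmersionAt p)
  have hps := mem_chart_source E p
  have hps' := mem_chart_source E' (f p)
  have hrad := hloc.mem_radical p hp
  have hpair := hloc.isTransversalPair p hp
  have hG := isUmbilicGerm hf hJg hD hD' hK hUo hloc hgauss himage humb hp
  set x₀ := chartAt E p p with hx₀
  have hx₀p : (chartAt E p).symm x₀ = p := (chartAt E p).left_inv hps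
  have hF0 : localMap E E' f p x₀ = chartAt E' (f p) (f p) := localMap_chart
  have hR : ∀ x y z, coordCurvature (christoffel D (f p)) (localMap E E' f p x₀) x y z
      = spaceFormCurvature (coordEndo J (f p) (localMap E E' f p x₀)).toLinearMap
        ((ContinuousLinearMap.coeLM ℝ).comp
          (coordForm g (f p) (localMap E E' f p x₀)).toLinearMap) (ν (f p)) (ν' (f p)) x y z := by
    rw [hF0]
    exact coordCurvature_eq_spaceFormCurvature (by omega) hJg hD hK hν (f p)
  -- values at the centre of the charts
  let df : E → E' := fun v ↦ mfderiv 𝓘(ℝ, E) 𝓘(ℝ, E') f p v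
  let gt : E' → E' → ℝ := fun a c ↦ associated J g (f p) a c
  let gp : E' → E' → ℝ := fun a c ↦ g (f p) a c
  let Jp : E' → E' := fun a ↦ J (f p) a
  let P : E → E := fun u ↦ S.proj p u
  let ξp : E := ξ p
  let Np : E' := N p
  have hdF : ∀ v : E, fderiv ℝ (localMap E E' f p) x₀ v = df v := fderiv_localMap_center hfs
  have hJp : ∀ a : E', coordEndo J (f p) (localMap E E' f p x₀) a = Jp a := by
    rw [hF0]
    exact coordEndo_center J (f p)
  have hgp : ∀ a c : E', coordForm g (f p) (localMap E E' f p x₀) a c = gp a c := by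
    rw [hF0]
    exact coordForm_center g (f p)
  have hgt : ∀ a c : E', coordAssociated (coordEndo J (f p)) (coordForm g (f p))
      (localMap E E' f p x₀) a c = gt a c := by
    intro a c
    rw [coordAssociated_apply, hJp, hgp]
    rfl
  have hNp : alongCoord p (f p) f N x₀ = Np := (alongCoord_chart hps).trans (coord_self (f p) _)
  have hξp : fieldCoord E p ξ x₀ = ξp := (fieldCoord_chart hps ξ).trans (coord_self p _)
  have hρp : (ρ ∘ (chartAt E p).symm) x₀ = ρ p := congrArg ρ hx₀p
  have hbp : (b ∘ (chartAt E p).symm) x₀ = b p := congrArg b hx₀p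
  have hP : ∀ u : E, IsUmbilicGerm.screenProj (coordEndo J (f p)) (coordForm g (f p))
      (localMap E E' f p) (fieldCoord E p ξ) (alongCoord p (f p) f N) x₀ u = P u := by
    intro u
    rw [IsUmbilicGerm.screenProj, hgt, hNp, hdF, hξp]
    exact (screen_proj_eq hJg hinj hdim hrad hpair u).symm
  have hder : ∀ {G : M → ℝ}, DifferentiableAt ℝ (G ∘ (chartAt E p).symm) x₀ → ∀ v : E,
      fderiv ℝ (G ∘ (chartAt E p).symm) x₀ v = mvfderiv 𝓘(ℝ, E) G p v := by
    intro G hd v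
    have h1 := mvfderiv_eq_fderiv_chart hps ((mdifferentiableAt_iff_chart hps).2 hd) v
    exact (h1.trans (congrArg (fderiv ℝ (G ∘ (chartAt E p).symm) x₀) (coord_self p v))).symm
  have hdρ := hder hG.differentiableAt_factor
  have hdb := hder hG.differentiableAt_factor_image
  have hb0 := hG.factor_ne_zero
  obtain ⟨hν0, hpde, hpde', hcurv⟩ := hG.fundamental_equations hdim hE hR
  have hric := fun u v ↦ hG.ricci_equation hdim hE hR
    (Module.finBasis ℝ (TangentSpace 𝓘(ℝ, E) p)) u v
  rw [hbp] at hb0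
  simp only [hdF, hgt, hJp, hgp, hP, hξp, hρp, hbp, hdρ] at hpde hpde' hcurv hric
  refine ⟨hν0, hb0, fun A τ hW ↦ ?_, fun X Y Z hX hY hZ ↦ ?_, fun x y ↦ ?_⟩
  -- Pairing the Weingarten formula with the radical vector $\xi$ removes the shape operator and
  -- leaves $\tau$.
  · have hτ : ∀ v : E, IsUmbilicGerm.transversalForm (coordEndo J (f p)) (coordForm g (f p))
        (christoffel D (f p)) (localMap E E' f p) (fieldCoord E p ξ) (alongCoord p (f p) f N) x₀ v
        = τ p v := by
      intro v
      have h1 := coord_covAlong (p := p) (p' := f p) D' (hfs p) hps hps'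
        (hloc.smooth_right.contMDiffAt (hUo.mem_nhds hp)) v
      rw [coord_self] at h1
      have hv : coord p p v = v := coord_self (E := E) (M := M) p v
      have h2 : coordCovAlong (localMap E E' f p) (christoffel D (f p))
          (alongCoord p (f p) f N) x₀ v = covAlong (I := 𝓘(ℝ, E)) f D' N p v := by
        refine Eq.trans ?_ ((congrArg (coordCovAlong (localMap E E' f p) (christoffel D' (f p))
          (alongCoord p (f p) f N) x₀) hv).symm.trans h1.symm)
        simp only [coordCovAlong]
        rw [← christoffel_associated hJg hD hD' hK (localMap_mem_target chart_mem_localDomain)]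
      rw [IsUmbilicGerm.transversalForm, hgt, h2, hdF, hξp]
      have h3 : associated J g (f p) (covAlong (I := 𝓘(ℝ, E)) f D' N p v)
          (mfderiv 𝓘(ℝ, E) 𝓘(ℝ, E') f p (ξ p)) = τ p v := by
        rw [hW p hp v, map_add, map_neg, map_smul, add_apply, neg_apply, smul_apply, hpair.1,
          hJg.associated_symm]
        have h4 := hrad (A p v)
        rw [induced] at h4
        rw [h4]
        simp
      exact h3
    simp only [hτ] at hpde hpde'
    refine ⟨fun v ↦ ?_, hpde, hpde'⟩
    have h5 := (hG.covariant_transversal hdim v).1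
    rw [hbp] at h5
    exact (hτ v).symm.trans (h5.trans (congrArg _ (hdb v)))
  · have h1 := coord_curvature C hps
      (((contMDiffAt_field_iff le_rfl hps).1 hX).differentiableAt (by simp))
      (((contMDiffAt_field_iff le_rfl hps).1 hY).differentiableAt (by simp))
      (((contMDiffAt_field_iff le_rfl hps).1 hZ).of_le (WithTop.coe_le_coe.2 le_top))
      hG.differentiableAt_connection
    simp only [coord_self] at h1
    exact (congrArg df h1).trans (hcurv (X p) (Y p) (Z p))
  · refine Eq.trans ?_ (hric x y)
    simp only [ricci]
    refine Finset.sum_congr rfl fun i _ ↦ ?_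
    rw [curvatureAt_eq_coordCurvature C hG.differentiableAt_connection]
    rfl

end Equations

end NordenLightlike

end

/-! ### The theorem in dimension $2n$ -/

theorem theorem3p3 (n : ℕ) (hn : 2 ≤ n)
    -- the ambient manifold, of dimension `2n`
    {Mbar : Type*} [TopologicalSpace Mbar] [T2Space Mbar] [SecondCountableTopology Mbar]
    [ChartedSpace (EuclideanSpace ℝ (Fin (2 * n))) Mbar]
    [IsManifold (𝓡 (2 * n)) ∞ Mbar]
    -- the hypersurface `f : M → Mbar`
    {M : Type*} [TopologicalSpace M] [T2Space M] [SecondCountableTopology M]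
    [ChartedSpace (EuclideanSpace ℝ (Fin (2 * n - 1))) M]
    [IsManifold (𝓡 (2 * n - 1)) ∞ M]
    (f : M → Mbar) (hf : Manifold.IsImmersion (𝓡 (2 * n - 1)) (𝓡 (2 * n)) ∞ f)
    -- the Kähler-Norden structure, with the Levi-Civita connections of `g` and of `g̃`
    (J : NordenLightlike.EndField (𝓡 (2 * n)) Mbar) (g : NordenLightlike.BilinField (𝓡 (2 * n)) Mbar)
    (D D' : NordenLightlike.AffineConnection (𝓡 (2 * n)) Mbar)
    (hJg : NordenLightlike.IsAlmostComplexNorden J g)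
    (hD : NordenLightlike.IsLeviCivita g D)
    (hD' : NordenLightlike.IsLeviCivita (NordenLightlike.associated J g) D')
    (hK : NordenLightlike.IsParallel D J)
    (ν ν' : Mbar → ℝ)
    (hν : NordenLightlike.HasConstantTotallyRealCurvatures J g D ν ν')
    -- `(M, g̃)` is a totally umbilical radical transversal lightlike hypersurface
    (S : NordenLightlike.ScreenDistribution (𝓡 (2 * n - 1)) f (NordenLightlike.associated J g))
    (hS : NordenLightlike.IsRadicalTransversalLightlike J S)
    (C : NordenLightlike.AffineConnection (𝓡 (2 * n - 1)) M)
    (hC : NordenLightlike.IsInducedConnection D' S C)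
    (hU : NordenLightlike.IsTotallyUmbilical D' S C) :
    (∀ p : M, ν' (f p) = 0) ∧
    ∀ (U : Set M) (ξ : ∀ q : M, TangentSpace (𝓡 (2 * n - 1)) q)
      (N : ∀ q : M, TangentSpace (𝓡 (2 * n)) (f q))
      (B : NordenLightlike.BilinField (𝓡 (2 * n - 1)) M)
      (A : NordenLightlike.EndField (𝓡 (2 * n - 1)) M)
      (τ : ∀ q : M, TangentSpace (𝓡 (2 * n - 1)) q →L[ℝ] ℝ) (b ρ : M → ℝ),
      IsOpen U →
      NordenLightlike.IsLocalPair S U ξ N →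
      NordenLightlike.GaussFormula f D' C U N B →
      NordenLightlike.WeingartenFormula f D' U N A τ →
      (∀ p ∈ U, J (f p) (mfderiv (𝓡 (2 * n - 1)) (𝓡 (2 * n)) f p (ξ p)) = b p • N p) →
      NordenLightlike.IsUmbilicalOn f (NordenLightlike.associated J g) U B ρ →
      ∀ p ∈ U,
        b p ≠ 0 ∧
        (∀ v, τ p v = -(1 / (2 * b p)) * mvfderiv (𝓡 (2 * n - 1)) b p v) ∧
        -- the partial differential equations of `ρ`
        b p * ν (f p) - ρ p ^ 2 + mvfderiv (𝓡 (2 * n - 1)) ρ p (ξ p) + ρ p * τ p (ξ p) = 0 ∧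
        (∀ v, mvfderiv (𝓡 (2 * n - 1)) ρ p (S.proj p v) + ρ p * τ p (S.proj p v) = 0) ∧
        -- the curvature tensor
        (∀ X Y Z : (∀ q : M, TangentSpace (𝓡 (2 * n - 1)) q),
          NordenLightlike.IsSmoothFieldAt X p → NordenLightlike.IsSmoothFieldAt Y p → NordenLightlike.IsSmoothFieldAt Z p →
          let df := mfderiv (𝓡 (2 * n - 1)) (𝓡 (2 * n)) f p
          let gt := NordenLightlike.associated J g (f p)
          df (NordenLightlike.curvature C X Y Z p) =
            (ν (f p) - ρ p ^ 2 / b p) •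
              (gt (df (X p)) (df (Z p)) • J (f p) (df (S.proj p (Y p)))
                - gt (df (Y p)) (df (Z p)) • J (f p) (df (S.proj p (X p))))
            + ν (f p) •
              (gt (df (X p)) (J (f p) (df (Z p))) • df (Y p)
                - gt (df (Y p)) (J (f p) (df (Z p))) • df (X p))) ∧
        -- the Ricci tensor
        (∀ x y : TangentSpace (𝓡 (2 * n - 1)) p,
          NordenLightlike.ricci C p x y =
            2 * ((n : ℝ) - 1) * ν (f p) * NordenLightlike.induced (𝓡 (2 * n - 1)) f g p x y
            - (ν (f p) - ρ p ^ 2 / b p) *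
              NordenLightlike.induced (𝓡 (2 * n - 1)) f g p (S.proj p x) (S.proj p y)) := by
  have hdim : Module.finrank ℝ (EuclideanSpace ℝ (Fin (2 * n)))
      = Module.finrank ℝ (EuclideanSpace ℝ (Fin (2 * n - 1))) + 1 := by
    rw [finrank_euclideanSpace_fin, finrank_euclideanSpace_fin]
    omega
  have hE : 2 ≤ Module.finrank ℝ (EuclideanSpace ℝ (Fin (2 * n - 1))) := by
    rw [finrank_euclideanSpace_fin]
    omega
  have hcast : (Module.finrank ℝ (EuclideanSpace ℝ (Fin (2 * n - 1))) : ℝ) - 1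
      = 2 * ((n : ℝ) - 1) := by
    rw [finrank_euclideanSpace_fin, Nat.cast_sub (by omega)]
    push_cast
    ring
  refine ⟨fun p ↦ ?_, fun U ξ N B A τ b ρ hUo hloc hgauss hW himage humb p hp ↦ ?_⟩
  -- The pair supplied by umbilicity comes without $b$, so $b=\tilde g(J\xi,\xi)$ is taken.
  · obtain ⟨U, hUo, hp, ξ, N, B, ρ, hloc, hgauss, humb⟩ := hU p
    exact (NordenLightlike.hypersurface_equations hdim hE hf hJg hD hD' hK hν hUo hloc hgauss
      (fun q hq ↦ NordenLightlike.endo_radical_eq hJg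
        (NordenLightlike.mfderiv_injective_of_isImmersionAt (hf.isImmersionAt q)) hdim
        (hloc.mem_radical q hq) (hloc.isTransversalPair q hq) hS) humb hp).1
  · obtain ⟨-, hb, hτ, hR, hRic⟩ := NordenLightlike.hypersurface_equations hdim hE hf hJg hD hD' hK
      hν hUo hloc hgauss himage humb hp
    obtain ⟨h1, h2, h3⟩ := hτ A τ hW
    rw [hcast] at hRic
    exact ⟨hb, h1, h2, h3, hR, hRic⟩
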